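/- **Setting.** Fix a dimension $n\ge 1$. A Riemannian manifold is a smooth (second countable, boundaryless, not necessarily connected) $n$-manifold with a continuous Riemannian metric; the distance $d_g$ is the infimum of lengths of $C^1$ curves ($\infty$ between different components), and $\operatorname{Vol}_g$ is the Riemannian volume. The limit manifold $M$ may be empty. Put $$v(x)=\operatorname{Vol}_g(B(x,1)),\quad v_{\min}(U)=\inf_U v,\quad v_{\max}(U)=\sup_U v,\quad \nu(x)=\inf_{0<r<1}\frac{\operatorname{Vol}_g(B(x,r))}{\omega_n r^n},$$ where $\omega_n$ is the volume of the Euclidean unit ball, and $\delta_g(U,V)=\inf_{u\in U,\,w\in V}d_g(u,w)$. For a subset $S$, $\pi_0(S)$ is the set of its connected components. *Collapsing graph.* Given $\epsilon>0$ and $\lambda_+>1>\lambda_0>\lambda_->0$, let $B=\{v\le\lambda_0\epsilon\}$, $C=\bigcup\{Z\in\pi_0(B): v_{\min}(Z)\le\lambda_-\epsilon\}$, $D=C\cup\bigcup\{Z\in\pi_0(\overline{M\setminus C}): v_{\max}(Z)\le\epsilon\}$. The vertices of $\Gamma_\epsilon(M,g)$ are $$V_\epsilon(M,g)=\pi_0(D)\cup\{Z\in\pi_0(\overline{M\setminus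 D}): v_{\max}(Z)>\lambda_+\epsilon\},$$ and two vertices $Z_1\ne Z_2$ are joined by an edge iff $\delta_g(Z_1,Z_2)<\infty$ and $\delta_g(Z_1,Z_2)<\delta_g(Z_1,Z_3)+\delta_g(Z_3,Z_2)$ for every vertex $Z_3\ne Z_1,Z_2$. *Convergence.* Let $\alpha\in(0,1)$. $(M_k,g_k)$ converges to $(M,g)$ in the volume exhausted $C^\alpha$ Cheeger–Gromov topology if for every $\eta>0$ there are an open set $\Omega\subset M$ with $\Omega\supset\{x\in M:\nu(x)>\eta\}$ and, for all sufficiently large $k$, $C^{1,\alpha}$ embeddings $f_k:\Omega\to M_k$ with $f_k(\Omega)\supset\{x\in M_k:\nu(x)>\eta\}$, such that $\Omega$ is covered by $C^{1,\alpha}$ coordinate charts in each of which the components of $f_k^*g_k-g$ tend to $0$ in the $C^{0,\alpha}$ norm. *Ends.* $M$ is a manifold with finitely many ends if there is a compact $n$-dimensional submanifold with boundary $K\subset M$ such that $M\setminus K$ is diffeomorphic to $\partial K\times(0,\infty)$. The ends of $M$ are the elements of $\varprojlim_{K'}\pi_0(M\setminus K')$, $K'\subset M$ compact. **Theorem.**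 Let $(M,g)$ be a complete Riemannian manifold with finitely many ends and $\operatorname{Vol}_g(M)<\infty$. There is $\epsilon_0>0$ such that for every $\epsilon\in(0,\epsilon_0)$ there are $\lambda_+>1>\lambda_0>\lambda_->0$ (depending only on $(M,g)$ and $\epsilon$) with the following properties, where all collapsing graphs are formed with these constants. 1. $\Gamma_\epsilon(M,g)$ is finite and depends only on the topology of $M$: it is isomorphic to the disjoint union, over the connected components $N$ of $M$, of a star whose center is $N$ and whose leaves are the ends of $N$. 2. The isomorphism is geometric: the vertex that is the center for $N$ is a subset of $N$, and the vertex that is the leaf for an end $e$ is a subset of the component of $e$ and contains a neighborhood of $e$. So every component of $M$ corresponds to a component of $\Gamma_\epsilon(M,g)$, which is a star with as many leaves as this component of $M$ has ends. 3. The centers of the stars are exactly the elements of $V^\alpha_\epsilon(M,g)=\{Z\in V_\epsilon(M,g): v_{\min}(Z)>0\}$, and the leaves are exactly the elements of $V^\omega_\epsilon(M,g)=\{Z\in V_\epsilon(M,g): v_{\min}(Z)=0\}$. 4. If $(M_k,g_k)$ is a sequence of complete Riemannian manifolds of finite volume that converges to $(M,g)$ in the volume exhausted $C^\alpha$ Cheeger–Gromov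 topology for some $\alpha\in(0,1)$, then for all sufficiently large $k$ there is a graph morphism $\varphi_k:V_\epsilon(M,g)\to V_\epsilon(M_k,g_k)$ (it maps edges to edges) that is injective on $V^\alpha_\epsilon(M,g)$. -/

import Mathlib

open Set Filter Topology MeasureTheory TopologicalSpace Manifold Bundle
open scoped Manifold ContDiff ENNReal NNReal

universe u

noncomputable section

/-! ### Components and ends of a topological space -/

/-- The set of connected components of a subset `S`, each component being regarded as a subset of
the ambient space. -/
def componentsOf {X : Type*} [TopologicalSpace X] (S : Set X) : Set (Set X) :=
  {Z | ∃ x ∈ S, Z = connectedComponentIn S x}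

/-- The connected components of the whole space. -/
abbrev SpaceComponent (X : Type*) [TopologicalSpace X] : Type _ :=
  {N : Set X // N ∈ componentsOf (univ : Set X)}

/-- The ends of a space: a compatible choice of a connected component of the complement of every
compact set (an element of the inverse limit of `π₀ (X ∖ K)` over the compact sets `K`). -/
def SpaceEnd (X : Type*) [TopologicalSpace X] : Type _ :=
  {e : Compacts X → Set X //
    (∀ K : Compacts X, e K ∈ componentsOf ((K : Set X)ᶜ)) ∧ ∀ K L : Compacts X, K ≤ L → e L ⊆ e K}

/-- The connected component of the space in which an end lies. -/
def SpaceEnd.component {X : Type*} [TopologicalSpace X] (e : SpaceEnd X) : SpaceComponent X :=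
  ⟨e.1 ⊥, by simpa using e.2.1 ⊥⟩

/-- The graph determined by the topology of `X`: the disjoint union, over the connected components
`N` of `X`, of a star with center `N` whose leaves are the ends of `N`. -/
def endStarGraph (X : Type*) [TopologicalSpace X] :
    SimpleGraph (SpaceComponent X ⊕ SpaceEnd X) where
  Adj a b := ∃ e : SpaceEnd X,
    (a = Sum.inl e.component ∧ b = Sum.inr e) ∨ (a = Sum.inr e ∧ b = Sum.inl e.component)
  symm := ⟨by
    rintro a b ⟨e, h | h⟩
    · exact ⟨e, Or.inr ⟨h.2, h.1⟩⟩
    · exact ⟨e, Or.inl ⟨h.2, h.1⟩⟩⟩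
  loopless := ⟨by
    rintro a ⟨e, ⟨h₁, h₂⟩ | ⟨h₁, h₂⟩⟩ <;> simp [h₁] at h₂⟩

/-! ### Manifolds with finitely many ends -/

/-- `K` is a closed `n`-dimensional smooth submanifold with boundary of the `n`-manifold `M`: around
every frontier point there is a smooth chart of `M` in which `K` is a half space. Around the
other points of `K`, which are interior, there is nothing to require. -/
def IsSmoothDomain (n : ℕ) [NeZero n] {M : Type*} [TopologicalSpace M]
    [ChartedSpace (EuclideanSpace ℝ (Fin n)) M] (K : Set M) : Prop :=
  IsClosed K ∧ ∀ x ∈ frontier K, ∃ φ ∈ IsManifold.maximalAtlas (𝓡 n) ∞ M,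
    x ∈ φ.source ∧ ∀ y ∈ φ.source, y ∈ K ↔ 0 ≤ φ y 0

/-- The open half line `(0, ∞)` as an open submanifold of `ℝ`. -/
def posHalfLine : Opens ℝ := ⟨Ioi 0, isOpen_Ioi⟩

/-- A manifold with finitely many ends: there is a compact `n`-dimensional submanifold with
boundary `K` such that `M ∖ K` is diffeomorphic to `∂K × (0, ∞)`. The smooth structure of the
hypersurface `∂K` is carried by a smooth embedding `ι : X → M` with image `∂K`. -/
def IsManifoldWithFinitelyManyEnds (n : ℕ) [NeZero n] (M : Type u) [TopologicalSpace M]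
    [ChartedSpace (EuclideanSpace ℝ (Fin n)) M] : Prop :=
  ∃ K : Closeds M, IsCompact (K : Set M) ∧ IsSmoothDomain n (K : Set M) ∧
    ∃ (X : Type u) (_ : TopologicalSpace X)
      (_ : ChartedSpace (EuclideanSpace ℝ (Fin (n - 1))) X) (_ : IsManifold (𝓡 (n - 1)) ∞ X)
      (ι : X → M), IsSmoothEmbedding (𝓡 (n - 1)) (𝓡 n) ∞ ι ∧ range ι = frontier (K : Set M) ∧
      Nonempty (Diffeomorph ((𝓡 (n - 1)).prod 𝓘(ℝ, ℝ)) (𝓡 n) (X × posHalfLine) K.compl ∞)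

/-! ### Volume collapsing -/

section Volume

variable (n : ℕ) {M : Type*} [EMetricSpace M] [MeasurableSpace M] [BorelSpace M]

/-- The Riemannian volume measure of an `n`-dimensional Riemannian manifold: the `n`-dimensional
Hausdorff measure of the Riemannian distance, normalized so that it is Lebesgue measure on
Euclidean `n`-space. -/
def riemVol : Measure M := Measure.euclideanHausdorffMeasure n

/-- The volume collapsing function `ν(x) = inf_{0 < r < 1} Vol(B(x,r)) / (ω_n r^n)`. -/
def volCollapse (x : M) : ℝ≥0∞ :=
  ⨅ r ∈ Ioo (0 : ℝ) 1, riemVol n (Metric.eball x (ENNReal.ofReal r)) /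
    (volume (Metric.ball (0 : EuclideanSpace ℝ (Fin n)) 1) * ENNReal.ofReal (r ^ n))

/-- `v(x) = Vol(B(x,1))`. -/
def unitBallVol (x : M) : ℝ≥0∞ := riemVol n (Metric.eball x 1)

/-- `v_min(U) = inf_{x ∈ U} Vol(B(x,1))`. -/
def vMin (U : Set M) : ℝ≥0∞ := ⨅ x ∈ U, unitBallVol n x

/-- `v_max(U) = sup_{x ∈ U} Vol(B(x,1))`. -/
def vMax (U : Set M) : ℝ≥0∞ := ⨆ x ∈ U, unitBallVol n x

/-! ### The collapsing graph -/

variable (M)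

/-- `C`: the union of the components `Z` of `B = {v ≤ λ₀ ε}` with `v_min(Z) ≤ λ₋ ε`. -/
def collapsedCore (ε lamMinus lamZero : ℝ) : Set M :=
  ⋃₀ {Z | Z ∈ componentsOf {x : M | unitBallVol n x ≤ ENNReal.ofReal (lamZero * ε)} ∧
    vMin n Z ≤ ENNReal.ofReal (lamMinus * ε)}

/-- `D`: the union of `C` and of the components `Z` of `closure (M ∖ C)` with `v_max(Z) ≤ ε`. -/
def collapsedRegion (ε lamMinus lamZero : ℝ) : Set M :=
  collapsedCore n M ε lamMinus lamZero ∪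
    ⋃₀ {Z | Z ∈ componentsOf (closure (collapsedCore n M ε lamMinus lamZero)ᶜ) ∧
      vMax n Z ≤ ENNReal.ofReal ε}

/-- The vertices: the components of `D`, and the components `Z` of `closure (M ∖ D)` with
`v_max(Z) > λ₊ ε`. -/
def collapsingVertices (ε lamMinus lamZero lamPlus : ℝ) : Set (Set M) :=
  componentsOf (collapsedRegion n M ε lamMinus lamZero) ∪
    {Z | Z ∈ componentsOf (closure (collapsedRegion n M ε lamMinus lamZero)ᶜ) ∧
      ENNReal.ofReal (lamPlus * ε) < vMax n Z}

end Volume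

/-- `δ(U, V) = inf_{u ∈ U, v ∈ V} d(u, v)`. -/
def setDist {M : Type*} [EMetricSpace M] (U V : Set M) : ℝ≥0∞ :=
  ⨅ u ∈ U, ⨅ v ∈ V, edist u v

theorem setDist_comm {M : Type*} [EMetricSpace M] (U V : Set M) : setDist U V = setDist V U := by
  unfold setDist
  rw [iInf₂_comm]
  simp only [edist_comm]

/-- The collapsing graph `Γ_ε(M, g)`. Distinct vertices `Z₁`, `Z₂` at finite distance are joined by
an edge if and only if `δ(Z₁, Z₂) < δ(Z₁, Z₃) + δ(Z₃, Z₂)` for all further vertices `Z₃`. -/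
def collapsingGraph (n : ℕ) (M : Type*) [EMetricSpace M] [MeasurableSpace M] [BorelSpace M]
    (ε lamMinus lamZero lamPlus : ℝ) :
    SimpleGraph (collapsingVertices n M ε lamMinus lamZero lamPlus) where
  Adj Z₁ Z₂ := Z₁ ≠ Z₂ ∧ setDist Z₁.1 Z₂.1 < ⊤ ∧ ∀ Z₃, Z₃ ≠ Z₁ → Z₃ ≠ Z₂ →
    setDist Z₁.1 Z₂.1 < setDist Z₁.1 Z₃.1 + setDist Z₃.1 Z₂.1
  symm := ⟨by
    rintro Z₁ Z₂ ⟨h, h', h''⟩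
    refine ⟨h.symm, by rwa [setDist_comm], fun Z₃ h₁ h₂ => ?_⟩
    have := h'' Z₃ h₂ h₁
    rwa [setDist_comm Z₂.1 Z₁.1, setDist_comm Z₂.1 Z₃.1, setDist_comm Z₃.1 Z₁.1, add_comm]⟩
  loopless := ⟨fun _ h => h.1 rfl⟩

/-! ### Volume exhausted convergence -/

section Convergence

variable (n : ℕ)

/-- The map `f` between `n`-manifolds is of class `C^{1,α}` on the open set `Ω`: it is `C¹` and its
first derivatives, in charts, are locally Hölder continuous with exponent `α`. -/
def IsC1HolderOn (α : ℝ≥0)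
    {M : Type*} [TopologicalSpace M] [ChartedSpace (EuclideanSpace ℝ (Fin n)) M]
    {N : Type*} [TopologicalSpace N] [ChartedSpace (EuclideanSpace ℝ (Fin n)) N]
    (f : M → N) (Ω : Set M) : Prop :=
  ContMDiffOn (𝓡 n) (𝓡 n) 1 f Ω ∧
    ∀ x ∈ Ω, ∃ U ∈ 𝓝 (extChartAt (𝓡 n) x x), ∃ C : ℝ≥0,
      HolderOnWith C α (fderiv ℝ (writtenInExtChartAt (𝓡 n) (𝓡 n) x f)) U

/-- `f` restricts to a `C^{1,α}` embedding of the open set `Ω`. -/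
def IsC1HolderEmbeddingOn (α : ℝ≥0)
    {M : Type*} [TopologicalSpace M] [ChartedSpace (EuclideanSpace ℝ (Fin n)) M]
    {N : Type*} [TopologicalSpace N] [ChartedSpace (EuclideanSpace ℝ (Fin n)) N]
    (f : M → N) (Ω : Set M) : Prop :=
  IsC1HolderOn n α f Ω ∧ (∀ x ∈ Ω, Function.Injective (mfderiv (𝓡 n) (𝓡 n) f x)) ∧
    IsEmbedding (Ω.domRestrict f)

/-- A `C^{1,α}` coordinate chart of the `n`-manifold `M`. -/
def IsC1HolderChart (α : ℝ≥0)
    {M : Type*} [TopologicalSpace M] [ChartedSpace (EuclideanSpace ℝ (Fin n)) M]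
    (φ : OpenPartialHomeomorph M (EuclideanSpace ℝ (Fin n))) : Prop :=
  IsC1HolderOn n α φ φ.source ∧ IsC1HolderOn n α φ.symm φ.target

/-- The components `(F^* g)_{ij}(y) = g(∂_i F(y), ∂_j F(y))` of the pullback of the Riemannian
metric of `N` along a map `F` from Euclidean space. -/
def pullbackMetric {N : Type*} [TopologicalSpace N] [ChartedSpace (EuclideanSpace ℝ (Fin n)) N]
    [RiemannianBundle (fun x : N ↦ TangentSpace (𝓡 n) x)]
    (F : EuclideanSpace ℝ (Fin n) → N) (y : EuclideanSpace ℝ (Fin n)) : Fin n → Fin n → ℝ :=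
  fun i j => inner ℝ
    (mfderiv (𝓡 n) (𝓡 n) F y (EuclideanSpace.single i (1 : ℝ) : EuclideanSpace ℝ (Fin n)))
    (mfderiv (𝓡 n) (𝓡 n) F y (EuclideanSpace.single j (1 : ℝ) : EuclideanSpace ℝ (Fin n)))

/-- The `C^{0,α}` norm on `V` (possibly infinite): the supremum norm plus the Hölder seminorm. -/
def holderNormOn (α : ℝ≥0) (V : Set (EuclideanSpace ℝ (Fin n)))
    (T : EuclideanSpace ℝ (Fin n) → Fin n → Fin n → ℝ) : ℝ≥0∞ :=
  (⨆ y ∈ V, ‖T y‖ₑ) + ⨆ y ∈ V, ⨆ z ∈ V, ‖T y - T z‖ₑ / edist y z ^ (α : ℝ)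

/-- `f_k^* g_k` converges to `g` on the open set `Ω` in the `C^{0,α}` topology: `Ω` is covered by
`C^{1,α}` charts, in each of which the components converge in the `C^{0,α}` norm. -/
def PullbackMetricsTendsto (α : ℝ≥0)
    {M : Type*} [TopologicalSpace M] [ChartedSpace (EuclideanSpace ℝ (Fin n)) M]
    [RiemannianBundle (fun x : M ↦ TangentSpace (𝓡 n) x)]
    (N : ℕ → Type*) [∀ k, TopologicalSpace (N k)]
    [∀ k, ChartedSpace (EuclideanSpace ℝ (Fin n)) (N k)]
    [∀ k, RiemannianBundle (fun x : N k ↦ TangentSpace (𝓡 n) x)]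
    (Ω : Set M) (f : ∀ k, M → N k) : Prop :=
  ∃ S : Set (OpenPartialHomeomorph M (EuclideanSpace ℝ (Fin n))),
    (⋃ φ ∈ S, φ.source) = Ω ∧ ∀ φ ∈ S, IsC1HolderChart n α φ ∧
      Tendsto (fun k => holderNormOn n α φ.target
        (fun y => pullbackMetric n (f k ∘ φ.symm) y - pullbackMetric n φ.symm y)) atTop (𝓝 0)

/-- `(N k)` converges to `M` in the volume exhausted `C^α` Cheeger–Gromov topology. The embeddings
are defined for all indices `k₀ + j`, that is, for all sufficiently large indices; only their
restrictions to `Ω` matter. -/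
def VolumeExhaustedTendsto (α : ℝ≥0)
    (N : ℕ → Type*) [∀ k, EMetricSpace (N k)]
    [∀ k, MeasurableSpace (N k)] [∀ k, BorelSpace (N k)]
    [∀ k, ChartedSpace (EuclideanSpace ℝ (Fin n)) (N k)]
    [∀ k, RiemannianBundle (fun x : N k ↦ TangentSpace (𝓡 n) x)]
    (M : Type*) [EMetricSpace M] [MeasurableSpace M] [BorelSpace M]
    [ChartedSpace (EuclideanSpace ℝ (Fin n)) M]
    [RiemannianBundle (fun x : M ↦ TangentSpace (𝓡 n) x)] : Prop :=
  ∀ ε : ℝ, 0 < ε → ∃ Ω : Set M, IsOpen Ω ∧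
    {x | ENNReal.ofReal ε < volCollapse n x} ⊆ Ω ∧
    ∃ (k₀ : ℕ) (f : ∀ j, M → N (k₀ + j)),
      (∀ j, IsC1HolderEmbeddingOn n α (f j) Ω ∧
        {x | ENNReal.ofReal ε < volCollapse n x} ⊆ f j '' Ω) ∧
      PullbackMetricsTendsto n α (fun j => N (k₀ + j)) Ω f

end Convergence

end

noncomputable section

/-! ### Compact connected sets -/

/-! Completeness and finite volume force `v` to tend to zero at infinity: closed bounded
neighborhoods of compact sets are compact (Hopf-Rinow), so a unit ball centered far away misses a
compact set that carries almost all of the volume. On the other hand `v` is positive and lower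
semicontinuous, hence bounded below on compact sets. So each component of `M` is a thick core with
finitely many thin ends, and the constants are chosen in alternation (`exists_volumeCore`): `ε₀`
below the volumes on a compact `L` that meets every component; for given `ε`, a compact `Q ⊇ L`,
connected in each component, with volumes at most `ε` outside; `λ₀` with `v > λ₀ε` on `Q`; a level
of the ends beyond which `v ≤ λ₀ε`; a larger compact `I`; `λ₋` with `v > λ₋ε` on `I`; and connected
collars `R j` along the edge of `I` that reach out to a point with `v ≤ λ₋ε`.

The rest is topology, packaged in `CoreFit`. The collars lie in `C`, and `Q` misses `D`. A piece of
`D` between `Q` and a collar belongs to the component of that collar, the leaf (`mem_leaf`):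
otherwise it would be trapped in the compact `I`, where `v > λ₋ε`, or give a clopen subset of `M`
that misses `Q`. The collar is a barrier inside `D`, so the component of the closure of the
complement of `D` through `Q ∩ N`, the center of `N`, stays in `I` (`center_subset`). A path from
the collar to `Q` shows that center and leaf touch (`nonempty_center_inter_leaf`). Every further
vertex has positive distance to one of the two, so they are adjacent (`adj_center_leaf`). Two leaves
at one center are not adjacent, since the detour through the center has length zero.

All this is done for a map `f` from `M` to a manifold `P`. The identity gives the isomorphism with
the star graph. For a convergent sequence, `f` is an embedding that distorts lengths on a large
compact set by a factor of at most `2`, so the volume of the unit ball at `f x` lies between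
`lowerVol n x` and `upperVol n x`. The constants are chosen with these two bounds and hence serve
every sequence. Beyond the image of `f` two leaves may be connected in `M_k`; the centers are kept
apart by the injectivity of `f`. -/

theorem IsPreconnected.subset_or_disjoint_of_frontier {X : Type*} [TopologicalSpace X]
    {S G : Set X} (hS : IsPreconnected S) (h : Disjoint S (frontier G)) :
    S ⊆ interior G ∨ Disjoint S G := by
  by_cases hSG : Disjoint S G
  · exact Or.inr hSG
  left
  have hcov : S ⊆ interior G ∪ (closure G)ᶜ := by
    intro x hx
    by_cases hxc : x ∈ closure G
    · by_cases hxi : x ∈ interior G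
      · exact Or.inl hxi
      · exact absurd ⟨hxc, hxi⟩ (h.notMem_of_mem_left hx)
    · exact Or.inr hxc
  refine hS.subset_left_of_subset_union isOpen_interior isClosed_closure.isOpen_compl ?_ hcov ?_
  · exact disjoint_compl_right.mono_left (interior_subset.trans subset_closure)
  · obtain ⟨x, hxS, hxG⟩ := not_disjoint_iff.1 hSG
    refine ⟨x, hxS, ?_⟩
    rcases hcov hxS with hx | hx
    · exact hx
    · exact absurd (subset_closure hxG) hx

/-- Being joined to a base point by a compact connected subset of `U` is a relatively clopen
condition, so it holds on all of `U`. Finitely many such sets, enlarged by closures of small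
connected neighborhoods, cover `K`. -/
theorem exists_isCompact_isConnected_superset {X : Type*} [TopologicalSpace X] [T2Space X]
    [LocallyCompactSpace X] [LocallyConnectedSpace X] {U K : Set X} (hU : IsOpen U)
    (hUc : IsConnected U) (hK : IsCompact K) (hKU : K ⊆ U) :
    ∃ K', IsCompact K' ∧ IsConnected K' ∧ K ⊆ K' ∧ K' ⊆ U := by
  have hloc : ∀ x ∈ U, ∃ V, IsOpen V ∧ x ∈ V ∧ IsConnected V ∧ IsCompact (closure V) ∧
      closure V ⊆ U := by
    intro x hx
    obtain ⟨W, hW, hWU, hWc⟩ := local_compact_nhds (hU.mem_nhds hx)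
    obtain ⟨V, hVW, hVo, hxV, hVc⟩ :=
      (locallyConnectedSpace_iff_subsets_isOpen_isConnected.1 ‹_›) x W hW
    have hcl : closure V ⊆ W := closure_minimal hVW hWc.isClosed
    exact ⟨V, hVo, hxV, hVc, hWc.of_isClosed_subset isClosed_closure hcl, hcl.trans hWU⟩
  obtain ⟨x₀, hx₀⟩ := hUc.nonempty
  let S : Set X := {y | ∃ C, IsCompact C ∧ IsConnected C ∧ C ⊆ U ∧ x₀ ∈ C ∧ y ∈ C}
  have key : ∀ x ∈ U, ∀ V, IsConnected V → IsCompact (closure V) → closure V ⊆ U →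
      (V ∩ S).Nonempty → V ⊆ S := by
    rintro x - V hVc hVk hVU ⟨y, hyV, C, hCk, hCc, hCU, hx₀C, hyC⟩ z hz
    refine ⟨C ∪ closure V, hCk.union hVk, ?_, union_subset hCU hVU, Or.inl hx₀C,
      Or.inr (subset_closure hz)⟩
    exact hCc.union ⟨y, hyC, subset_closure hyV⟩ hVc.closure
  have hSU : U ⊆ S := by
    have h₁ : IsOpen (U ∩ S) := by
      rw [isOpen_iff_mem_nhds]
      rintro x ⟨hxU, hxS⟩
      obtain ⟨V, hVo, hxV, hVc, hVk, hVU⟩ := hloc x hxU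
      exact mem_of_superset (hVo.mem_nhds hxV) (subset_inter (subset_closure.trans hVU)
        (key x hxU V hVc hVk hVU ⟨x, hxV, hxS⟩))
    have h₂ : IsOpen (U \ S) := by
      rw [isOpen_iff_mem_nhds]
      rintro x ⟨hxU, hxS⟩
      obtain ⟨V, hVo, hxV, hVc, hVk, hVU⟩ := hloc x hxU
      refine mem_of_superset (hVo.mem_nhds hxV) fun y hy => ⟨hVU (subset_closure hy), fun hyS => ?_⟩
      exact hxS (key x hxU V hVc hVk hVU ⟨y, hy, hyS⟩ hxV)
    have := hUc.isPreconnected.subset_left_of_subset_union h₁ h₂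
      (disjoint_left.2 fun x hx hx' => hx'.2 hx.2) (by rw [inter_union_sdiff])
      ⟨x₀, hx₀, hx₀, {x₀}, isCompact_singleton, isConnected_singleton, by simpa, rfl, rfl⟩
    exact this.trans inter_subset_right
  choose! V hVo hxV hVc hVk hVU using hloc
  obtain ⟨t, ht⟩ := hK.elim_nhds_subcover' (fun x _ => V x)
    (fun x hx => (hVo x (hKU hx)).mem_nhds (hxV x (hKU hx)))
  have hCx : ∀ x : K, ∃ C, IsCompact C ∧ IsConnected C ∧ C ⊆ U ∧ x₀ ∈ C ∧ (x : X) ∈ C :=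
    fun x => hSU (hKU x.2)
  choose C hCk hCc hCU hx₀C hxC using hCx
  refine ⟨{x₀} ∪ ⋃ x ∈ t, (C x ∪ closure (V x)), ?_, ?_, ?_, ?_⟩
  · exact isCompact_singleton.union
      (t.isCompact_biUnion fun x _ => (hCk x).union (hVk x (hKU x.2)))
  · have hconn : ∀ x : K, IsConnected (C x ∪ closure (V x)) := fun x =>
      (hCc x).union ⟨x, hxC x, subset_closure (hxV x (hKU x.2))⟩ (hVc x (hKU x.2)).closure
    refine ⟨⟨x₀, Or.inl rfl⟩, ?_⟩
    refine isPreconnected_of_forall x₀ ?_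
    rintro y (rfl | hy)
    · exact ⟨{y}, subset_union_left, rfl, rfl, isPreconnected_singleton⟩
    · obtain ⟨x, hx, hxy⟩ := mem_iUnion₂.1 hy
      exact ⟨_, subset_union_of_subset_right (subset_biUnion_of_mem (u := fun x => C x ∪ closure (V x)) hx) _,
        Or.inl (hx₀C x), hxy, (hconn x).isPreconnected⟩
  · intro x hx
    obtain ⟨y, hy, hxy⟩ := mem_iUnion₂.1 (ht hx)
    exact Or.inr (mem_iUnion₂.2 ⟨y, hy, Or.inr (subset_closure hxy)⟩)
  · refine union_subset (by simpa using hx₀) (iUnion₂_subset fun x _ => ?_)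
    exact union_subset (hCU x) (hVU x (hKU x.2))

/-! ### Components of subsets -/

section Components

variable {X : Type*} [TopologicalSpace X] {S Z Z' T : Set X} {x : X}

theorem connectedComponentIn_mem_componentsOf (hx : x ∈ S) :
    connectedComponentIn S x ∈ componentsOf S :=
  ⟨x, hx, rfl⟩

theorem componentsOf_subset (hZ : Z ∈ componentsOf S) : Z ⊆ S := by
  obtain ⟨x, -, rfl⟩ := hZ
  exact connectedComponentIn_subset S x

theorem isConnected_of_mem_componentsOf (hZ : Z ∈ componentsOf S) : IsConnected Z := by
  obtain ⟨x, hx, rfl⟩ := hZ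
  exact isConnected_connectedComponentIn_iff.2 hx

theorem eq_connectedComponentIn_of_mem (hZ : Z ∈ componentsOf S) (hx : x ∈ Z) :
    Z = connectedComponentIn S x := by
  obtain ⟨y, hy, rfl⟩ := hZ
  exact connectedComponentIn_eq hx

theorem eq_of_mem_componentsOf (hZ : Z ∈ componentsOf S) (hZ' : Z' ∈ componentsOf S)
    (hx : x ∈ Z) (hx' : x ∈ Z') : Z = Z' :=
  (eq_connectedComponentIn_of_mem hZ hx).trans (eq_connectedComponentIn_of_mem hZ' hx').symm

theorem IsPreconnected.subset_of_mem_componentsOf (hT : IsPreconnected T) (hTS : T ⊆ S)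
    (hZ : Z ∈ componentsOf S) (hxT : x ∈ T) (hxZ : x ∈ Z) : T ⊆ Z := by
  rw [eq_connectedComponentIn_of_mem hZ hxZ]
  exact hT.subset_connectedComponentIn hxT hTS

theorem IsClosed.of_mem_componentsOf (hS : IsClosed S) (hZ : Z ∈ componentsOf S) : IsClosed Z := by
  refine isClosed_of_closure_subset ?_
  obtain ⟨x, hx⟩ := (isConnected_of_mem_componentsOf hZ).nonempty
  exact (isConnected_of_mem_componentsOf hZ).isPreconnected.closure.subset_of_mem_componentsOf
    (closure_minimal (componentsOf_subset hZ) hS) hZ (subset_closure hx) hx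

theorem IsOpen.of_mem_componentsOf [LocallyConnectedSpace X] (hS : IsOpen S)
    (hZ : Z ∈ componentsOf S) : IsOpen Z := by
  obtain ⟨x, -, rfl⟩ := hZ
  exact hS.connectedComponentIn

end Components

/-! ### Neighborhoods of the ends -/

/-- A complete system of disjoint neighborhoods of the ends of `X`, indexed by `J`. -/
structure EndData (X : Type*) [TopologicalSpace X] (J : Type*) where
  /-- The `s`-th neighborhood of the `j`-th end. -/
  E : J → ℕ → Set X
  isOpen : ∀ j s, IsOpen (E j s)
  isConnected : ∀ j s, IsConnected (E j s)
  antitone : ∀ j, Antitone (E j)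
  disjoint : ∀ i j, i ≠ j → Disjoint (E i 0) (E j 0)
  isCompact_compl : ∀ s, IsCompact (⋃ j, E j s)ᶜ
  exists_disjoint : ∀ K, IsCompact K → ∃ s, ∀ j, Disjoint (E j s) K

namespace EndData

/-- The two ends of the open half line. -/
def halfLine : EndData posHalfLine Bool where
  -- The index `true` is the end at infinity, `false` the end at zero. The shift by one makes the
  -- sets of level zero, `(1, ∞)` and `(0, 1)`, disjoint.
  E b s := Subtype.val ⁻¹' (bif b then Ioi ((s : ℝ) + 1) else Iio (1 / ((s : ℝ) + 1)))
  isOpen b s := by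
    cases b
    · exact isOpen_Iio.preimage continuous_subtype_val
    · exact isOpen_Ioi.preimage continuous_subtype_val
  isConnected b s := by
    have hs : (0 : ℝ) < (s : ℝ) + 1 := by positivity
    have hs' : (0 : ℝ) < 1 / ((s : ℝ) + 1) := by positivity
    have hconn : ∀ T : Set ℝ, IsConnected (Ioi 0 ∩ T) →
        IsConnected (Subtype.val ⁻¹' T : Set posHalfLine) := by
      intro T hT
      have himg : (Subtype.val '' (Subtype.val ⁻¹' T : Set posHalfLine) : Set ℝ) = Ioi 0 ∩ T :=
        Subtype.image_preimage_coe _ _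
      refine ⟨?_, ?_⟩
      · rw [← image_nonempty (f := Subtype.val), himg]
        exact hT.nonempty
      · exact IsInducing.subtypeVal.isPreconnected_image.1
          ((congrArg IsPreconnected himg).mpr hT.isPreconnected)
    cases b
    · refine hconn _ ?_
      rw [cond_false, Ioi_inter_Iio]
      exact isConnected_Ioo hs'
    · refine hconn _ ?_
      rw [cond_true, Ioi_inter_Ioi, sup_eq_right.2 hs.le]
      exact isConnected_Ioi
  antitone b := by
    intro s s' h
    have h' : (s : ℝ) ≤ s' := by exact_mod_cast h
    cases b
    · exact preimage_mono (Iio_subset_Iio (one_div_le_one_div_of_le (by positivity) (by linarith)))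
    · exact preimage_mono (Ioi_subset_Ioi (by linarith))
  disjoint i j h := by
    have h₁ : ∀ x : ℝ, 1 < x → 1 ≤ x := fun x h => h.le
    have h₂ : ∀ x : ℝ, x < 1 → x ≤ 1 := fun x h => h.le
    cases i <;> cases j <;> simp_all [disjoint_left]
  isCompact_compl s := by
    have hs : (0 : ℝ) < 1 / ((s : ℝ) + 1) := by positivity
    have : (Subtype.val '' (⋃ b : Bool, (Subtype.val ⁻¹' (bif b then Ioi ((s : ℝ) + 1)
        else Iio (1 / ((s : ℝ) + 1))) : Set posHalfLine))ᶜ : Set ℝ) =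
        Icc (1 / ((s : ℝ) + 1)) ((s : ℝ) + 1) := by
      ext x
      simp only [mem_image, mem_compl_iff, mem_iUnion, Bool.exists_bool, mem_preimage, not_or,
        cond_true, cond_false, mem_Ioi, mem_Iio, not_lt, mem_Icc, Subtype.exists, exists_and_left,
        exists_prop, exists_eq_right_right]
      constructor
      · rintro ⟨h₁, h₂⟩
        exact h₁
      · intro h
        exact ⟨h, hs.trans_le h.1⟩
    exact IsInducing.subtypeVal.isCompact_iff.2 ((congrArg IsCompact this).mpr isCompact_Icc)
  exists_disjoint K hK := by
    have hK' : IsCompact (Subtype.val '' K : Set ℝ) := hK.image continuous_subtype_val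
    obtain ⟨b, hb⟩ := hK'.bddAbove
    -- Inversion moves the end at zero to infinity, so an upper bound for the inverses keeps `K`
    -- away from zero.
    have hinv : IsCompact ((fun x : posHalfLine => (x : ℝ)⁻¹) '' K) := by
      refine hK.image ?_
      exact continuous_subtype_val.inv₀ fun x => ne_of_gt x.2
    obtain ⟨a, ha⟩ := hinv.bddAbove
    obtain ⟨s, hs⟩ := exists_nat_ge (max a b)
    refine ⟨s, fun c => disjoint_left.2 fun x hx hxK => ?_⟩
    have h₁ : (x : ℝ) ≤ b := hb ⟨x, hxK, rfl⟩
    have h₂ : (x : ℝ)⁻¹ ≤ a := ha ⟨x, hxK, rfl⟩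
    have hx0 : (0 : ℝ) < x := x.2
    cases c
    · have h₃ : (x : ℝ) < 1 / ((s : ℝ) + 1) := hx
      rw [lt_one_div hx0 (by positivity), one_div] at h₃
      linarith [le_max_left a b]
    · have h₃ : (s : ℝ) + 1 < x := hx
      linarith [le_max_right a b]

/-- The ends of the product of a compact space with `Y`. -/
def prodLeft {Y : Type*} [TopologicalSpace Y] {J : Type*} (𝓔 : EndData Y J) (X : Type*)
    [TopologicalSpace X] [CompactSpace X] [LocallyConnectedSpace X] :
    EndData (X × Y) (ConnectedComponents X × J) where
  E j s := (ConnectedComponents.mk ⁻¹' {j.1}) ×ˢ 𝓔.E j.2 s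
  isOpen j s := ((isOpen_discrete _).preimage ConnectedComponents.continuous_coe).prod
    (𝓔.isOpen _ _)
  isConnected j s := by
    obtain ⟨x, hx⟩ := ConnectedComponents.surjective_coe j.1
    refine IsConnected.prod ?_ (𝓔.isConnected _ _)
    rw [← hx, connectedComponents_preimage_singleton]
    exact isConnected_connectedComponent
  antitone j := fun s s' h => prod_mono_right (𝓔.antitone _ h)
  disjoint i j h := by
    rw [Set.disjoint_prod]
    by_cases h₁ : i.1 = j.1
    · exact Or.inr (𝓔.disjoint _ _ fun h₂ => h (Prod.ext h₁ h₂))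
    · exact Or.inl (Disjoint.preimage _ (by simpa using h₁))
  isCompact_compl s := by
    convert! (isCompact_univ (X := X)).prod (𝓔.isCompact_compl s) using 1
    ext p
    simp only [mem_compl_iff, mem_iUnion, mem_prod, mem_preimage, mem_singleton_iff, Prod.exists,
      not_exists, not_and, mem_univ, true_and]
    exact ⟨fun h j => h _ j rfl, fun h _ j _ => h j⟩
  exists_disjoint K hK := by
    obtain ⟨s, hs⟩ := 𝓔.exists_disjoint _ (hK.image continuous_snd)
    exact ⟨s, fun j => disjoint_left.2 fun p hp hpK =>
      (hs j.2).notMem_of_mem_left hp.2 ⟨p, hpK, rfl⟩⟩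

/-- The ends of a space are among the ends of the complement of a compact set. -/
theorem exists_of_isOpenEmbedding {Y M J : Type*} [TopologicalSpace Y] [TopologicalSpace M]
    [T2Space M] [LocallyCompactSpace M] [Finite J] (𝓔 : EndData Y J) {g : Y → M}
    (hg : IsOpenEmbedding g) {K : Set M} (hK : IsCompact K) (hr : range g = Kᶜ) :
    ∃ J' : Set J, Nonempty (EndData M J') := by
  have hfr : IsCompact (frontier K) := hK.of_isClosed_subset isClosed_frontier
    hK.isClosed.frontier_subset
  -- Some ends of `Y` may run into `K` rather than to infinity, and `g` does not tell which. They
  -- are sorted by a compact neighborhood `G` of the frontier of `K`.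
  obtain ⟨G, hG, hKG⟩ := exists_compact_superset hfr
  have hpre : ∀ F : Set M, IsCompact F → F ⊆ Kᶜ → IsCompact (g ⁻¹' F) := by
    intro F hF hFK
    exact hg.isInducing.isCompact_preimage' hF (hr ▸ hFK)
  have hbd : ∀ x, x ∈ K → x ∉ interior K → x ∈ interior G := fun x hx hx' =>
    hKG ⟨subset_closure hx, hx'⟩
  -- This compact set misses `K`, because the frontier of `K` lies in the interior of `G`. Far out,
  -- the connected neighborhoods avoid it and so cannot cross the frontier of `G`.
  obtain ⟨s₀, hs₀⟩ := 𝓔.exists_disjoint (g ⁻¹' (frontier G \ interior K))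
    (hpre _ ((hG.of_isClosed_subset isClosed_frontier hG.isClosed.frontier_subset).diff
      isOpen_interior) fun x hx hxK => hx.1.2 (hbd x hxK hx.2))
  have hgK : ∀ y, g y ∉ K := fun y => by
    have : g y ∈ Kᶜ := hr ▸ mem_range_self y
    exact this
  have hdich : ∀ j, g '' 𝓔.E j s₀ ⊆ interior G ∨ Disjoint (g '' 𝓔.E j s₀) G := by
    intro j
    refine ((𝓔.isConnected j s₀).image g hg.continuous.continuousOn).isPreconnected
      |>.subset_or_disjoint_of_frontier ?_
    rw [disjoint_left]
    rintro _ ⟨y, hy, rfl⟩ hyG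
    exact (hs₀ j).notMem_of_mem_left hy ⟨hyG, fun h => hgK y (interior_subset h)⟩
  refine ⟨{j | Disjoint (g '' 𝓔.E j s₀) G}, ⟨?_⟩⟩
  refine
    { E := fun j s => g '' 𝓔.E j (s + s₀)
      isOpen := fun j s => hg.isOpenMap _ (𝓔.isOpen _ _)
      isConnected := fun j s => (𝓔.isConnected _ _).image g hg.continuous.continuousOn
      antitone := fun j s s' h => image_mono (𝓔.antitone _ (by omega))
      disjoint := ?_
      isCompact_compl := ?_
      exists_disjoint := ?_ }
  · intro i j h
    rw [disjoint_image_iff hg.injective]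
    exact (𝓔.disjoint i.1 j.1 fun h' => h (Subtype.ext h')).mono (𝓔.antitone _ (Nat.zero_le _))
      (𝓔.antitone _ (Nat.zero_le _))
  · intro s
    refine ((hK.union hG).union ((𝓔.isCompact_compl (s + s₀)).image hg.continuous)).of_isClosed_subset
      (isOpen_iUnion fun j => hg.isOpenMap _ (𝓔.isOpen _ _)).isClosed_compl ?_
    intro x hx
    by_cases hxK : x ∈ K
    · exact Or.inl (Or.inl hxK)
    obtain ⟨y, rfl⟩ : x ∈ range g := by rw [hr]; exact hxK
    by_cases hy : y ∈ ⋃ j, 𝓔.E j (s + s₀)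
    · obtain ⟨j, hj⟩ := mem_iUnion.1 hy
      rcases hdich j with h | h
      · exact Or.inl (Or.inr (interior_subset (h (mem_image_of_mem g
          (𝓔.antitone _ (Nat.le_add_left s₀ s) hj)))))
      · exact (hx (mem_iUnion.2 ⟨⟨j, h⟩, y, hj, rfl⟩)).elim
    · exact Or.inr ⟨y, hy, rfl⟩
  · intro K' hK'
    obtain ⟨s, hs⟩ := 𝓔.exists_disjoint (g ⁻¹' (K' \ (interior K ∪ interior G)))
      (hpre _ (hK'.diff (isOpen_interior.union isOpen_interior)) fun x hx hxK =>
        hx.2 (or_iff_not_imp_left.2 (hbd x hxK)))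
    refine ⟨s, fun j => ?_⟩
    rw [disjoint_left]
    rintro _ ⟨y, hy, rfl⟩ hyK
    refine (hs j).notMem_of_mem_left (𝓔.antitone _ (Nat.le_add_right _ _) hy) ⟨hyK, ?_⟩
    rintro (h | h)
    · exact hgK y (interior_subset h)
    · exact (show Disjoint (g '' 𝓔.E j s₀) G from j.2).notMem_of_mem_left
        ⟨y, 𝓔.antitone _ (Nat.le_add_left _ _) hy, rfl⟩ (interior_subset h)

section Ends

variable {X J : Type*} [TopologicalSpace X] (𝓔 : EndData X J)

theorem nonempty_inter (j : J) (s s' : ℕ) : (𝓔.E j s ∩ 𝓔.E j s').Nonempty := by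
  obtain ⟨x, hx⟩ := (𝓔.isConnected j (max s s')).nonempty
  exact ⟨x, 𝓔.antitone j (le_max_left _ _) hx, 𝓔.antitone j (le_max_right _ _) hx⟩

/-- Any two neighborhoods of the same index meet, so all those that miss `K` lie in a single
component of its complement. -/
theorem exists_spaceEnd (j : J) :
    ∃ e : SpaceEnd X, ∀ (K : Compacts X) (s : ℕ), Disjoint (𝓔.E j s) K → 𝓔.E j s ⊆ e.1 K := by
  have h : ∀ K : Compacts X, ∃ Z ∈ componentsOf (K : Set X)ᶜ,
      ∀ s, Disjoint (𝓔.E j s) K → 𝓔.E j s ⊆ Z := by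
    intro K
    obtain ⟨s₀, hs₀⟩ := 𝓔.exists_disjoint K K.isCompact
    obtain ⟨x, hx⟩ := (𝓔.isConnected j s₀).nonempty
    have hsub : 𝓔.E j s₀ ⊆ (K : Set X)ᶜ := (hs₀ j).subset_compl_right
    have hZ := connectedComponentIn_mem_componentsOf (hsub hx)
    refine ⟨_, hZ, fun s hs => ?_⟩
    obtain ⟨y, hy, hy'⟩ := 𝓔.nonempty_inter j s s₀
    exact (𝓔.isConnected j s).isPreconnected.subset_of_mem_componentsOf hs.subset_compl_right hZ hy
      ((𝓔.isConnected j s₀).isPreconnected.subset_connectedComponentIn hx hsub hy')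
  choose e he hes using h
  refine ⟨⟨e, he, fun K L hKL => ?_⟩, hes⟩
  obtain ⟨s, hs⟩ := 𝓔.exists_disjoint L L.isCompact
  obtain ⟨x, hx⟩ := (𝓔.isConnected j s).nonempty
  exact (isConnected_of_mem_componentsOf (he L)).isPreconnected.subset_of_mem_componentsOf
    ((componentsOf_subset (he L)).trans (compl_subset_compl.2 hKL)) (he K) (hes L s (hs j) hx)
    (hes K s ((hs j).mono_right hKL) hx)

/-- The end with the neighborhoods `𝓔.E j s`. -/
def toSpaceEnd (j : J) : SpaceEnd X := (𝓔.exists_spaceEnd j).choose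

theorem subset_toSpaceEnd {j : J} {K : Compacts X} {s : ℕ} (h : Disjoint (𝓔.E j s) K) :
    𝓔.E j s ⊆ (𝓔.toSpaceEnd j).1 K :=
  (𝓔.exists_spaceEnd j).choose_spec K s h

/-- The complement of the `s`-th neighborhoods of the ends. -/
def core (s : ℕ) : Compacts X := ⟨(⋃ j, 𝓔.E j s)ᶜ, 𝓔.isCompact_compl s⟩

theorem compl_core (s : ℕ) : (𝓔.core s : Set X)ᶜ = ⋃ j, 𝓔.E j s := compl_compl _

theorem disjoint_core (j : J) (s : ℕ) : Disjoint (𝓔.E j s) (𝓔.core s) :=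
  disjoint_left.2 fun _ hx hx' => hx' (mem_iUnion.2 ⟨j, hx⟩)

theorem eq_of_mem {i j : J} {s s' : ℕ} {x : X} (hi : x ∈ 𝓔.E i s) (hj : x ∈ 𝓔.E j s') : i = j := by
  by_contra h
  exact (𝓔.disjoint i j h).notMem_of_mem_left (𝓔.antitone _ (Nat.zero_le _) hi)
    (𝓔.antitone _ (Nat.zero_le _) hj)

theorem subset_of_isPreconnected {T : Set X} (hT : IsPreconnected T) {s : ℕ}
    (h : T ⊆ ⋃ j, 𝓔.E j s) {j : J} {x : X} (hx : x ∈ T) (hxj : x ∈ 𝓔.E j s) : T ⊆ 𝓔.E j s := by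
  refine hT.subset_left_of_subset_union (v := ⋃ i ∈ {i | i ≠ j}, 𝓔.E i s) (𝓔.isOpen j s)
    (isOpen_biUnion fun i _ => 𝓔.isOpen i s) ?_ ?_ ⟨x, hx, hxj⟩
  · rw [disjoint_left]
    intro y hy hy'
    obtain ⟨i, hi, hyi⟩ := mem_iUnion₂.1 hy'
    exact hi (𝓔.eq_of_mem hyi hy)
  · intro y hy
    obtain ⟨i, hi⟩ := mem_iUnion.1 (h hy)
    by_cases hij : i = j
    · exact Or.inl (hij ▸ hi)
    · exact Or.inr (mem_iUnion₂.2 ⟨i, hij, hi⟩)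

theorem toSpaceEnd_core (j : J) (s : ℕ) : (𝓔.toSpaceEnd j).1 (𝓔.core s) = 𝓔.E j s := by
  have hZ := (𝓔.toSpaceEnd j).2.1 (𝓔.core s)
  have hsub := 𝓔.subset_toSpaceEnd (𝓔.disjoint_core j s)
  refine Subset.antisymm ?_ hsub
  obtain ⟨x, hx⟩ := (𝓔.isConnected j s).nonempty
  exact 𝓔.subset_of_isPreconnected (isConnected_of_mem_componentsOf hZ).isPreconnected
    ((componentsOf_subset hZ).trans (𝓔.compl_core s).subset) (hsub hx) hx

theorem toSpaceEnd_bijective : Function.Bijective 𝓔.toSpaceEnd := by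
  constructor
  · intro i j h
    have h' := 𝓔.toSpaceEnd_core i 0
    rw [h, 𝓔.toSpaceEnd_core j 0] at h'
    obtain ⟨x, hx⟩ := (𝓔.isConnected i 0).nonempty
    exact 𝓔.eq_of_mem hx (h' ▸ hx)
  · intro e
    have hs : ∀ s, ∃ j, e.1 (𝓔.core s) ⊆ 𝓔.E j s := by
      intro s
      have hZ := e.2.1 (𝓔.core s)
      obtain ⟨x, hx⟩ := (isConnected_of_mem_componentsOf hZ).nonempty
      have hsub := (componentsOf_subset hZ).trans (𝓔.compl_core s).subset
      obtain ⟨j, hj⟩ := mem_iUnion.1 (hsub hx)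
      exact ⟨j, 𝓔.subset_of_isPreconnected
        (isConnected_of_mem_componentsOf hZ).isPreconnected hsub hx hj⟩
    choose j hj using hs
    have hmono : ∀ K L : Compacts X, (e.1 (K ⊔ L)) ⊆ e.1 K ∩ e.1 L := fun K L =>
      subset_inter (e.2.2 _ _ le_sup_left) (e.2.2 _ _ le_sup_right)
    -- The values of the end at two cores both contain its value at their union, so the selected
    -- index is the same at every level.
    have hconst : ∀ s, j s = j 0 := by
      intro s
      obtain ⟨x, hx⟩ := (isConnected_of_mem_componentsOf (e.2.1 (𝓔.core s ⊔ 𝓔.core 0))).nonempty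
      exact 𝓔.eq_of_mem (hj s (hmono _ _ hx).1) (hj 0 (hmono _ _ hx).2)
    refine ⟨j 0, Subtype.ext (funext fun K => ?_)⟩
    obtain ⟨s, hs⟩ := 𝓔.exists_disjoint K K.isCompact
    obtain ⟨x, hx⟩ := (isConnected_of_mem_componentsOf (e.2.1 (K ⊔ 𝓔.core s))).nonempty
    have hxE : x ∈ 𝓔.E (j 0) s := hconst s ▸ hj s (hmono _ _ hx).2
    exact eq_of_mem_componentsOf ((𝓔.toSpaceEnd (j 0)).2.1 K) (e.2.1 K)
      (𝓔.subset_toSpaceEnd (hs _) hxE) (hmono _ _ hx).1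

/-- The ends of a space with a complete system `𝓔` of neighborhoods are indexed by `J`. -/
def equivSpaceEnd : J ≃ SpaceEnd X := Equiv.ofBijective _ 𝓔.toSpaceEnd_bijective

theorem E_subset_component (j : J) (s : ℕ) : 𝓔.E j s ⊆ (𝓔.toSpaceEnd j).component.1 :=
  𝓔.subset_toSpaceEnd (by simp)

/-- The closure of a far neighborhood misses the interior of a compact neighborhood of the core.
Openness and disjointness of the neighborhoods prevent it from reaching another end. -/
theorem exists_closure_subset [LocallyCompactSpace X] (s : ℕ) :
    ∃ s' > s, ∀ j, closure (𝓔.E j s') ⊆ 𝓔.E j s := by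
  obtain ⟨G, hG, hcG⟩ := exists_compact_superset (𝓔.isCompact_compl s)
  obtain ⟨s', hs'⟩ := 𝓔.exists_disjoint G hG
  refine ⟨max (s + 1) s', lt_max_of_lt_left (Nat.lt_succ_self s), fun j x hx => ?_⟩
  have hxG : x ∉ interior G := fun h => by
    obtain ⟨y, hyG, hy⟩ := mem_closure_iff.1 hx _ isOpen_interior h
    exact (hs' j).notMem_of_mem_left (𝓔.antitone j (le_max_right _ _) hy) (interior_subset hyG)
  obtain ⟨i, hi⟩ : ∃ i, x ∈ 𝓔.E i s := by
    by_contra h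
    exact hxG (hcG (by simpa using h))
  obtain ⟨y, hyi, hyj⟩ := mem_closure_iff.1 hx _ (𝓔.isOpen i s) hi
  rwa [← 𝓔.eq_of_mem hyi hyj]

end Ends

end EndData

theorem IsManifoldWithFinitelyManyEnds.exists_endData {n : ℕ} [NeZero n] {M : Type u}
    [TopologicalSpace M] [T2Space M] [ChartedSpace (EuclideanSpace ℝ (Fin n)) M]
    (h : IsManifoldWithFinitelyManyEnds n M) :
    ∃ J : Type u, Finite J ∧ Nonempty (EndData M J) := by
  obtain ⟨K, hK, -, X, _, _, _, ι, hι, hιr, ⟨Φ⟩⟩ := h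
  have : LocallyConnectedSpace X :=
    ChartedSpace.locallyConnectedSpace (EuclideanSpace ℝ (Fin (n - 1))) X
  have : LocallyCompactSpace M := ChartedSpace.locallyCompactSpace (EuclideanSpace ℝ (Fin n)) M
  -- The cross section is homeomorphic to the compact frontier of `K`, so it has finitely many
  -- components; each contributes two candidate ends.
  have : CompactSpace X := by
    rw [← isCompact_univ_iff, hι.isEmbedding.isInducing.isCompact_iff, image_univ, hιr]
    exact hK.of_isClosed_subset isClosed_frontier K.isClosed.frontier_subset
  have : Finite (ConnectedComponents X) := finite_of_compact_of_discrete
  have hg : IsOpenEmbedding (fun y => (Φ y : M)) :=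
    K.compl.isOpen.isOpenEmbedding_subtypeVal.comp Φ.toHomeomorph.isOpenEmbedding
  obtain ⟨J', hJ'⟩ := (EndData.halfLine.prodLeft X).exists_of_isOpenEmbedding hg hK (by
    rw [show (fun y => (Φ y : M)) = Subtype.val ∘ Φ from rfl, range_comp,
      show range Φ = univ from Φ.surjective.range_eq, image_univ, Subtype.range_coe]
    rfl)
  exact ⟨J', inferInstance, hJ'⟩

/-! ### Path metrics -/

/-- The two consequences that we use of the fact that a distance is the infimum of the lengths of
paths. -/
class IsPathMetric (P : Type*) [EMetricSpace P] : Prop where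
  isPreconnected_eball : ∀ (x : P) (r : ℝ≥0∞), IsPreconnected (Metric.eball x r)
  exists_between : ∀ (x y : P) (a b : ℝ≥0∞), edist x y < a + b → 0 < a → 0 < b →
    ∃ z, edist x z < a ∧ edist z y < b

section PathMetric

variable {P : Type*} [EMetricSpace P] [IsPathMetric P]

/-- This is where the path metric enters Hopf-Rinow: a slightly larger neighborhood is reached from
the smaller one by a short step, which fails in a general metric space. -/
theorem IsPathMetric.cthickening_subset_thickening {K : Set P} {r a e : ℝ} (ha : 0 ≤ a)
    (he : 0 < e) (h : r < a + e) :
    Metric.cthickening r K ⊆ Metric.thickening e (Metric.cthickening a K) := by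
  intro x hx
  have hlt : Metric.infEDist x K < ENNReal.ofReal e + ENNReal.ofReal a := by
    rw [← ENNReal.ofReal_add he.le ha]
    exact (Metric.mem_cthickening_iff.1 hx).trans_lt
      ((ENNReal.ofReal_lt_ofReal_iff (by linarith)).2 (by linarith))
  obtain ⟨y, hyK, hy⟩ := Metric.infEDist_lt_iff.1 hlt
  rw [Metric.mem_thickening_iff_exists_edist_lt]
  rcases ha.eq_or_lt with rfl | ha'
  · exact ⟨y, Metric.self_subset_cthickening K hyK, by simpa using hy⟩
  · obtain ⟨z, hxz, hzy⟩ := IsPathMetric.exists_between x y _ _ hy (ENNReal.ofReal_pos.2 he)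
      (ENNReal.ofReal_pos.2 ha')
    exact ⟨z, Metric.mem_cthickening_of_edist_le z y a K hyK hzy.le, hxz⟩

/-- The **Hopf-Rinow theorem**: closed bounded neighborhoods of compact sets are compact. -/
theorem IsCompact.cthickening_of_isPathMetric [CompleteSpace P] [LocallyCompactSpace P] {K : Set P}
    (hK : IsCompact K) (R : ℝ) : IsCompact (Metric.cthickening R K) := by
  let S : Set ℝ := {r | IsCompact (Metric.cthickening r K)}
  have hmono : ∀ {r r'}, r ≤ r' → r' ∈ S → r ∈ S := fun {r r'} h hr' =>
    IsCompact.of_isClosed_subset hr' Metric.isClosed_cthickening (Metric.cthickening_mono h K)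
  have h0 : (0 : ℝ) ∈ S := by
    simpa [S, hK.isClosed.closure_eq] using hK
  -- Continuous induction on the radius. At a limit radius the neighborhood lies within `e` of a
  -- compact one, so it is totally bounded; being closed, it is complete.
  have hclosed : IsClosed (S ∩ Icc 0 R) := by
    refine isClosed_of_closure_subset fun r hr => ?_
    have hrI : r ∈ Icc 0 R := isClosed_Icc.closure_subset_iff.2 inter_subset_right hr
    refine ⟨?_, hrI⟩
    refine isCompact_iff_totallyBounded_isComplete.2 ⟨?_, Metric.isClosed_cthickening.isComplete⟩
    rw [EMetric.totallyBounded_iff]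
    intro ε hε
    obtain ⟨e, he, heε⟩ : ∃ e : ℝ, 0 < e ∧ ENNReal.ofReal e + ENNReal.ofReal e ≤ ε := by
      obtain ⟨δ, hδ, hδε⟩ := ENNReal.lt_iff_exists_nnreal_btwn.1 (ENNReal.half_pos hε.ne')
      refine ⟨δ, by exact_mod_cast hδ, ?_⟩
      rw [ENNReal.ofReal_coe_nnreal]
      calc (δ : ℝ≥0∞) + δ ≤ ε / 2 + ε / 2 := add_le_add hδε.le hδε.le
        _ = ε := ENNReal.add_halves ε
    obtain ⟨r', hr', hr'e⟩ := Metric.mem_closure_iff.1 hr e he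
    rw [Real.dist_eq] at hr'e
    obtain ⟨t, ht, hcov⟩ := EMetric.totallyBounded_iff.1 (IsCompact.totallyBounded hr'.1)
      (ENNReal.ofReal e) (ENNReal.ofReal_pos.2 he)
    refine ⟨t, ht, fun x hx => ?_⟩
    have hx' := IsPathMetric.cthickening_subset_thickening hr'.2.1 he
      (by linarith [(abs_lt.1 hr'e).2]) hx
    obtain ⟨z, hz, hxz⟩ := (Metric.mem_thickening_iff_exists_edist_lt _ _).1 hx'
    obtain ⟨y, hy, hzy⟩ := mem_iUnion₂.1 (hcov hz)
    refine mem_iUnion₂.2 ⟨y, hy, ?_⟩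
    exact (edist_triangle x z y).trans_lt ((ENNReal.add_lt_add hxz hzy).trans_le heε)
  rcases le_or_gt 0 R with hR | hR
  · refine hclosed.Icc_subset_of_forall_mem_nhdsGT_of_Icc_subset h0 ?_ ⟨hR, le_rfl⟩
    intro r hr hrS
    -- By local compactness the radius can be increased beyond `r`.
    obtain ⟨δ, hδ, hδc⟩ := IsCompact.exists_isCompact_cthickening (hrS ⟨hr.1, le_rfl⟩)
    have hmem : r + δ / 2 ∈ S := by
      refine hδc.of_isClosed_subset Metric.isClosed_cthickening ?_
      exact (IsPathMetric.cthickening_subset_thickening hr.1 hδ (by linarith)).trans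
        (Metric.thickening_subset_cthickening _ _)
    exact mem_of_superset (Ioc_mem_nhdsGT (show r < r + δ / 2 by linarith))
      fun r' hr' => hmono hr'.2 hmem
  · exact hmono hR.le h0

theorem isPreconnected_setOf_edist_lt (x : P) (r : ℝ≥0∞) : IsPreconnected {y | edist x y < r} := by
  convert! IsPathMetric.isPreconnected_eball x r using 1
  ext y
  rw [Metric.mem_eball', mem_ofPred_eq]

theorem mem_component_of_edist_lt_top {N : Set P} (hN : N ∈ componentsOf (univ : Set P)) {x y : P}
    (hx : x ∈ N) (h : edist x y < ⊤) : y ∈ N :=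
  (isPreconnected_setOf_edist_lt x ⊤).subset_of_mem_componentsOf (subset_univ _) hN
    (x := x) (by simp) hx h

instance (priority := 100) IsPathMetric.locallyConnectedSpace : LocallyConnectedSpace P := by
  refine locallyConnectedSpace_of_connected_bases (fun x (r : ℝ≥0∞) => Metric.eball x r)
    (fun _ r => 0 < r) (fun x => Metric.nhds_basis_eball) fun x r _ =>
      IsPathMetric.isPreconnected_eball x r

end PathMetric

/-! ### Volumes of balls -/

section BallVolume

variable {P : Type*} [EMetricSpace P] [MeasurableSpace P]

/-- The ball is exhausted by balls of smaller radius `q m`, and each of these stays inside the ball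
of radius `r` when its center moves by less than `r - q m`. -/
theorem lowerSemicontinuous_measure_eball (μ : Measure P) (r : ℝ≥0∞) :
    LowerSemicontinuous fun x => μ (Metric.eball x r) := by
  intro x c hc
  rcases eq_or_ne r 0 with rfl | hr
  · simp at hc
  obtain ⟨q, hq, hqr, hlim⟩ := exists_seq_strictMono_tendsto' (pos_iff_ne_zero.2 hr)
  have hU : Metric.eball x r = ⋃ m, Metric.eball x (q m) := by
    ext y
    simp only [Metric.mem_eball, mem_iUnion]
    exact ⟨fun h => (hlim.eventually (lt_mem_nhds h)).exists, fun ⟨m, h⟩ => h.trans (hqr m).2⟩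
  have hmono : Monotone fun m => Metric.eball x (q m) := fun m m' h =>
    Metric.eball_subset_eball (hq.monotone h)
  change c < μ (Metric.eball x r) at hc
  rw [hU, hmono.measure_iUnion, lt_iSup_iff] at hc
  obtain ⟨m, hm⟩ := hc
  filter_upwards [Metric.eball_mem_nhds x (tsub_pos_of_lt (hqr m).2)] with y hy
  refine hm.trans_le (measure_mono fun z hz => ?_)
  calc edist z y ≤ edist z x + edist x y := edist_triangle _ _ _
    _ < q m + (r - q m) := ENNReal.add_lt_add hz (Metric.mem_eball'.1 hy)
    _ = r := add_tsub_cancel_of_le (hqr m).2.le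

/-- A finite measure is concentrated up to `δ` on a relatively compact set. Balls centered outside
the closed `r`-neighborhood of its closure miss it, and this neighborhood is compact by Hopf-Rinow.
-/
theorem exists_isCompact_measure_eball_le [BorelSpace P] [CompleteSpace P] [SecondCountableTopology P]
    [LocallyCompactSpace P] [IsPathMetric P] (μ : Measure P) (hμ : μ univ < ⊤) (r : ℝ)
    {δ : ℝ≥0∞} (hδ : 0 < δ) :
    ∃ G, IsCompact G ∧ ∀ x ∉ G, μ (Metric.eball x (ENNReal.ofReal r)) ≤ δ := by
  have : IsFiniteMeasure μ := ⟨hμ⟩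
  obtain ⟨K, hK, hKδ⟩ := exists_isCompact_closure_measure_compl_lt μ δ hδ
  refine ⟨_, hK.cthickening_of_isPathMetric r, fun x hx => ?_⟩
  refine (measure_mono ?_).trans hKδ.le
  intro y hy hyK
  exact hx (Metric.mem_cthickening_of_edist_le x y r _ (subset_closure hyK)
    (Metric.mem_eball'.1 hy).le)

end BallVolume

/-! ### Closedness of the collapsed region -/

theorem LowerSemicontinuous.exists_lt_forall_le {X : Type*} [TopologicalSpace X] {f : X → ℝ≥0∞}
    (hf : LowerSemicontinuous f) {K : Set X} (hK : IsCompact K) {c : ℝ≥0∞} (hc : c < ⊤)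
    (h : ∀ x ∈ K, c < f x) : ∃ m, c < m ∧ ∀ x ∈ K, m ≤ f x := by
  rcases K.eq_empty_or_nonempty with rfl | hne
  -- On the empty set the bound `⊤` works, and this is where `c` has to be finite.
  · exact ⟨⊤, hc, by simp⟩
  · obtain ⟨x, hx, hmin⟩ := (hf.lowerSemicontinuousOn K).exists_isMinOn hne hK
    exact ⟨f x, h x hx, fun y hy => hmin hy⟩

/-- The trace of `O` on `Z` is also the trace of `W`, hence clopen in `Z`. This is the trapping
principle behind all arguments that confine a connected set to a compact region. -/
theorem IsPreconnected.subset_of_inter_eq {X : Type*} [TopologicalSpace X] {Z O W : Set X}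
    (hZ : IsPreconnected Z) (hO : IsOpen O) (hW : IsClosed W) (hOW : ∀ y ∈ Z, y ∈ O → y ∈ W)
    (hWO : ∀ y ∈ Z, y ∈ W → y ∈ O) {x : X} (hxZ : x ∈ Z) (hxO : x ∈ O) : Z ⊆ W := by
  by_contra hnot
  obtain ⟨y, hy, hyW⟩ := not_subset.1 hnot
  obtain ⟨w, hwZ, hwO, hwW⟩ := hZ _ _ hO hW.isOpen_compl
    (fun z hz => (em (z ∈ W)).imp (hWO z hz) id) ⟨x, hxZ, hxO⟩ ⟨y, hy, hyW⟩
  exact hwW (hOW w hwZ hwO)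

/-- In a compact space, the component of a point has arbitrarily small clopen neighborhoods. -/
theorem exists_isClopen_subset {X : Type*} [TopologicalSpace X] [CompactSpace X] [T2Space X]
    {x : X} {U : Set X} (hU : IsOpen U) (h : connectedComponent x ⊆ U) :
    ∃ V, IsClopen V ∧ x ∈ V ∧ V ⊆ U := by
  rw [connectedComponent_eq_iInter_isClopen] at h
  have hdir : Directed (· ⊇ ·) fun s : { s : Set X // IsClopen s ∧ x ∈ s } => (s : Set X) :=
    fun s t => ⟨⟨s ∩ t, s.2.1.inter t.2.1, s.2.2, t.2.2⟩, inter_subset_left, inter_subset_right⟩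
  have : Nonempty { s : Set X // IsClopen s ∧ x ∈ s } := ⟨⟨univ, isClopen_univ, mem_univ _⟩⟩
  obtain ⟨s, hs⟩ := exists_subset_nhds_of_compactSpace hdir (fun s => s.2.1.isClosed)
    fun t ht => hU.mem_nhds (h ht)
  exact ⟨s, s.2.1, s.2.2, hs⟩

/-- The statement on clopen neighborhoods is applied in the compact space `B ∩ G`. As the clopen set
obtained lies in `U`, inside the interior of `G`, it is also relatively open in `B`. -/
theorem exists_isOpen_inter_eq_isCompact {X : Type*} [TopologicalSpace X] [T2Space X]
    {B U G : Set X} (hB : IsClosed B) (hU : IsOpen U) (hG : IsCompact G) (hUG : U ⊆ interior G)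
    {x : X} (hx : x ∈ B) (h : connectedComponentIn B x ⊆ U) :
    ∃ O W, IsOpen O ∧ IsCompact W ∧ x ∈ O ∧ B ∩ O = W ∧ W ⊆ U := by
  have hxG : x ∈ G := interior_subset (hUG (h (mem_connectedComponentIn hx)))
  have : CompactSpace ↥(B ∩ G) := isCompact_iff_compactSpace.1 (hG.inter_left hB)
  let x' : ↥(B ∩ G) := ⟨x, hx, hxG⟩
  obtain ⟨V, hV, hxV, hVU⟩ := exists_isClopen_subset (x := x')
    (hU.preimage continuous_subtype_val) fun t ht => h (by
      refine (isPreconnected_connectedComponent.image Subtype.val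
        continuous_subtype_val.continuousOn).subset_connectedComponentIn
        ⟨x', mem_connectedComponent, rfl⟩ ?_ ⟨t, ht, rfl⟩
      rintro _ ⟨s, -, rfl⟩
      exact s.2.1)
  obtain ⟨O, hO, rfl⟩ := isOpen_induced_iff.1 hV.isOpen
  refine ⟨O ∩ interior G, Subtype.val '' (Subtype.val ⁻¹' O : Set ↥(B ∩ G)),
    hO.inter isOpen_interior, hV.isClosed.isCompact.image continuous_subtype_val,
    ⟨hxV, hUG (hVU hxV)⟩, ?_, ?_⟩
  · ext y
    constructor
    · rintro ⟨hyB, hyO, hyG⟩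
      exact ⟨⟨y, hyB, interior_subset hyG⟩, hyO, rfl⟩
    · rintro ⟨t, ht, rfl⟩
      exact ⟨t.2.1, ht, hUG (hVU ht)⟩
  · rintro _ ⟨t, ht, rfl⟩
    exact hVU ht

/-! ### Distances between sets. -/

section SetDist

variable {P : Type*} [EMetricSpace P]

theorem setDist_le_edist {U V : Set P} {x y : P} (hx : x ∈ U) (hy : y ∈ V) :
    setDist U V ≤ edist x y :=
  (iInf₂_le x hx).trans (iInf₂_le y hy)

theorem setDist_eq_zero_of_mem {U V : Set P} {x : P} (hx : x ∈ U) (hy : x ∈ V) :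
    setDist U V = 0 :=
  le_antisymm ((setDist_le_edist hx hy).trans (edist_self x).le) zero_le

theorem le_setDist {U V : Set P} {r : ℝ≥0∞} (h : ∀ x ∈ U, ∀ y ∈ V, r ≤ edist x y) :
    r ≤ setDist U V :=
  le_iInf₂ fun x hx => le_iInf₂ fun y hy => h x hx y hy

theorem IsCompact.setDist_pos {U V : Set P} (hU : IsCompact U) (hV : IsClosed V)
    (h : Disjoint U V) : 0 < setDist U V := by
  obtain ⟨r, hr, hrUV⟩ := Metric.exists_pos_forall_lt_edist hU hV h
  exact (ENNReal.coe_pos.2 hr).trans_le (le_setDist fun x hx y hy => (hrUV x hx y hy).le)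

end SetDist

/-! ### Unit ball volumes and the topology of the sets `C` and `D`. -/

section Collapse

variable {n : ℕ} {P : Type*} [EMetricSpace P] [MeasurableSpace P] [BorelSpace P]

theorem lowerSemicontinuous_unitBallVol : LowerSemicontinuous (unitBallVol n : P → ℝ≥0∞) :=
  lowerSemicontinuous_measure_eball _ 1

theorem isClosed_unitBallVol_le (c : ℝ≥0∞) : IsClosed {x : P | unitBallVol n x ≤ c} :=
  lowerSemicontinuous_unitBallVol.isClosed_preimage c

theorem vMin_le {Z : Set P} {x : P} (hx : x ∈ Z) : vMin n Z ≤ unitBallVol n x := iInf₂_le x hx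

theorem le_vMax {Z : Set P} {x : P} (hx : x ∈ Z) : unitBallVol n x ≤ vMax n Z :=
  le_iSup₂ (f := fun x (_ : x ∈ Z) => unitBallVol n x) x hx

theorem lt_vMin_of_isCompact {K Z : Set P} (hK : IsCompact K) {c : ℝ≥0∞} (hc : c < ⊤)
    (h : ∀ x ∈ K, c < unitBallVol n x) (hZ : Z ⊆ K) : c < vMin n Z := by
  obtain ⟨m, hcm, hm⟩ := lowerSemicontinuous_unitBallVol.exists_lt_forall_le hK hc h
  exact hcm.trans_le (le_iInf₂ fun x hx => hm x (hZ hx))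

variable {ε lm l0 lp : ℝ}

theorem collapsedCore_subset :
    collapsedCore n P ε lm l0 ⊆ {x | unitBallVol n x ≤ ENNReal.ofReal (l0 * ε)} :=
  sUnion_subset fun _ hZ => componentsOf_subset hZ.1

theorem IsPreconnected.subset_collapsedCore {T : Set P} (hT : IsPreconnected T)
    (h : ∀ x ∈ T, unitBallVol n x ≤ ENNReal.ofReal (l0 * ε)) {x : P} (hx : x ∈ T)
    (hxm : unitBallVol n x ≤ ENNReal.ofReal (lm * ε)) : T ⊆ collapsedCore n P ε lm l0 := by
  have hsub := hT.subset_connectedComponentIn hx h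
  exact hsub.trans (subset_sUnion_of_mem
    ⟨connectedComponentIn_mem_componentsOf (h x hx), (vMin_le (hsub hx)).trans hxm⟩)

/-- Off `C`, the region is a union of full components of the open complement of `C`: such a
component lies in one component of the closure, which is added entirely or not at all. -/
theorem isClosed_collapsedRegion [IsPathMetric P]
    (hC : IsClosed (collapsedCore n P ε lm l0)) :
    IsClosed (collapsedRegion n P ε lm l0) := by
  refine isClosed_of_closure_subset fun x hx => ?_
  by_contra hxD
  have hxC : x ∈ (collapsedCore n P ε lm l0)ᶜ := fun h => hxD (Or.inl h)
  obtain ⟨p, hpU, hpD⟩ := mem_closure_iff.1 hx _ hC.isOpen_compl.connectedComponentIn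
    (mem_connectedComponentIn hxC)
  rcases hpD with hpC | ⟨Y, hY, hpY⟩
  · exact connectedComponentIn_subset _ _ hpU hpC
  · exact hxD (Or.inr ⟨Y, hY, isPreconnected_connectedComponentIn.subset_of_mem_componentsOf
      ((connectedComponentIn_subset _ _).trans subset_closure) hY.1 hpU hpY
      (mem_connectedComponentIn hxC)⟩)

variable [CompleteSpace P] [SecondCountableTopology P] [LocallyCompactSpace P] [IsPathMetric P]

theorem exists_isCompact_unitBallVol_le (hvol : riemVol n (univ : Set P) < ⊤) {δ : ℝ≥0∞}
    (hδ : 0 < δ) : ∃ G : Set P, IsCompact G ∧ ∀ x ∉ G, unitBallVol n x ≤ δ := by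
  simpa [unitBallVol] using exists_isCompact_measure_eball_le (riemVol n : Measure P) hvol 1 hδ

/-- Infinitely many components could accumulate at a point `x` outside `C`. But the component of `x`
in `B` lies in the relatively compact set where `v > λ₋ε`, and so does a compact, relatively open
neighborhood `W` of `x` in `B`. A component in `C` that enters `W` stays there, against the lower
bound for `v` on `W`. -/
theorem isClosed_collapsedCore (hvol : riemVol n (univ : Set P) < ⊤) (hm : 0 < lm * ε) :
    IsClosed (collapsedCore n P ε lm l0) := by
  refine isClosed_of_closure_subset fun x hx => ?_
  have hB := isClosed_unitBallVol_le (n := n) (P := P) (ENNReal.ofReal (l0 * ε))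
  have hxB : x ∈ {x : P | unitBallVol n x ≤ ENNReal.ofReal (l0 * ε)} :=
    closure_minimal collapsedCore_subset hB hx
  by_contra hxC
  obtain ⟨G, hG, hGa⟩ := exists_isCompact_unitBallVol_le hvol (ENNReal.ofReal_pos.2 hm)
  obtain ⟨G', hG', hGG'⟩ := exists_compact_superset hG
  obtain ⟨O, W, hO, hW, hxO, hOW, hWU⟩ := exists_isOpen_inter_eq_isCompact hB
    (isClosed_unitBallVol_le (n := n) (P := P) (ENNReal.ofReal (lm * ε))).isOpen_compl hG'
    (fun y hy => hGG' (by_contra fun h => hy (hGa y h))) hxB fun y hy hya =>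
      hxC ⟨_, ⟨connectedComponentIn_mem_componentsOf hxB, (vMin_le hy).trans hya⟩,
        mem_connectedComponentIn hxB⟩
  obtain ⟨p, hpO, Z, ⟨hZc, hZa⟩, hpZ⟩ := mem_closure_iff.1 hx O hO hxO
  have hZW : Z ⊆ W := by
    have hZB := componentsOf_subset hZc
    refine (isConnected_of_mem_componentsOf hZc).isPreconnected.subset_of_inter_eq hO hW.isClosed
      (fun y hy hyO => hOW.subset ⟨hZB hy, hyO⟩) (fun y _ hyW => (hOW.superset hyW).2) hpZ hpO
  exact (lt_vMin_of_isCompact (n := n) hW ENNReal.ofReal_lt_top (fun y hy => not_le.1 (hWU hy))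
    hZW).not_ge hZa

/-- Near the compact set outside which `v ≤ λ₋ε`, compactness separates the two closed sets. At a
point of `Z` far from it the whole unit ball is connected and contained in `C`, hence in `Z`, so
`Z'` has distance at least one. -/
theorem setDist_pos_of_ne (hvol : riemVol n (univ : Set P) < ⊤) (hm : 0 < lm * ε)
    (hm0 : lm * ε ≤ l0 * ε) {Z Z' : Set P}
    (hZ : Z ∈ componentsOf (collapsedRegion n P ε lm l0))
    (hZ' : Z' ∈ componentsOf (collapsedRegion n P ε lm l0)) (hne : Z ≠ Z') :
    0 < setDist Z Z' := by
  have hD := isClosed_collapsedRegion (isClosed_collapsedCore (P := P) (l0 := l0) hvol hm)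
  have hdisj : ∀ x ∈ Z, x ∉ Z' := fun x hx hx' => hne (eq_of_mem_componentsOf hZ hZ' hx hx')
  obtain ⟨G, hG, hGa⟩ := exists_isCompact_unitBallVol_le hvol (ENNReal.ofReal_pos.2 hm)
  have hG₁ := hG.cthickening_of_isPathMetric 1
  have hpos : 0 < setDist (Z ∩ Metric.cthickening 1 G) Z' :=
    (hG₁.inter_left (hD.of_mem_componentsOf hZ)).setDist_pos (hD.of_mem_componentsOf hZ')
      (disjoint_left.2 fun x hx => hdisj x hx.1)
  refine (lt_min hpos one_pos).trans_le (le_setDist fun x hx y hy => ?_)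
  by_cases hxG : x ∈ Metric.cthickening 1 G
  · exact (min_le_left _ _).trans (setDist_le_edist ⟨hx, hxG⟩ hy)
  refine (min_le_right _ _).trans (not_lt.1 fun hxy => hdisj y ?_ hy)
  have hball : ∀ z ∈ {z | edist x z < 1}, unitBallVol n z ≤ ENNReal.ofReal (lm * ε) :=
    fun z hz => hGa z fun hzG => hxG
      (Metric.mem_cthickening_of_edist_le x z 1 G hzG (by simpa using hz.le))
  have hxx : x ∈ {z | edist x z < 1} := by simp
  have hsub := (isPreconnected_setOf_edist_lt x 1).subset_collapsedCore (lm := lm) (l0 := l0)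
    (fun z hz => (hball z hz).trans (ENNReal.ofReal_le_ofReal hm0)) hxx (hball x hxx)
  exact (isPreconnected_setOf_edist_lt x 1).subset_of_mem_componentsOf
    (hsub.trans subset_union_left) hZ hxx hx hxy

end Collapse

/-! ### The part of the collapsing graph that is seen by the limit -/

theorem isClosed_spaceComponent {M : Type*} [TopologicalSpace M] (N : SpaceComponent M) :
    IsClosed N.1 :=
  isClosed_univ.of_mem_componentsOf N.2

theorem isOpen_spaceComponent {M : Type*} [TopologicalSpace M] [LocallyConnectedSpace M]
    (N : SpaceComponent M) : IsOpen N.1 :=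
  isOpen_univ.of_mem_componentsOf N.2

theorem eq_of_setDist_lt_top {M : Type*} [EMetricSpace M] [IsPathMetric M]
    {N N' : SpaceComponent M} {Z Z' : Set M} (hZ : Z ⊆ N.1) (hZ' : Z' ⊆ N'.1)
    (hlt : setDist Z Z' < ⊤) : N = N' := by
  simp only [setDist, iInf_lt_iff] at hlt
  obtain ⟨x, hx, y, hy, hxy⟩ := hlt
  exact Subtype.ext (eq_of_mem_componentsOf N.2 N'.2
    (mem_component_of_edist_lt_top N.2 (hZ hx) hxy) (hZ' hy))

/-- A map `f` from (a part of) the space `M` with ends in the disjoint open sets `A j` to `P`. The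
unit ball volumes on `P` are large on the image of `Q`, small on the images of the collars `R j`,
and intermediate on the compact part `I` of `M` that is bounded by the collars. -/
structure CoreFit (n : ℕ) {M P J : Type*} [TopologicalSpace M] [EMetricSpace P]
    [MeasurableSpace P] [BorelSpace P] (A : J → Set M) (f : M → P) (ε lm l0 lp : ℝ)
    (L Q I I' : Set M) (R : J → Set M) : Prop where
  ε_pos : 0 < ε
  lm_pos : 0 < lm
  lm_lt : lm < l0
  lt_lp : 1 < lp
  isOpen_A : ∀ j, IsOpen (A j)
  disjoint_A : ∀ i j, i ≠ j → Disjoint (A i) (A j)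
  isCompact_I : IsCompact I
  isOpen_I' : IsOpen I'
  I_subset : I ⊆ I'
  isCompact_Q : IsCompact Q
  Q_subset : Q ⊆ I
  L_subset : L ⊆ Q
  compl_Q_subset : Qᶜ ⊆ ⋃ j, A j
  isConnected_Q : ∀ N ∈ componentsOf (univ : Set M), IsConnected (Q ∩ N)
  nonempty_L : ∀ N ∈ componentsOf (univ : Set M), (L ∩ N).Nonempty
  isConnected_R : ∀ j, IsConnected (R j)
  isCompact_R : ∀ j, IsCompact (R j)
  R_subset : ∀ j, R j ⊆ A j
  collar : ∀ j, (I' \ I) ∩ A j ⊆ R j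
  continuousAt : ∀ x ∈ I', ContinuousAt f x
  continuousAt_R : ∀ j, ∀ x ∈ R j, ContinuousAt f x
  injOn : InjOn f I'
  isOpen_image : ∀ U ⊆ I', IsOpen U → IsOpen (f '' U)
  lt_L : ∀ x ∈ L, ENNReal.ofReal (lp * ε) < unitBallVol n (f x)
  lt_Q : ∀ x ∈ Q, ENNReal.ofReal (l0 * ε) < unitBallVol n (f x)
  le_I : ∀ x ∈ I, x ∉ Q → unitBallVol n (f x) ≤ ENNReal.ofReal ε
  lt_I : ∀ x ∈ I, ENNReal.ofReal (lm * ε) < unitBallVol n (f x)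
  le_R : ∀ j, ∀ x ∈ R j, unitBallVol n (f x) ≤ ENNReal.ofReal (l0 * ε)
  exists_R : ∀ j, ∃ x ∈ R j, unitBallVol n (f x) ≤ ENNReal.ofReal (lm * ε)

namespace CoreFit

section Basic

variable {n : ℕ} {M P J : Type*} [TopologicalSpace M] [EMetricSpace P]
  [MeasurableSpace P] [BorelSpace P] {A : J → Set M} {f : M → P} {ε lm l0 lp : ℝ}
  {L Q I I' : Set M} {R : J → Set M} (h : CoreFit n A f ε lm l0 lp L Q I I' R)

include h

theorem lm_mul_pos : 0 < lm * ε := mul_pos h.lm_pos h.ε_pos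

theorem lm_mul_le : lm * ε ≤ l0 * ε := mul_le_mul_of_nonneg_right h.lm_lt.le h.ε_pos.le

theorem le_lp_mul : ε ≤ lp * ε := le_mul_of_one_le_left h.ε_pos.le h.lt_lp.le

theorem continuousOn_I : ContinuousOn f I := fun x hx =>
  (h.continuousAt x (h.I_subset hx)).continuousWithinAt

theorem isPreconnected_image_R (j : J) : IsPreconnected (f '' R j) :=
  (h.isConnected_R j).isPreconnected.image f fun x hx => (h.continuousAt_R j x hx).continuousWithinAt

theorem isPreconnected_image_Q {N : Set M} (hN : N ∈ componentsOf (univ : Set M)) :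
    IsPreconnected (f '' (Q ∩ N)) :=
  (h.isConnected_Q N hN).isPreconnected.image f
    (h.continuousOn_I.mono (inter_subset_left.trans h.Q_subset))

theorem image_R_subset (j : J) : f '' R j ⊆ collapsedCore n P ε lm l0 := by
  obtain ⟨x, hx, hxm⟩ := h.exists_R j
  refine (h.isPreconnected_image_R j).subset_collapsedCore ?_ (mem_image_of_mem f hx) hxm
  rintro _ ⟨y, hy, rfl⟩
  exact h.le_R j y hy

theorem image_Q_disjoint_core {x : M} (hx : x ∈ Q) : f x ∉ collapsedCore n P ε lm l0 :=
  fun hx' => (h.lt_Q x hx).not_ge (collapsedCore_subset hx')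

/-- A component added to `C` that meets the image of `Q` contains the image of `Q ∩ N`, and with it
a point of `L`, whose volume exceeds `ε`. -/
theorem image_Q_disjoint {x : M} (hx : x ∈ Q) : f x ∉ collapsedRegion n P ε lm l0 := by
  rintro (hx' | ⟨Y, ⟨hY, hYε⟩, hxY⟩)
  · exact h.image_Q_disjoint_core hx hx'
  · have hN := connectedComponentIn_mem_componentsOf (mem_univ x)
    have hsub : f '' (Q ∩ connectedComponentIn univ x) ⊆ Y := by
      refine (h.isPreconnected_image_Q hN).subset_of_mem_componentsOf ?_ hY
        (mem_image_of_mem f ⟨hx, mem_connectedComponentIn (mem_univ x)⟩) hxY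
      rintro _ ⟨y, hy, rfl⟩
      exact subset_closure (h.image_Q_disjoint_core hy.1)
    obtain ⟨l, hl, hlN⟩ := h.nonempty_L _ hN
    have h₁ := (le_vMax (n := n) (hsub ⟨l, ⟨h.L_subset hl, hlN⟩, rfl⟩)).trans hYε
    exact (h.lt_L l hl).not_ge (h₁.trans (ENNReal.ofReal_le_ofReal h.le_lp_mul))

theorem exists_mem_A {x : M} (hx : x ∉ Q) : ∃ j, x ∈ A j := mem_iUnion.1 (h.compl_Q_subset hx)

/-- Removing the other open sets `A i` from `I` leaves a compact set that differs from `I ∩ A j`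
only within `Q`. -/
theorem isCompact_Q_union (j : J) : IsCompact (Q ∪ I ∩ A j) := by
  have : Q ∪ I ∩ A j = Q ∪ (I \ ⋃ i ∈ {i | i ≠ j}, A i) := by
    ext x
    constructor
    · rintro (hx | ⟨hxI, hxj⟩)
      · exact Or.inl hx
      · refine Or.inr ⟨hxI, fun hx' => ?_⟩
        obtain ⟨i, hi, hxi⟩ := mem_iUnion₂.1 hx'
        exact (h.disjoint_A i j hi).notMem_of_mem_left hxi hxj
    · rintro (hx | ⟨hxI, hxA⟩)
      · exact Or.inl hx
      · refine or_iff_not_imp_left.2 fun hxQ => ⟨hxI, ?_⟩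
        obtain ⟨i, hi⟩ := h.exists_mem_A hxQ
        by_cases hij : i = j
        · exact hij ▸ hi
        · exact absurd (mem_iUnion₂.2 ⟨i, hij, hi⟩) hxA
  rw [this]
  exact h.isCompact_Q.union (h.isCompact_I.diff (isOpen_biUnion fun i _ => h.isOpen_A i))

/-- A connected subset of `P` cannot leave the image of `I ∩ A j` without meeting the images of
`Q` or the collar `R j`. -/
theorem subset_image_of_disjoint {Z : Set P} (hZ : IsPreconnected Z) {j : J}
    (hQ : ∀ x ∈ Q, f x ∉ Z) (hR : ∀ x ∈ R j, f x ∉ Z) {x : M} (hx : x ∈ I) (hxA : x ∈ A j)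
    (hxZ : f x ∈ Z) : Z ⊆ f '' (I ∩ A j) := by
  have hQI : Q ∪ I ∩ A j ⊆ I := union_subset h.Q_subset inter_subset_left
  have hsub := hZ.subset_of_inter_eq
    (h.isOpen_image (I' ∩ A j) inter_subset_left (h.isOpen_I'.inter (h.isOpen_A j)))
    ((h.isCompact_Q_union j).image_of_continuousOn (h.continuousOn_I.mono hQI)).isClosed
    (by
      rintro _ hyZ ⟨y, ⟨hyI', hyA⟩, rfl⟩
      refine mem_image_of_mem f (Or.inr ⟨by_contra fun hyI => ?_, hyA⟩)
      exact hR y (h.collar j ⟨⟨hyI', hyI⟩, hyA⟩) hyZ)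
    (by
      rintro _ hyZ ⟨y, hyQ | hy, rfl⟩
      · exact absurd hyZ (hQ y hyQ)
      · exact mem_image_of_mem f ⟨h.I_subset hy.1, hy.2⟩)
    hxZ (mem_image_of_mem f ⟨h.I_subset hx, hxA⟩)
  intro y hy
  obtain ⟨z, hzQ | hz, rfl⟩ := hsub hy
  · exact absurd hy (hQ z hzQ)
  · exact mem_image_of_mem f hz

/-- The component of the collapsed region that contains the image of the collar `R j`. -/
def leaf (j : J) : Set P :=
  connectedComponentIn (collapsedRegion n P ε lm l0) (f (h.isConnected_R j).nonempty.some)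

theorem leaf_mem (j : J) : h.leaf j ∈ componentsOf (collapsedRegion n P ε lm l0) :=
  connectedComponentIn_mem_componentsOf
    (Or.inl (h.image_R_subset j (mem_image_of_mem f (h.isConnected_R j).nonempty.some_mem)))

theorem image_R_subset_leaf (j : J) : f '' R j ⊆ h.leaf j :=
  (h.isPreconnected_image_R j).subset_connectedComponentIn
    (mem_image_of_mem f (h.isConnected_R j).nonempty.some_mem)
    ((h.image_R_subset j).trans subset_union_left)

theorem subset_leaf {T : Set P} (hT : IsPreconnected T) (hTD : T ⊆ collapsedRegion n P ε lm l0)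
    {j : J} {y : P} (hyT : y ∈ T) (hy : y ∈ h.leaf j) : T ⊆ h.leaf j :=
  hT.subset_of_mem_componentsOf hTD (h.leaf_mem j) hyT hy

/-- A component of `B` that misses the collar is trapped in the image of the compact set `I`, where
the infimum of `v` is larger than `λ₋ε`; so it does not belong to `C`. -/
theorem mem_leaf_of_mem_core {j : J} {x : M} (hx : x ∈ I) (hxA : x ∈ A j)
    (hxC : f x ∈ collapsedCore n P ε lm l0) : f x ∈ h.leaf j := by
  obtain ⟨Z, hZ, hxZ⟩ := hxC
  have hZC : Z ⊆ collapsedCore n P ε lm l0 := subset_sUnion_of_mem hZ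
  have hZc := (isConnected_of_mem_componentsOf hZ.1).isPreconnected
  by_cases hR : ∀ y ∈ R j, f y ∉ Z
  · have hsub := h.subset_image_of_disjoint hZc
      (fun y hy hyZ => h.image_Q_disjoint_core hy (hZC hyZ)) hR hx hxA hxZ
    refine absurd hZ.2 (lt_vMin_of_isCompact (n := n)
      (h.isCompact_I.image_of_continuousOn h.continuousOn_I) ENNReal.ofReal_lt_top ?_
      (hsub.trans (image_mono inter_subset_left))).not_ge
    rintro _ ⟨y, hy, rfl⟩
    exact h.lt_I y hy
  · push Not at hR
    obtain ⟨y, hyR, hyZ⟩ := hR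
    exact h.subset_leaf hZc (hZC.trans subset_union_left) hyZ
      (h.image_R_subset_leaf j (mem_image_of_mem f hyR)) hxZ

theorem mem_leaf [T2Space M] [LocallyConnectedSpace P] (hC : IsClosed (collapsedCore n P ε lm l0)) {j : J}
    {x : M} (hx : x ∈ I) (hxA : x ∈ A j) (hxD : f x ∈ collapsedRegion n P ε lm l0) :
    f x ∈ h.leaf j := by
  rcases hxD with hxC | ⟨Y, hY, hxY⟩
  · exact h.mem_leaf_of_mem_core hx hxA hxC
  have hYD : Y ⊆ collapsedRegion n P ε lm l0 :=
    subset_union_of_subset_right (subset_sUnion_of_mem hY) _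
  have hYc := (isConnected_of_mem_componentsOf hY.1).isPreconnected
  by_cases hR : ∀ y ∈ R j, f y ∉ Y
  swap
  · push Not at hR
    obtain ⟨y, hyR, hyY⟩ := hR
    exact h.subset_leaf hYc hYD hyY (h.image_R_subset_leaf j (mem_image_of_mem f hyR)) hxY
  have hYQ : ∀ y ∈ Q, f y ∉ Y := fun y hy hyY => h.image_Q_disjoint hy (hYD hyY)
  have hsub := h.subset_image_of_disjoint hYc hYQ hR hx hxA hxY
  by_cases hYC : ∃ y ∈ Y, y ∈ collapsedCore n P ε lm l0
  · obtain ⟨y, hyY, hyC⟩ := hYC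
    obtain ⟨z, hz, rfl⟩ := hsub hyY
    exact h.subset_leaf hYc hYD hyY (h.mem_leaf_of_mem_core hz.1 hz.2 hyC) hxY
  -- A component `Y` that is trapped in `I ∩ A j` and misses `C` is open as well as closed. Its
  -- preimage is clopen in `M` and misses `Q`, although `Q` meets every component of `M`.
  exfalso
  push Not at hYC
  have hYcl : IsClosed Y := isClosed_closure.of_mem_componentsOf hY.1
  have hYop : IsOpen Y := by
    rw [isOpen_iff_mem_nhds]
    intro y hy
    refine mem_of_superset (hC.isOpen_compl.connectedComponentIn.mem_nhds
      (mem_connectedComponentIn (hYC y hy))) ?_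
    exact isPreconnected_connectedComponentIn.subset_of_mem_componentsOf
      ((connectedComponentIn_subset _ _).trans subset_closure) hY.1
      (mem_connectedComponentIn (hYC y hy)) hy
  have hG : IsClopen (I' ∩ f ⁻¹' Y) := by
    constructor
    · have : I' ∩ f ⁻¹' Y = I ∩ f ⁻¹' Y := by
        refine Subset.antisymm (fun y hy => ⟨?_, hy.2⟩) (inter_subset_inter_left _ h.I_subset)
        obtain ⟨z, hz, hzy⟩ := hsub hy.2
        rw [← h.injOn (h.I_subset hz.1) hy.1 hzy]
        exact hz.1
      rw [this]
      exact h.continuousOn_I.preimage_isClosed_of_isClosed h.isCompact_I.isClosed hYcl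
    · exact ContinuousOn.isOpen_inter_preimage
        (fun y hy => (h.continuousAt y hy).continuousWithinAt) h.isOpen_I' hYop
  have hN := connectedComponentIn_mem_componentsOf (mem_univ x)
  obtain ⟨q, hqQ, hqN⟩ := (h.isConnected_Q _ hN).nonempty
  rw [connectedComponentIn_univ] at hqN
  exact hYQ q hqQ (hG.connectedComponent_subset ⟨h.I_subset hx, hxY⟩ hqN).2

/-- The component of the closure of the complement of the collapsed region that contains the image
of `Q ∩ N`. -/
def center (N : SpaceComponent M) : Set P :=
  connectedComponentIn (closure (collapsedRegion n P ε lm l0)ᶜ)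
    (f (h.isConnected_Q N.1 N.2).nonempty.some)

theorem center_mem (N : SpaceComponent M) :
    h.center N ∈ componentsOf (closure (collapsedRegion n P ε lm l0)ᶜ) :=
  connectedComponentIn_mem_componentsOf
    (subset_closure (h.image_Q_disjoint (h.isConnected_Q N.1 N.2).nonempty.some_mem.1))

theorem image_Q_subset_center (N : SpaceComponent M) : f '' (Q ∩ N.1) ⊆ h.center N := by
  refine (h.isPreconnected_image_Q N.2).subset_connectedComponentIn
    (mem_image_of_mem f (h.isConnected_Q N.1 N.2).nonempty.some_mem) ?_
  rintro _ ⟨x, hx, rfl⟩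
  exact subset_closure (h.image_Q_disjoint hx.1)

theorem lt_vMax_center (N : SpaceComponent M) : ENNReal.ofReal (lp * ε) < vMax n (h.center N) := by
  obtain ⟨l, hl, hlN⟩ := h.nonempty_L N.1 N.2
  exact (h.lt_L l hl).trans_le
    (le_vMax (h.image_Q_subset_center N (mem_image_of_mem f ⟨h.L_subset hl, hlN⟩)))

theorem center_vertex (N : SpaceComponent M) :
    h.center N ∈ collapsingVertices n P ε lm l0 lp :=
  Or.inr ⟨h.center_mem N, h.lt_vMax_center N⟩

theorem leaf_vertex (j : J) : h.leaf j ∈ collapsingVertices n P ε lm l0 lp :=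
  Or.inl (h.leaf_mem j)

theorem center_ne_leaf (N : SpaceComponent M) (j : J) : h.center N ≠ h.leaf j := by
  intro heq
  obtain ⟨q, hq⟩ := (h.isConnected_Q N.1 N.2).nonempty
  have := h.image_Q_subset_center N (mem_image_of_mem f hq)
  rw [heq] at this
  exact h.image_Q_disjoint hq.1 (componentsOf_subset (h.leaf_mem j) this)

variable [T2Space M] [LocallyConnectedSpace M]

/-- The part of `I'` outside `I` has open image inside `D`, so the closure of the complement of `D`
cannot enter it. Hence the center cannot leave the image of `I`. -/
theorem center_subset (N : SpaceComponent M) : h.center N ⊆ f '' (I ∩ N.1) := by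
  obtain ⟨q, hq⟩ := (h.isConnected_Q N.1 N.2).nonempty
  refine (isConnected_of_mem_componentsOf (h.center_mem N)).isPreconnected.subset_of_inter_eq
    (h.isOpen_image (I' ∩ N.1) inter_subset_left
      (h.isOpen_I'.inter (isOpen_spaceComponent N)))
    ((h.isCompact_I.inter_right (isClosed_spaceComponent N)).image_of_continuousOn
      (h.continuousOn_I.mono inter_subset_left)).isClosed
    ?_ (fun y _ hy => image_mono (inter_subset_inter_left _ h.I_subset) hy)
    (h.image_Q_subset_center N (mem_image_of_mem f hq))
    (mem_image_of_mem f ⟨h.I_subset (h.Q_subset hq.1), hq.2⟩)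
  rintro _ hy ⟨x, ⟨hxI', hxN⟩, rfl⟩
  refine mem_image_of_mem f ⟨by_contra fun hxI => ?_, hxN⟩
  obtain ⟨j, hj⟩ := h.exists_mem_A fun hxQ => hxI (h.Q_subset hxQ)
  have hopen : IsOpen (f '' ((I' \ I) ∩ A j)) := h.isOpen_image _
    (inter_subset_left.trans sdiff_subset)
    ((h.isOpen_I'.sdiff h.isCompact_I.isClosed).inter (h.isOpen_A j))
  obtain ⟨y, hy, hyD⟩ := mem_closure_iff.1 (componentsOf_subset (h.center_mem N) hy) _ hopen
    (mem_image_of_mem f ⟨⟨hxI', hxI⟩, hj⟩)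
  exact hyD (Or.inl (h.image_R_subset j (image_mono (h.collar j) hy)))

theorem isCompact_center (N : SpaceComponent M) : IsCompact (h.center N) :=
  (h.isCompact_I.image_of_continuousOn h.continuousOn_I).of_isClosed_subset
    (isClosed_closure.of_mem_componentsOf (h.center_mem N))
    ((h.center_subset N).trans (image_mono inter_subset_left))

theorem vMin_center_pos (N : SpaceComponent M) : 0 < vMin n (h.center N) := by
  refine lt_of_le_of_lt zero_le (lt_vMin_of_isCompact (n := n)
    (h.isCompact_I.image_of_continuousOn h.continuousOn_I)
    (ENNReal.ofReal_lt_top (r := lm * ε)) ?_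
    ((h.center_subset N).trans (image_mono inter_subset_left)))
  rintro _ ⟨x, hx, rfl⟩
  exact h.lt_I x hx

theorem center_injective : Function.Injective h.center := by
  intro N N' heq
  obtain ⟨q, hqQ, hqN⟩ := (h.isConnected_Q N.1 N.2).nonempty
  have h₁ := h.image_Q_subset_center N (mem_image_of_mem f ⟨hqQ, hqN⟩)
  rw [heq] at h₁
  obtain ⟨x, ⟨hxI, hxN⟩, hxq⟩ := h.center_subset N' h₁
  rw [h.injOn (h.I_subset hxI) (h.I_subset (h.Q_subset hqQ)) hxq] at hxN
  exact Subtype.ext (eq_of_mem_componentsOf N.2 N'.2 hqN hxN)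

/-- A path runs from the collar to `Q`. On its stretch between the last visit to the collar and the
first visit to `Q`, the last point in `D` belongs to both vertices. -/
theorem nonempty_center_inter_leaf [LocallyPathConnectedSpace M] [LocallyConnectedSpace P]
    (hC : IsClosed (collapsedCore n P ε lm l0)) (hD : IsClosed (collapsedRegion n P ε lm l0))
    {N : SpaceComponent M} {j : J} (hRN : (R j ∩ N.1).Nonempty) :
    (h.center N ∩ h.leaf j).Nonempty := by
  obtain ⟨r, hrR, hrN⟩ := hRN
  obtain ⟨q, hqQ, hqN⟩ := (h.isConnected_Q N.1 N.2).nonempty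
  have hpath : IsPathConnected N.1 := (isOpen_spaceComponent N).isConnected_iff_isPathConnected.1
    (isConnected_of_mem_componentsOf N.2)
  obtain ⟨γ, hγ⟩ := hpath.joinedIn r hrN q hqN
  have hQR : ∀ x ∈ Q, x ∉ R j := fun x hxQ hxR => (h.lt_Q x hxQ).not_ge (h.le_R j x hxR)
  obtain ⟨t₁, ht₁Q, ht₁⟩ : ∃ t₁, IsLeast (γ ⁻¹' Q) t₁ :=
    (h.isCompact_Q.isClosed.preimage γ.continuous).isCompact.exists_isLeast ⟨1, by simpa⟩
  obtain ⟨t₀, ⟨ht₀R, ht₀₁⟩, ht₀⟩ : ∃ t₀, IsGreatest (γ ⁻¹' R j ∩ Iic t₁) t₀ :=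
    (((h.isCompact_R j).isClosed.preimage γ.continuous).inter isClosed_Iic).isCompact.exists_isGreatest
      ⟨0, by simpa, unitInterval.nonneg'⟩
  have hlt : t₀ < t₁ := lt_of_le_of_ne ht₀₁ fun heq => hQR _ ht₁Q (heq ▸ ht₀R)
  have hA : ∀ t < t₁, γ t ∈ A j := by
    intro t ht
    have hsub : γ '' Iio t₁ ⊆ A j := by
      refine (isPreconnected_Iio.image γ γ.continuous.continuousOn).subset_left_of_subset_union
        (v := ⋃ i ∈ {i | i ≠ j}, A i) (h.isOpen_A j) (isOpen_biUnion fun i _ => h.isOpen_A i)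
        ?_ ?_ ⟨r, ⟨0, lt_of_le_of_lt unitInterval.nonneg' hlt, γ.source⟩, h.R_subset j hrR⟩
      · refine disjoint_left.2 fun x hx hx' => ?_
        obtain ⟨i, hi, hxi⟩ := mem_iUnion₂.1 hx'
        exact (h.disjoint_A i j hi).notMem_of_mem_left hxi hx
      · rintro _ ⟨t, ht, rfl⟩
        obtain ⟨i, hi⟩ := h.exists_mem_A fun hQ => (ht₁ hQ).not_gt ht
        by_cases hij : i = j
        · exact Or.inl (hij ▸ hi)
        · exact Or.inr (mem_iUnion₂.2 ⟨i, hij, hi⟩)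
    exact hsub ⟨t, ht, rfl⟩
  -- To leave `I` before reaching `Q` the path would have to return to the collar after `t₀`.
  have hI : ∀ t ∈ Ioc t₀ t₁, γ t ∈ I := by
    have hsub : γ '' Ioc t₀ t₁ ⊆ I := by
      refine (isPreconnected_Ioc.image γ γ.continuous.continuousOn).subset_of_inter_eq
        h.isOpen_I' h.isCompact_I.isClosed ?_ (fun _ _ hy => h.I_subset hy)
        (mem_image_of_mem γ ⟨hlt, le_rfl⟩) (h.I_subset (h.Q_subset ht₁Q))
      rintro _ ⟨t, ht, rfl⟩ hI'
      by_contra hI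
      have htt : t < t₁ := lt_of_le_of_ne ht.2 fun heq => hI (h.Q_subset (heq ▸ ht₁Q))
      exact (ht₀ ⟨h.collar j ⟨⟨hI', hI⟩, hA t htt⟩, ht.2⟩).not_gt ht.1
    exact fun t ht => hsub ⟨t, ht, rfl⟩
  have hcont : ContinuousOn (f ∘ γ) (Icc t₀ t₁) := by
    intro t ht
    refine (ContinuousAt.comp ?_ γ.continuous.continuousAt).continuousWithinAt
    rcases ht.1.eq_or_lt with rfl | h'
    · exact h.continuousAt_R j _ ht₀R
    · exact h.continuousAt _ (h.I_subset (hI t ⟨h', ht.2⟩))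
  obtain ⟨t₂, ⟨ht₂, ht₂D⟩, ht₂max⟩ :
      ∃ t₂, IsGreatest (Icc t₀ t₁ ∩ (f ∘ γ) ⁻¹' collapsedRegion n P ε lm l0) t₂ :=
    (hcont.preimage_isClosed_of_isClosed isClosed_Icc hD).isCompact.exists_isGreatest
      ⟨t₀, ⟨le_rfl, ht₀₁⟩, Or.inl (h.image_R_subset j (mem_image_of_mem f ht₀R))⟩
  have hlt₂ : t₂ < t₁ := lt_of_le_of_ne ht₂.2 fun heq => by
    rw [heq] at ht₂D
    exact h.image_Q_disjoint ht₁Q ht₂D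
  have hcont₂ : ContinuousOn (f ∘ γ) (Icc t₂ t₁) := hcont.mono (Icc_subset_Icc_left ht₂.1)
  have hcenter : (f ∘ γ) '' Icc t₂ t₁ ⊆ h.center N := by
    refine (isPreconnected_Icc.image _ hcont₂).subset_of_mem_componentsOf ?_ (h.center_mem N)
      (x := f (γ t₁)) ⟨t₁, right_mem_Icc.2 hlt₂.le, rfl⟩
      (h.image_Q_subset_center N (mem_image_of_mem f ⟨ht₁Q, hγ t₁⟩))
    -- After `t₂` the path is outside `D`, so at `t₂` itself it is in the closure of the complement.
    rw [← closure_Ioc hlt₂.ne] at hcont₂ ⊢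
    refine hcont₂.image_closure.trans (closure_mono ?_)
    rintro _ ⟨t, ht, rfl⟩ htD
    exact (ht₂max ⟨⟨ht₂.1.trans ht.1.le, ht.2⟩, htD⟩).not_gt ht.1
  refine ⟨f (γ t₂), hcenter ⟨t₂, left_mem_Icc.2 hlt₂.le, rfl⟩, ?_⟩
  rcases ht₂.1.eq_or_lt with heq | hlt'
  · exact h.image_R_subset_leaf j (mem_image_of_mem f (heq ▸ ht₀R))
  · exact h.mem_leaf hC (hI t₂ ⟨hlt', ht₂.2⟩) (hA t₂ hlt₂) ht₂D

/-- The two vertices touch, so their distance is zero. A further component of `D` has positive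
distance to the leaf, and a further vertex outside `D` is closed and disjoint from the compact
center. -/
theorem adj_center_leaf [LocallyPathConnectedSpace M] [CompleteSpace P] [SecondCountableTopology P]
    [LocallyCompactSpace P] [IsPathMetric P] (hvol : riemVol n (univ : Set P) < ⊤)
    {N : SpaceComponent M} {j : J} (hRN : (R j ∩ N.1).Nonempty) :
    (collapsingGraph n P ε lm l0 lp).Adj ⟨h.center N, h.center_vertex N⟩
      ⟨h.leaf j, h.leaf_vertex j⟩ := by
  have hC := isClosed_collapsedCore (P := P) (l0 := l0) hvol h.lm_mul_pos
  obtain ⟨y, hyN, hyj⟩ := h.nonempty_center_inter_leaf hC (isClosed_collapsedRegion hC) hRN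
  have h0 : setDist (h.center N) (h.leaf j) = 0 := setDist_eq_zero_of_mem hyN hyj
  refine ⟨fun heq => h.center_ne_leaf N j (congrArg Subtype.val heq), by simp [h0], ?_⟩
  rintro ⟨Z, hZ⟩ hne hne'
  change setDist (h.center N) (h.leaf j) < setDist (h.center N) Z + setDist Z (h.leaf j)
  rw [h0]
  rcases hZ with hZ | ⟨hZ, _⟩
  · exact (setDist_pos_of_ne hvol h.lm_mul_pos h.lm_mul_le hZ (h.leaf_mem j) fun heq =>
      hne' (Subtype.ext heq)).trans_le le_add_self
  · refine ((h.isCompact_center N).setDist_pos (isClosed_closure.of_mem_componentsOf hZ)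
      (disjoint_left.2 fun x hx hx' => hne ?_)).trans_le le_self_add
    exact Subtype.ext (eq_of_mem_componentsOf hZ (h.center_mem N) hx' hx)

end Basic

/-! ### The morphism from the star graph. -/

section Graph

variable {n : ℕ} {M P J : Type*} [TopologicalSpace M] [EMetricSpace P] [MeasurableSpace P]
  [BorelSpace P]
  {𝓔 : EndData M J} {f : M → P} {ε lm l0 lp : ℝ} {L Q I I' : Set M} {R : J → Set M}
  (h : CoreFit n (fun j => 𝓔.E j 0) f ε lm l0 lp L Q I I' R)

/-- The vertices of the collapsing graph of `P` that belong to the components and the ends of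
`M`. -/
def vertexMap : SpaceComponent M ⊕ SpaceEnd M → collapsingVertices n P ε lm l0 lp :=
  Sum.elim (fun N => ⟨h.center N, h.center_vertex N⟩)
    fun e => ⟨h.leaf (𝓔.equivSpaceEnd.symm e), h.leaf_vertex _⟩

include h in
theorem nonempty_R_inter_component (e : SpaceEnd M) :
    (R (𝓔.equivSpaceEnd.symm e) ∩ e.component.1).Nonempty := by
  obtain ⟨r, hr⟩ := (h.isConnected_R (𝓔.equivSpaceEnd.symm e)).nonempty
  refine ⟨r, hr, ?_⟩
  have := 𝓔.E_subset_component (𝓔.equivSpaceEnd.symm e) 0 (h.R_subset _ hr)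
  rwa [show 𝓔.toSpaceEnd (𝓔.equivSpaceEnd.symm e) = e from 𝓔.equivSpaceEnd.apply_symm_apply e]
    at this

variable [T2Space M] [LocallyConnectedSpace M] [LocallyPathConnectedSpace M]
  [CompleteSpace P] [SecondCountableTopology P] [LocallyCompactSpace P] [IsPathMetric P]

/-- The graph morphism from the star graph of `M` to the collapsing graph of `P`. -/
def starHom (hvol : riemVol n (univ : Set P) < ⊤) :
    endStarGraph M →g collapsingGraph n P ε lm l0 lp where
  toFun := h.vertexMap
  map_rel' := by
    rintro a b ⟨e, ⟨rfl, rfl⟩ | ⟨rfl, rfl⟩⟩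
    · exact h.adj_center_leaf hvol (h.nonempty_R_inter_component e)
    · exact (h.adj_center_leaf hvol (h.nonempty_R_inter_component e)).symm

end Graph

/-! ### The collapsing graph of the limit, seen through the identity map. -/

section Identity

variable {n : ℕ} {M J : Type*} [EMetricSpace M] [MeasurableSpace M] [BorelSpace M]
  {𝓔 : EndData M J} {ε lm l0 lp : ℝ} {L Q I I' : Set M} {R : J → Set M}
  (h : CoreFit n (fun j => 𝓔.E j 0) id ε lm l0 lp L Q I I' R)

include h

theorem E_subset_leaf {s : ℕ} (hR : ∀ j, R j ⊆ 𝓔.E j s)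
    (hE : ∀ j, ∀ x ∈ 𝓔.E j s, unitBallVol n x ≤ ENNReal.ofReal (l0 * ε)) (j : J) :
    𝓔.E j s ⊆ h.leaf j := by
  obtain ⟨x, hx, hxm⟩ := h.exists_R j
  refine h.subset_leaf (𝓔.isConnected j s).isPreconnected (subset_union_of_subset_left
    ((𝓔.isConnected j s).isPreconnected.subset_collapsedCore (hE j) (hR j hx) hxm) _) (hR j hx) ?_
  exact h.image_R_subset_leaf j (mem_image_of_mem id hx)

theorem leaf_subset_E (j : J) : h.leaf j ⊆ 𝓔.E j 0 := by
  obtain ⟨r, hr⟩ := (h.isConnected_R j).nonempty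
  exact 𝓔.subset_of_isPreconnected (isConnected_of_mem_componentsOf (h.leaf_mem j)).isPreconnected
    (fun x hx => h.compl_Q_subset fun hxQ =>
      h.image_Q_disjoint hxQ (componentsOf_subset (h.leaf_mem j) hx))
    (h.image_R_subset_leaf j (mem_image_of_mem id hr)) (h.R_subset j hr)

theorem leaf_injective : Function.Injective h.leaf := by
  intro i j hij
  obtain ⟨x, hx⟩ := (isConnected_of_mem_componentsOf (h.leaf_mem i)).nonempty
  exact 𝓔.eq_of_mem (h.leaf_subset_E i hx) (h.leaf_subset_E j (hij ▸ hx))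

theorem leaf_subset_component (e : SpaceEnd M) :
    h.leaf (𝓔.equivSpaceEnd.symm e) ⊆ e.component.1 := by
  have h₁ := (h.leaf_subset_E (𝓔.equivSpaceEnd.symm e)).trans (𝓔.E_subset_component _ 0)
  rwa [show 𝓔.toSpaceEnd (𝓔.equivSpaceEnd.symm e) = e from 𝓔.equivSpaceEnd.apply_symm_apply e]
    at h₁

theorem exists_leaf_eq [LocallyConnectedSpace M] (hC : IsClosed (collapsedCore n M ε lm l0))
    {s : ℕ} (hI : (𝓔.core s : Set M) ⊆ I)
    (hR : ∀ j, R j ⊆ 𝓔.E j s)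
    (hE : ∀ j, ∀ x ∈ 𝓔.E j s, unitBallVol n x ≤ ENNReal.ofReal (l0 * ε)) {Z : Set M}
    (hZ : Z ∈ componentsOf (collapsedRegion n M ε lm l0)) : ∃ j, Z = h.leaf j := by
  obtain ⟨x, hx⟩ := (isConnected_of_mem_componentsOf hZ).nonempty
  have hxD := componentsOf_subset hZ hx
  suffices ∃ j, x ∈ h.leaf j by
    obtain ⟨j, hj⟩ := this
    exact ⟨j, eq_of_mem_componentsOf hZ (h.leaf_mem j) hx hj⟩
  by_cases hxI : x ∈ I
  · obtain ⟨j, hj⟩ := h.exists_mem_A fun hxQ => h.image_Q_disjoint hxQ hxD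
    exact ⟨j, h.mem_leaf hC hxI hj hxD⟩
  · have : x ∈ (𝓔.core s : Set M)ᶜ := fun hx => hxI (hI hx)
    rw [𝓔.compl_core] at this
    obtain ⟨j, hj⟩ := mem_iUnion.1 this
    exact ⟨j, h.E_subset_leaf hR hE j hj⟩

/-- Volumes above `λ₊ε`, and hence above `ε`, occur only in `Q`, whose intersection with each
component lies in one center. -/
theorem exists_center_eq (hl0 : l0 < 1) {s : ℕ} (hI : (𝓔.core s : Set M) ⊆ I)
    (hE : ∀ j, ∀ x ∈ 𝓔.E j s, unitBallVol n x ≤ ENNReal.ofReal (l0 * ε)) {Z : Set M}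
    (hZ : Z ∈ componentsOf (closure (collapsedRegion n M ε lm l0)ᶜ))
    (hZv : ENNReal.ofReal (lp * ε) < vMax n Z) : ∃ N, Z = h.center N := by
  obtain ⟨x, hxZ, hx⟩ : ∃ x ∈ Z, ENNReal.ofReal (lp * ε) < unitBallVol n x := by
    simpa [vMax, lt_iSup_iff] using hZv
  have hxε : ENNReal.ofReal ε < unitBallVol n x :=
    (ENNReal.ofReal_le_ofReal h.le_lp_mul).trans_lt hx
  have hxI : x ∈ I := by
    by_contra hxI
    have : x ∈ (𝓔.core s : Set M)ᶜ := fun hx => hxI (hI hx)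
    rw [𝓔.compl_core] at this
    obtain ⟨j, hj⟩ := mem_iUnion.1 this
    refine hxε.not_ge ((hE j x hj).trans (ENNReal.ofReal_le_ofReal ?_))
    exact mul_le_of_le_one_left h.ε_pos.le hl0.le
  have hxQ : x ∈ Q := by_contra fun hxQ => hxε.not_ge (h.le_I x hxI hxQ)
  refine ⟨⟨_, connectedComponentIn_mem_componentsOf (mem_univ x)⟩,
    eq_of_mem_componentsOf hZ (h.center_mem _) hxZ (h.image_Q_subset_center _ ?_)⟩
  exact mem_image_of_mem id ⟨hxQ, mem_connectedComponentIn (mem_univ x)⟩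

theorem center_subset_component [LocallyConnectedSpace M] (N : SpaceComponent M) :
    h.center N ⊆ N.1 := by
  intro x hx
  obtain ⟨y, hy, rfl⟩ := h.center_subset N hx
  exact hy.2

variable [CompleteSpace M] [SecondCountableTopology M] [LocallyCompactSpace M] [IsPathMetric M]

/-- The leaf contains a neighborhood of its end, along which `v` tends to zero. -/
theorem vMin_leaf (hvol : riemVol n (univ : Set M) < ⊤) {s : ℕ} (hR : ∀ j, R j ⊆ 𝓔.E j s)
    (hE : ∀ j, ∀ x ∈ 𝓔.E j s, unitBallVol n x ≤ ENNReal.ofReal (l0 * ε)) (j : J) :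
    vMin n (h.leaf j) = 0 := by
  refine le_antisymm (le_of_forall_gt_imp_ge_of_dense fun δ hδ => ?_) zero_le
  obtain ⟨G, hG, hGδ⟩ := exists_isCompact_unitBallVol_le (n := n) hvol hδ
  obtain ⟨s', hs'⟩ := 𝓔.exists_disjoint G hG
  obtain ⟨x, hx, hx'⟩ := 𝓔.nonempty_inter j s s'
  exact (vMin_le (h.E_subset_leaf hR hE j hx)).trans
    (hGδ x ((hs' j).notMem_of_mem_left hx'))

variable [LocallyPathConnectedSpace M]

/-- The collapsing graph of a manifold with finitely many ends is its star graph. -/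
theorem exists_iso (hvol : riemVol n (univ : Set M) < ⊤) (hl0 : l0 < 1) {s : ℕ}
    (hI : (𝓔.core s : Set M) ⊆ I) (hR : ∀ j, R j ⊆ 𝓔.E j s)
    (hE : ∀ j, ∀ x ∈ 𝓔.E j s, unitBallVol n x ≤ ENNReal.ofReal (l0 * ε)) :
    ∃ Φ : endStarGraph M ≃g collapsingGraph n M ε lm l0 lp, ⇑Φ = h.vertexMap := by
  have hC := isClosed_collapsedCore (P := M) (l0 := l0) hvol h.lm_mul_pos
  have hbij : Function.Bijective h.vertexMap := by
    constructor
    · rintro (N | e) (N' | e') heq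
      · exact congrArg _ (h.center_injective (congrArg Subtype.val heq))
      · exact absurd (congrArg Subtype.val heq) (h.center_ne_leaf _ _)
      · exact absurd (congrArg Subtype.val heq) (h.center_ne_leaf _ _).symm
      · exact congrArg _ (𝓔.equivSpaceEnd.symm.injective
          (h.leaf_injective (congrArg Subtype.val heq)))
    · rintro ⟨Z, hZ⟩
      rcases hZ with hZ | ⟨hZ, hZv⟩
      · obtain ⟨j, rfl⟩ := h.exists_leaf_eq hC hI hR hE hZ
        exact ⟨Sum.inr (𝓔.equivSpaceEnd j), Subtype.ext (by simp [vertexMap])⟩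
      · obtain ⟨N, rfl⟩ := h.exists_center_eq hl0 hI hE hZ hZv
        exact ⟨Sum.inl N, rfl⟩
  have hcl : ∀ N e, (collapsingGraph n M ε lm l0 lp).Adj (h.vertexMap (Sum.inl N))
      (h.vertexMap (Sum.inr e)) → N = e.component := fun N e hadj =>
    eq_of_setDist_lt_top (h.center_subset_component N) (h.leaf_subset_component e) hadj.2.1
  refine ⟨⟨Equiv.ofBijective _ hbij, ?_⟩, rfl⟩
  intro a b
  refine ⟨fun hadj => ?_, fun hadj => (h.starHom hvol).map_adj hadj⟩
  change (collapsingGraph n M ε lm l0 lp).Adj (h.vertexMap a) (h.vertexMap b) at hadj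
  rcases a with N | e <;> rcases b with N' | e'
  · refine absurd ?_ hadj.1
    rw [eq_of_setDist_lt_top (h.center_subset_component N) (h.center_subset_component N')
      hadj.2.1]
  · exact ⟨e', Or.inl ⟨by rw [hcl N e' hadj], rfl⟩⟩
  · exact ⟨e, Or.inr ⟨rfl, by rw [hcl N' e hadj.symm]⟩⟩
  -- Two leaves at finite distance lie in the same component and touch the same center. The detour
  -- through the center has length zero, so the strict inequality fails.
  · exfalso
    have hee : e.component = e'.component := eq_of_setDist_lt_top
      (h.leaf_subset_component e) (h.leaf_subset_component e') hadj.2.1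
    have hzero : ∀ e₁ : SpaceEnd M, setDist (h.center e₁.component)
        (h.leaf (𝓔.equivSpaceEnd.symm e₁)) = 0 := by
      intro e₁
      obtain ⟨y, hy, hy'⟩ := h.nonempty_center_inter_leaf hC (isClosed_collapsedRegion hC)
        (h.nonempty_R_inter_component e₁)
      exact setDist_eq_zero_of_mem hy hy'
    have hlt := hadj.2.2 (h.vertexMap (Sum.inl e.component))
      (fun heq => Sum.inl_ne_inr (hbij.1 heq)) (fun heq => Sum.inl_ne_inr (hbij.1 heq))
    have h₁ : setDist (h.vertexMap (Sum.inr e)).1 (h.vertexMap (Sum.inl e.component)).1 = 0 := by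
      rw [setDist_comm]
      exact hzero e
    have h₂ : setDist (h.vertexMap (Sum.inl e.component)).1 (h.vertexMap (Sum.inr e')).1 = 0 := by
      rw [hee]
      exact hzero e'
    rw [h₁, h₂, add_zero] at hlt
    exact not_lt_zero hlt

end Identity

end CoreFit

/-! ### Maps between Riemannian manifolds -/

section Lipschitz

variable {E : Type*} [NormedAddCommGroup E] [NormedSpace ℝ E]
  {H : Type*} [TopologicalSpace H] {I : ModelWithCorners ℝ E H}
  {M : Type*} [EMetricSpace M] [ChartedSpace H M]
  [RiemannianBundle (fun x : M ↦ TangentSpace I x)] [IsRiemannianManifold I M]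

theorem exists_path_of_edist_lt {x y : M} {r : ℝ≥0∞} (h : edist x y < r) :
    ∃ γ : ℝ → M, γ 0 = x ∧ γ 1 = y ∧ ContMDiffOn 𝓘(ℝ, ℝ) I 1 γ (Icc 0 1) ∧
      pathELength I γ 0 1 < r := by
  rw [IsRiemannianManifold.out (I := I) x y] at h
  exact exists_lt_of_riemannianEDist_lt h

theorem edist_le_pathELength {γ : ℝ → M} {a b s t : ℝ} (hγ : ContMDiffOn 𝓘(ℝ, ℝ) I 1 γ (Icc a b))
    (hs : a ≤ s) (hst : s ≤ t) (ht : t ≤ b) : edist (γ s) (γ t) ≤ pathELength I γ s t := by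
  rw [IsRiemannianManifold.out (I := I)]
  exact riemannianEDist_le_pathELength (hγ.mono (Icc_subset_Icc hs ht)) rfl rfl hst

theorem path_mem_eball {γ : ℝ → M} {r : ℝ≥0∞} (hγ : ContMDiffOn 𝓘(ℝ, ℝ) I 1 γ (Icc 0 1))
    (hr : pathELength I γ 0 1 < r) {t : ℝ} (ht : t ∈ Icc (0 : ℝ) 1) :
    γ t ∈ Metric.eball (γ 0) r :=
  Metric.mem_eball'.2 (((edist_le_pathELength hγ le_rfl ht.1 ht.2).trans
    (pathELength_mono le_rfl ht.2)).trans_lt hr)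

theorem isPathMetric_of_isRiemannianManifold {E : Type*} [NormedAddCommGroup E] [NormedSpace ℝ E]
    {H : Type*} [TopologicalSpace H] (I : ModelWithCorners ℝ E H)
    (M : Type*) [EMetricSpace M] [ChartedSpace H M]
    [RiemannianBundle (fun x : M ↦ TangentSpace I x)] [IsRiemannianManifold I M] :
    IsPathMetric M where
  isPreconnected_eball x r := by
    refine isPreconnected_of_forall x fun y hy => ?_
    obtain ⟨γ, rfl, rfl, hγ, hr⟩ := exists_path_of_edist_lt (I := I) (Metric.mem_eball'.1 hy)
    refine ⟨γ '' Icc 0 1, ?_, ⟨0, by simp, rfl⟩, ⟨1, by simp, rfl⟩,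
      isPreconnected_Icc.image γ hγ.continuousOn⟩
    rintro _ ⟨t, ht, rfl⟩
    exact path_mem_eball hγ hr ht
  exists_between x y a b h ha hb := by
    obtain ⟨γ, rfl, rfl, hγ, hr⟩ := exists_path_of_edist_lt (I := I) h
    by_cases hxa : edist (γ 0) (γ 1) < a
    · exact ⟨γ 1, hxa, by simpa using hb⟩
    push Not at hxa
    -- The path is cut where its distance from the starting point equals `a'`; what remains has
    -- length less than `b`.
    obtain ⟨a', ha', haa'⟩ : ∃ a' < a, pathELength I γ 0 1 < a' + b := by
      rcases lt_or_ge (pathELength I γ 0 1) b with hlt | hle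
      · obtain ⟨a', h₀, h₁⟩ := exists_between ha
        exact ⟨a', h₁, hlt.trans_le le_add_self⟩
      · have hbt : b ≠ ⊤ := ne_top_of_le_ne_top hr.ne_top hle
        obtain ⟨a', h₀, h₁⟩ := exists_between (ENNReal.sub_lt_of_lt_add hle hr)
        refine ⟨a', h₁, ?_⟩
        rw [← tsub_add_cancel_of_le hle]
        exact ENNReal.add_lt_add_right hbt h₀
    obtain ⟨t, ht, hta⟩ : ∃ t ∈ Icc (0 : ℝ) 1, edist (γ 0) (γ t) = a' := by
      have hc : ContinuousOn (fun t => edist (γ 0) (γ t)) (Icc 0 1) :=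
        Continuous.comp_continuousOn (continuous_const.edist continuous_id) hγ.continuousOn
      have := intermediate_value_Icc zero_le_one hc
      exact this ⟨by simp, ha'.le.trans hxa⟩
    refine ⟨γ t, hta ▸ ha', ?_⟩
    have h₁ := edist_le_pathELength hγ le_rfl ht.1 ht.2
    have h₂ := edist_le_pathELength hγ ht.1 ht.2 le_rfl
    rw [← pathELength_add ht.1 ht.2, ← hta] at haa'
    have h₃ : edist (γ 0) (γ t) + edist (γ t) (γ 1) < edist (γ 0) (γ t) + b :=
      (add_le_add h₁ h₂).trans_lt haa'
    exact lt_of_add_lt_add_left h₃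

variable {E' : Type*} [NormedAddCommGroup E'] [NormedSpace ℝ E']
  {H' : Type*} [TopologicalSpace H'] {I' : ModelWithCorners ℝ E' H'}
  {M' : Type*} [EMetricSpace M'] [ChartedSpace H' M']
  [RiemannianBundle (fun x : M' ↦ TangentSpace I' x)] [IsRiemannianManifold I' M']
  {f : M → M'} {U : Set M} {C : ℝ≥0}

omit [IsRiemannianManifold I M] [IsRiemannianManifold I' M'] in
theorem pathELength_comp_le (hU : IsOpen U) (hf : ContMDiffOn I I' 1 f U)
    (hC : ∀ x ∈ U, ∀ w : TangentSpace I x, ‖mfderiv I I' f x w‖ₑ ≤ C * ‖w‖ₑ) {γ : ℝ → M} {a b : ℝ}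
    (hγ : ContMDiffOn 𝓘(ℝ, ℝ) I 1 γ (Icc a b)) (hγU : ∀ t ∈ Icc a b, γ t ∈ U) :
    pathELength I' (f ∘ γ) a b ≤ C * pathELength I γ a b := by
  rw [pathELength_eq_lintegral_mfderiv_Ioo, pathELength_eq_lintegral_mfderiv_Ioo,
    ← lintegral_const_mul' _ _ ENNReal.coe_ne_top]
  refine setLIntegral_mono' measurableSet_Ioo fun t ht => ?_
  have htI := Ioo_subset_Icc_self ht
  have hγt : MDifferentiableAt 𝓘(ℝ, ℝ) I γ t :=
    ((hγ t htI).contMDiffAt (Icc_mem_nhds ht.1 ht.2)).mdifferentiableAt one_ne_zero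
  have hft : MDifferentiableAt I I' f (γ t) :=
    ((hf _ (hγU t htI)).contMDiffAt (hU.mem_nhds (hγU t htI))).mdifferentiableAt one_ne_zero
  rw [mfderiv_comp t hft hγt]
  exact hC _ (hγU t htI) _

omit [IsRiemannianManifold I M] in
theorem edist_comp_le (hU : IsOpen U) (hf : ContMDiffOn I I' 1 f U)
    (hC : ∀ x ∈ U, ∀ w : TangentSpace I x, ‖mfderiv I I' f x w‖ₑ ≤ C * ‖w‖ₑ) {γ : ℝ → M} {a b : ℝ}
    (hab : a ≤ b) (hγ : ContMDiffOn 𝓘(ℝ, ℝ) I 1 γ (Icc a b)) (hγU : ∀ t ∈ Icc a b, γ t ∈ U) :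
    edist (f (γ a)) (f (γ b)) ≤ C * pathELength I γ a b :=
  (edist_le_pathELength (I := I') (hf.comp hγ hγU) le_rfl hab le_rfl).trans
    (pathELength_comp_le hU hf hC hγ hγU)

theorem edist_map_le (hU : IsOpen U) (hf : ContMDiffOn I I' 1 f U)
    (hC : ∀ x ∈ U, ∀ w : TangentSpace I x, ‖mfderiv I I' f x w‖ₑ ≤ C * ‖w‖ₑ) {x y : M} {r : ℝ≥0∞}
    (hr : Metric.eball x r ⊆ U) (hxy : edist x y < r) :
    edist (f x) (f y) ≤ C * edist x y := by
  have key : ∀ b > edist x y, edist (f x) (f y) ≤ C * b := by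
    intro b hb
    obtain ⟨γ, rfl, rfl, hγ, hγr⟩ := exists_path_of_edist_lt (I := I) (lt_min hb hxy)
    have hγU : ∀ t ∈ Icc (0 : ℝ) 1, γ t ∈ U := fun t ht =>
      hr (path_mem_eball hγ (hγr.trans_le (min_le_right _ _)) ht)
    exact (edist_comp_le hU hf hC zero_le_one hγ hγU).trans
      (mul_le_mul_right (hγr.le.trans (min_le_left _ _)) _)
  refine ENNReal.le_mul_of_forall_lt (Or.inr hxy.ne_top) (Or.inl ENNReal.coe_ne_top)
    fun c hc d hd => (key d hd).trans ?_
  gcongr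

theorem exists_lipschitzOnWith (hU : IsOpen U) (hf : ContMDiffOn I I' 1 f U)
    (hC : ∀ x ∈ U, ∀ w : TangentSpace I x, ‖mfderiv I I' f x w‖ₑ ≤ C * ‖w‖ₑ) {x : M}
    (hx : x ∈ U) : ∃ V ∈ 𝓝 x, LipschitzOnWith C f V := by
  obtain ⟨r, hr, hrU⟩ := Metric.nhds_basis_eball.mem_iff.1 (hU.mem_nhds hx)
  have hr4 : 0 < r / 2 / 2 := ENNReal.half_pos (ENNReal.half_pos hr.ne').ne'
  -- With a quarter of the radius, points of the small ball are less than `r / 2` apart, and the `r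
  -- / 2`-balls around them stay in the ball of radius `r`, so almost shortest paths remain in `U`.
  refine ⟨Metric.eball x (r / 2 / 2), Metric.eball_mem_nhds x hr4, fun y hy z hz => ?_⟩
  have hyz : edist y z < r / 2 := by
    calc edist y z ≤ edist y x + edist x z := edist_triangle _ _ _
      _ < r / 2 / 2 + r / 2 / 2 := ENNReal.add_lt_add hy (Metric.mem_eball'.1 hz)
      _ = r / 2 := ENNReal.add_halves _
  refine edist_map_le hU hf hC (fun w hw => hrU ?_) hyz
  calc edist w x ≤ edist w y + edist y x := edist_triangle _ _ _
    _ < r / 2 + r / 2 := ENNReal.add_lt_add hw (hy.trans_le ENNReal.half_le_self)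
    _ = r := ENNReal.add_halves _

end Lipschitz

/-- By second countability, `S` is cut into countably many pieces on which `f` is Lipschitz. The set
`S` may be nonmeasurable; the cutting sets `D i` are measurable, so the outer measure of `S` still
splits along them. -/
theorem euclideanHausdorffMeasure_image_le {X Y : Type*} [EMetricSpace X] [MeasurableSpace X]
    [BorelSpace X] [SecondCountableTopology X] [EMetricSpace Y] [MeasurableSpace Y] [BorelSpace Y]
    (n : ℕ) {f : X → Y} {S : Set X} {C : ℝ≥0}
    (hf : ∀ x ∈ S, ∃ V ∈ 𝓝 x, LipschitzOnWith C f V) :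
    (riemVol n : Measure Y) (f '' S) ≤ C ^ n * (riemVol n : Measure X) S := by
  have hle : ∀ T : Set X, LipschitzOnWith C f T →
      (riemVol n : Measure Y) (f '' T) ≤ C ^ n * (riemVol n : Measure X) T := by
    intro T hT
    simp only [riemVol, Measure.euclideanHausdorffMeasure_def, Measure.smul_apply]
    have := hT.hausdorffMeasure_image_le (d := n) n.cast_nonneg
    rw [ENNReal.rpow_natCast] at this
    rw [mul_smul_comm]
    gcongr
  choose! V hV hVf using hf
  obtain ⟨t, htS, htc, hcov⟩ := countable_cover_nhdsWithin (f := fun x => interior (V x))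
    fun x hx => mem_nhdsWithin_of_mem_nhds (interior_mem_nhds.2 (hV x hx))
  rcases t.eq_empty_or_nonempty with rfl | hne
  · have : S = ∅ := subset_empty_iff.1 (by simpa using hcov)
    simp [this]
  obtain ⟨e, rfl⟩ := htc.exists_eq_range hne
  let D : ℕ → Set X := disjointed fun i => interior (V (e i))
  have hD : ∀ i, MeasurableSet (D i) :=
    MeasurableSet.disjointed fun i => isOpen_interior.measurableSet
  have hSD : S ⊆ ⋃ i, D i := by
    rw [iUnion_disjointed]
    simpa using hcov
  calc (riemVol n : Measure Y) (f '' S) ≤ (riemVol n : Measure Y) (⋃ i, f '' (D i ∩ S)) := by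
        refine measure_mono ?_
        rw [← image_iUnion, ← iUnion_inter]
        exact image_mono fun x hx => ⟨hSD hx, hx⟩
    _ ≤ ∑' i, (riemVol n : Measure Y) (f '' (D i ∩ S)) := measure_iUnion_le _
    _ ≤ ∑' i, C ^ n * (riemVol n : Measure X) (D i ∩ S) := by
        refine ENNReal.tsum_le_tsum fun i => hle _ ((hVf _ (htS (mem_range_self i))).mono ?_)
        exact inter_subset_left.trans ((disjointed_subset _ i).trans interior_subset)
    _ = C ^ n * (riemVol n : Measure X).restrict S (⋃ i, D i) := by
        rw [ENNReal.tsum_mul_left, measure_iUnion (disjoint_disjointed _) hD]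
        refine congr_arg _ (tsum_congr fun i => ?_)
        rw [Measure.restrict_apply (hD i)]
    _ ≤ C ^ n * (riemVol n : Measure X) S := by
        exact mul_le_mul_right
          ((measure_mono (subset_univ _)).trans_eq (Measure.restrict_apply_univ S)) _

/-! ### The inverse function theorem on manifolds -/

section Inverse

variable {E : Type*} [NormedAddCommGroup E] [NormedSpace ℝ E] [FiniteDimensional ℝ E]
  {H : Type*} [TopologicalSpace H] {I : ModelWithCorners ℝ E H} [I.Boundaryless]
  {M : Type*} [TopologicalSpace M] [ChartedSpace H M] [IsManifold I 1 M]
  {H' : Type*} [TopologicalSpace H'] {I' : ModelWithCorners ℝ E H'}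
  {M' : Type*} [TopologicalSpace M'] [ChartedSpace H' M']

/-- In equal finite dimensions an injective differential is invertible, and the inverse function
theorem applies in charts. A right inverse suffices: where `f` is injective it agrees with the
inverse. -/
theorem ContMDiffAt.exists_rightInverse {f : M → M'} {x : M} (hf : ContMDiffAt I I' 1 f x)
    (hinj : Function.Injective (mfderiv I I' f x)) :
    ∃ g : M' → M, ContMDiffAt I' I 1 g (f x) ∧ g (f x) = x ∧ ∀ᶠ y in 𝓝 (f x), f (g y) = y := by
  have : CompleteSpace E := FiniteDimensional.complete ℝ E
  have hmf := hf.mdifferentiableAt one_ne_zero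
  obtain ⟨hcont, hF⟩ := contMDiffAt_iff.1 hf
  rw [I.range_eq_univ, contDiffWithinAt_univ] at hF
  set φ := extChartAt I x with hφ
  set ψ := extChartAt I' (f x) with hψ
  set F : E → E := ψ ∘ f ∘ φ.symm with hFdef
  have hderiv : mfderiv I I' f x = fderiv ℝ F (φ x) := by
    refine hmf.mfderiv.trans ?_
    rw [I.range_eq_univ, fderivWithin_univ]
    rfl
  have hinj' : Function.Injective (fderiv ℝ F (φ x) : E →ₗ[ℝ] E) := by
    intro v w hvw
    exact hinj (by rw [hderiv]; exact hvw)
  let e : E ≃L[ℝ] E := (LinearEquiv.ofInjectiveEndo _ hinj').toContinuousLinearEquiv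
  have hstrict : HasStrictFDerivAt F (e : E →L[ℝ] E) (φ x) := by
    have := hF.hasStrictFDerivAt one_ne_zero
    convert! this using 1
  have hFx : F (φ x) = ψ (f x) := by simp [F, φ]
  let G := hF.localInverse hstrict.hasFDerivAt one_ne_zero
  have hG : ContDiffAt ℝ 1 G (ψ (f x)) := hFx ▸ hF.to_localInverse hstrict.hasFDerivAt one_ne_zero
  have hGx : G (ψ (f x)) = φ x := hFx ▸ hstrict.localInverse_apply_image
  have hFG : ∀ᶠ z in 𝓝 (ψ (f x)), F (G z) = z := hFx ▸ hstrict.eventually_right_inverse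
  have hψc : ContMDiffAt I' 𝓘(ℝ, E) 1 ψ (f x) := contMDiffAt_extChartAt
  have hφc : ContMDiffAt 𝓘(ℝ, E) I 1 φ.symm (φ x) :=
    (contMDiffOn_extChartAt_symm x).contMDiffAt (extChartAt_target_mem_nhds x)
  have hg : ContMDiffAt I' I 1 (φ.symm ∘ G ∘ ψ) (f x) := by
    refine ContMDiffAt.comp (f x) ?_ (hG.contMDiffAt.comp (f x) hψc)
    simpa [Function.comp, hGx] using hφc
  have hgx : (φ.symm ∘ G ∘ ψ) (f x) = x := by simp [hGx, φ]
  refine ⟨φ.symm ∘ G ∘ ψ, hg, hgx, ?_⟩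
  have hsrc : ∀ᶠ y in 𝓝 (f x), f ((φ.symm ∘ G ∘ ψ) y) ∈ ψ.source := by
    have : ContinuousAt (f ∘ (φ.symm ∘ G ∘ ψ)) (f x) :=
      ContinuousAt.comp (by rw [hgx]; exact hcont) hg.continuousAt
    refine this.eventually_mem ?_
    simp only [Function.comp_apply] at hgx ⊢
    rw [hgx]
    exact extChartAt_source_mem_nhds (f x)
  filter_upwards [hsrc, hψc.continuousAt.eventually hFG, extChartAt_source_mem_nhds (I := I') (f x)]
    with y hy hy' hys
  exact ψ.injOn hy hys hy'

end Inverse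

/-! ### Images and inverses of maps with a lower bound on the differential. -/

section LocalIsometry

variable {E : Type*} [NormedAddCommGroup E] [NormedSpace ℝ E] [FiniteDimensional ℝ E]
  {H : Type*} [TopologicalSpace H] {I : ModelWithCorners ℝ E H} [I.Boundaryless]
  {M : Type*} [TopologicalSpace M] [ChartedSpace H M] [IsManifold I 1 M]
  [RiemannianBundle (fun x : M ↦ TangentSpace I x)]
  {H' : Type*} [TopologicalSpace H'] {I' : ModelWithCorners ℝ E H'}
  {M' : Type*} [TopologicalSpace M'] [ChartedSpace H' M']
  [RiemannianBundle (fun x : M' ↦ TangentSpace I' x)]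

omit [FiniteDimensional ℝ E] in
theorem enorm_tangentSpace_congr {I : ModelWithCorners ℝ E H} {M : Type*} [TopologicalSpace M]
    [ChartedSpace H M] [RiemannianBundle (fun x : M ↦ TangentSpace I x)] {x y : M} (h : x = y)
    {v : TangentSpace I x} {w : TangentSpace I y} (hvw : @Eq E v w) : ‖v‖ₑ = ‖w‖ₑ := by
  subst h
  exact congr_arg (fun v : TangentSpace I x => ‖v‖ₑ) hvw

variable {f : M → M'} {O : Set M} {C : ℝ≥0}

omit [FiniteDimensional ℝ E] [I.Boundaryless] [IsManifold I 1 M] in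
theorem injective_mfderiv_of_enorm_le {x : M}
    (h : ∀ w : TangentSpace I x, ‖w‖ₑ ≤ C * ‖mfderiv I I' f x w‖ₑ) :
    Function.Injective (mfderiv I I' f x) := by
  rw [injective_iff_map_eq_zero]
  intro w hw
  have := h w
  rw [hw, enorm_zero, mul_zero, nonpos_iff_eq_zero, enorm_eq_zero] at this
  exact this

theorem isOpen_image_of_enorm_le (hO : IsOpen O) (hf : ContMDiffOn I I' 1 f O)
    (h : ∀ x ∈ O, ∀ w : TangentSpace I x, ‖w‖ₑ ≤ C * ‖mfderiv I I' f x w‖ₑ) : IsOpen (f '' O) := by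
  rw [isOpen_iff_mem_nhds]
  rintro _ ⟨x, hx, rfl⟩
  obtain ⟨g, hg, hgx, hgf⟩ := (hf.contMDiffAt (hO.mem_nhds hx)).exists_rightInverse
    (injective_mfderiv_of_enorm_le (h x hx))
  have := hg.continuousAt.eventually_mem (hO.mem_nhds (hgx.symm ▸ hx))
  filter_upwards [hgf, this] with y hy hyO
  exact ⟨g y, hyO, hy⟩

theorem contMDiffOn_invFunOn [Nonempty M] (hO : IsOpen O) (hf : ContMDiffOn I I' 1 f O)
    (hinj : InjOn f O)
    (h : ∀ x ∈ O, ∀ w : TangentSpace I x, ‖w‖ₑ ≤ C * ‖mfderiv I I' f x w‖ₑ) :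
    ContMDiffOn I' I 1 (Function.invFunOn f O) (f '' O) ∧
    ∀ y ∈ f '' O, ∀ w : TangentSpace I' y,
      ‖mfderiv I' I (Function.invFunOn f O) y w‖ₑ ≤ C * ‖w‖ₑ := by
  set g₀ := Function.invFunOn f O
  have hC1 : ∀ y ∈ f '' O, ContMDiffAt I' I 1 g₀ y := by
    rintro _ ⟨x, hx, rfl⟩
    obtain ⟨g, hg, hgx, hgf⟩ := (hf.contMDiffAt (hO.mem_nhds hx)).exists_rightInverse
      (injective_mfderiv_of_enorm_le (h x hx))
    have := hg.continuousAt.eventually_mem (hO.mem_nhds (hgx.symm ▸ hx))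
    refine hg.congr_of_eventuallyEq ?_
    filter_upwards [hgf, this] with y hy hyO
    rw [← hinj.leftInvOn_invFunOn hyO, hy]
  refine ⟨fun y hy => (hC1 y hy).contMDiffWithinAt, fun y hy w => ?_⟩
  have hg := (hC1 y hy).mdifferentiableAt one_ne_zero
  have hgO : g₀ y ∈ O := Function.invFunOn_mem hy
  have hfg : f (g₀ y) = y := Function.invFunOn_eq hy
  have hfd := (hf.contMDiffAt (hO.mem_nhds hgO)).mdifferentiableAt one_ne_zero
  have hcomp := hfd.hasMFDerivAt.comp y hg.hasMFDerivAt
  have hid : HasMFDerivAt I' I' (f ∘ g₀) y (ContinuousLinearMap.id ℝ E) := by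
    refine (hasMFDerivAt_id y).congr_of_eventuallyEq ?_
    filter_upwards [(isOpen_image_of_enorm_le hO hf h).mem_nhds hy] with z hz
    exact Function.invFunOn_eq hz
  have heq := hasMFDerivAt_unique hcomp hid
  refine (h _ hgO _).trans ?_
  exact mul_le_mul_right (enorm_tangentSpace_congr (I := I') hfg (w := w)
    (congr_arg (fun L : E →L[ℝ] E => L w) heq)).le _

end LocalIsometry

/-! ### Unit balls under maps of bounded distortion. -/

section UnitBalls

variable {E : Type*} [NormedAddCommGroup E] [NormedSpace ℝ E] [FiniteDimensional ℝ E]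
  {H : Type*} [TopologicalSpace H] {I : ModelWithCorners ℝ E H} [I.Boundaryless]
  {M : Type*} [EMetricSpace M] [ChartedSpace H M] [IsManifold I 1 M]
  [RiemannianBundle (fun x : M ↦ TangentSpace I x)] [IsRiemannianManifold I M]
  {H' : Type*} [TopologicalSpace H'] {I' : ModelWithCorners ℝ E H'}
  {M' : Type*} [EMetricSpace M'] [ChartedSpace H' M']
  [RiemannianBundle (fun x : M' ↦ TangentSpace I' x)] [IsRiemannianManifold I' M']
  {f : M → M'} {O : Set M} {C : ℝ≥0}

/-- A path of length less than one from `f x` is lifted through the inverse of `f`, which at most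
doubles lengths, so the lift stays in the ball of radius `2`. Completeness keeps the lift from
running out of `M`. -/
theorem eball_subset_image_eball [CompleteSpace M] (hO : IsOpen O) (hf : ContMDiffOn I I' 1 f O)
    (hinj : InjOn f O)
    (h : ∀ x ∈ O, ∀ w : TangentSpace I x, ‖w‖ₑ ≤ 2 * ‖mfderiv I I' f x w‖ₑ) {x : M}
    (hx : Metric.eball x 2 ⊆ O) : Metric.eball (f x) 1 ⊆ f '' Metric.eball x 2 := by
  have : Nonempty M := ⟨x⟩
  have := isPathMetric_of_isRiemannianManifold I M
  have : LocallyCompactSpace M := Manifold.locallyCompact_of_finiteDimensional I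
  intro y hy
  obtain ⟨γ, h0, rfl, hγ, hγ1⟩ := exists_path_of_edist_lt (I := I') (Metric.mem_eball'.1 hy)
  -- The room between the length of the path and `1` gives a closed ball `B` of radius `2c < 2`. It
  -- is compact, so its image is closed, as the continuous induction along the path requires.
  obtain ⟨c, hc, hc1⟩ := ENNReal.lt_iff_exists_nnreal_btwn.1 hγ1
  have hc1' : 2 * (c : ℝ≥0∞) < 2 := by
    calc 2 * (c : ℝ≥0∞) < 2 * 1 := ENNReal.mul_lt_mul_right (by simp) (by simp) hc1
      _ = 2 := mul_one 2
  set B := Metric.cthickening (2 * (c : ℝ)) {x} with hB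
  have hmemB : ∀ z, z ∈ B ↔ edist z x ≤ 2 * (c : ℝ≥0∞) := fun z => by
    rw [hB, Metric.mem_cthickening_iff, Metric.infEDist_singleton, ENNReal.ofReal_mul (by simp)]
    simp
  have hB2 : B ⊆ Metric.eball x 2 := fun z hz => ((hmemB z).1 hz).trans_lt hc1'
  have hBO : B ⊆ O := hB2.trans hx
  have hBc : IsCompact B := isCompact_singleton.cthickening_of_isPathMetric _
  have hfB : IsClosed (f '' B) := (hBc.image_of_continuousOn (hf.continuousOn.mono hBO)).isClosed
  have hsub : Metric.eball x (2 * c) ⊆ B := fun z hz => (hmemB z).2 (le_of_lt hz)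
  obtain ⟨hg, hgC⟩ := contMDiffOn_invFunOn (C := 2) hO hf hinj h
  set g := Function.invFunOn f O
  have hfO : IsOpen (f '' O) := isOpen_image_of_enorm_le (C := 2) hO hf h
  have hfb : IsOpen (f '' Metric.eball x (2 * c)) :=
    isOpen_image_of_enorm_le (C := 2) Metric.isOpen_eball (hf.mono (hsub.trans hBO))
      fun z hz => h z (hBO (hsub hz))
  have hclosed : IsClosed (γ ⁻¹' (f '' B) ∩ Icc 0 1) := by
    rw [inter_comm]
    exact hγ.continuousOn.preimage_isClosed_of_isClosed isClosed_Icc hfB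
  have hall : Icc 0 1 ⊆ γ ⁻¹' (f '' B) := by
    refine hclosed.Icc_subset_of_forall_mem_nhdsGT_of_Icc_subset ?_ ?_
    · exact ⟨x, (hmemB x).2 (by simp), h0.symm⟩
    · intro t ht htB
      have hγt : ContMDiffOn 𝓘(ℝ, ℝ) I' 1 γ (Icc 0 t) := hγ.mono (Icc_subset_Icc_right ht.2.le)
      have hd : edist (g (γ 0)) (g (γ t)) ≤ 2 * pathELength I' γ 0 t :=
        edist_comp_le (C := 2) hfO hg hgC ht.1 hγt fun s hs => image_mono hBO (htB hs)
      have hg0 : g (γ 0) = x := by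
        rw [h0]
        exact hinj.leftInvOn_invFunOn (hBO ((hmemB x).2 (by simp)))
      have hmem : γ t ∈ f '' Metric.eball x (2 * c) := by
        refine ⟨g (γ t), ?_, Function.invFunOn_eq (image_mono hBO (htB ⟨ht.1, le_rfl⟩))⟩
        rw [hg0] at hd
        refine Metric.mem_eball'.2 (hd.trans_lt (ENNReal.mul_lt_mul_right (by simp) (by simp) ?_))
        exact (pathELength_mono le_rfl ht.2.le).trans_lt hc
      have hct : ContinuousWithinAt γ (Icc 0 1) t := hγ.continuousOn t ⟨ht.1, ht.2.le⟩
      have h₁ := hct.preimage_mem_nhdsWithin (hfb.mem_nhds hmem)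
      have h₂ : Icc (0 : ℝ) 1 ∈ 𝓝[>] t := mem_of_superset (Ioo_mem_nhdsGT ht.2)
        (Ioo_subset_Icc_self.trans (Icc_subset_Icc_left ht.1))
      refine mem_of_superset (nhdsWithin_le_of_mem h₂ h₁) fun s hs => image_mono hsub hs
  exact image_mono hB2 (hall ⟨zero_le_one, le_rfl⟩)

variable [SecondCountableTopology M] [MeasurableSpace M] [BorelSpace M]
  [SecondCountableTopology M'] [MeasurableSpace M'] [BorelSpace M']

-- The map `f` is 2-Lipschitz on small scales, so the ball of radius `1/2` goes into the unit ball;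
-- the inverse loses a factor of at most `2 ^ n` in volume.
omit [SecondCountableTopology M] in
theorem riemVol_eball_half_le_unitBallVol (n : ℕ) (hO : IsOpen O) (hf : ContMDiffOn I I' 1 f O)
    (hinj : InjOn f O)
    (hle : ∀ x ∈ O, ∀ w : TangentSpace I x, ‖mfderiv I I' f x w‖ₑ ≤ 2 * ‖w‖ₑ)
    (h : ∀ x ∈ O, ∀ w : TangentSpace I x, ‖w‖ₑ ≤ 2 * ‖mfderiv I I' f x w‖ₑ) {x : M}
    (hx : Metric.eball x 1 ⊆ O) :
    riemVol n (Metric.eball x 2⁻¹) ≤ 2 ^ n * unitBallVol n (f x) := by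
  have : Nonempty M := ⟨x⟩
  have hhalf : (2⁻¹ : ℝ≥0∞) ≤ 1 := by simp
  have hsub : f '' Metric.eball x 2⁻¹ ⊆ Metric.eball (f x) 1 := by
    rintro _ ⟨y, hy, rfl⟩
    have hy' : edist x y < 2⁻¹ := Metric.mem_eball'.1 hy
    refine Metric.mem_eball'.2 ((edist_map_le (C := 2) hO hf hle hx
      (hy'.trans_le hhalf)).trans_lt ?_)
    calc (2 : ℝ≥0∞) * edist x y < 2 * 2⁻¹ := ENNReal.mul_lt_mul_right (by simp) (by simp) hy'
      _ = 1 := ENNReal.mul_inv_cancel (by simp) (by simp)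
  have hSO : Metric.eball x 2⁻¹ ⊆ O := (Metric.eball_subset_eball hhalf).trans hx
  obtain ⟨hg, hgC⟩ := contMDiffOn_invFunOn (C := 2) hO hf hinj h
  have hfO : IsOpen (f '' O) := isOpen_image_of_enorm_le (C := 2) hO hf h
  have hgf : Function.invFunOn f O '' (f '' Metric.eball x 2⁻¹) = Metric.eball x 2⁻¹ := by
    rw [image_image]
    exact (image_congr fun y hy => hinj.leftInvOn_invFunOn (hSO hy)).trans (image_id' _)
  calc riemVol n (Metric.eball x 2⁻¹)
      = riemVol n (Function.invFunOn f O '' (f '' Metric.eball x 2⁻¹)) := by rw [hgf]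
    _ ≤ (2 : ℝ≥0) ^ n * riemVol n (f '' Metric.eball x 2⁻¹) :=
        euclideanHausdorffMeasure_image_le n fun y hy =>
          exists_lipschitzOnWith (C := 2) hfO hg hgC (image_mono hSO hy)
    _ ≤ 2 ^ n * unitBallVol n (f x) := mul_le_mul_right (measure_mono hsub) _

omit [SecondCountableTopology M'] in
theorem unitBallVol_le_riemVol_eball_two [CompleteSpace M] (n : ℕ) (hO : IsOpen O)
    (hf : ContMDiffOn I I' 1 f O) (hinj : InjOn f O)
    (hle : ∀ x ∈ O, ∀ w : TangentSpace I x, ‖mfderiv I I' f x w‖ₑ ≤ 2 * ‖w‖ₑ)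
    (h : ∀ x ∈ O, ∀ w : TangentSpace I x, ‖w‖ₑ ≤ 2 * ‖mfderiv I I' f x w‖ₑ) {x : M}
    (hx : Metric.eball x 2 ⊆ O) :
    unitBallVol n (f x) ≤ 2 ^ n * riemVol n (Metric.eball x 2) :=
  (measure_mono (eball_subset_image_eball hO hf hinj h hx)).trans
    (euclideanHausdorffMeasure_image_le (C := 2) n fun _ hy =>
      exists_lipschitzOnWith (C := 2) hO hf hle (hx hy))

end UnitBalls

/-! ### Convergence of the pulled back metrics -/

theorem abs_norm_sq_sub_norm_sq_le {V W : Type*} [NormedAddCommGroup V] [InnerProductSpace ℝ V]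
    [NormedAddCommGroup W] [InnerProductSpace ℝ W] {n : ℕ} {b : Fin n → V} {b' : Fin n → W}
    {δ U : ℝ} (hδ : ∀ i j, |inner ℝ (b' i) (b' j) - inner ℝ (b i) (b j)| ≤ δ) {u : Fin n → ℝ}
    (hU : ∀ i, |u i| ≤ U) :
    |‖∑ i, u i • b' i‖ ^ 2 - ‖∑ i, u i • b i‖ ^ 2| ≤ n ^ 2 * (δ * U ^ 2) := by
  have hexp : ‖∑ i, u i • b' i‖ ^ 2 - ‖∑ i, u i • b i‖ ^ 2
      = ∑ i, ∑ j, u i * u j * (inner ℝ (b' i) (b' j) - inner ℝ (b i) (b j)) := by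
    rw [← real_inner_self_eq_norm_sq, ← real_inner_self_eq_norm_sq]
    simp only [sum_inner, inner_sum, real_inner_smul_left, real_inner_smul_right,
      ← Finset.sum_sub_distrib]
    refine Finset.sum_congr rfl fun i _ => Finset.sum_congr rfl fun j _ => ?_
    rw [real_inner_comm (b' i), real_inner_comm (b i)]
    ring
  rw [hexp]
  calc |∑ i, ∑ j, u i * u j * (inner ℝ (b' i) (b' j) - inner ℝ (b i) (b j))|
      ≤ ∑ i, ∑ j, |u i * u j * (inner ℝ (b' i) (b' j) - inner ℝ (b i) (b j))| :=
        (Finset.abs_sum_le_sum_abs _ _).trans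
          (Finset.sum_le_sum fun i _ => Finset.abs_sum_le_sum_abs _ _)
    _ ≤ ∑ _i : Fin n, ∑ _j : Fin n, δ * U ^ 2 := by
        refine Finset.sum_le_sum fun i _ => Finset.sum_le_sum fun j _ => ?_
        rw [abs_mul, abs_mul, mul_comm, sq]
        have hU0 : 0 ≤ U := (abs_nonneg _).trans (hU i)
        exact mul_le_mul (hδ i j) (mul_le_mul (hU i) (hU j) (abs_nonneg _) hU0)
          (by positivity) ((abs_nonneg _).trans (hδ i j))
    _ = n ^ 2 * (δ * U ^ 2) := by simp; ring

/-! ### Local bounds on differentials for a continuous metric. -/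

section Charts

variable {E : Type*} [NormedAddCommGroup E] [NormedSpace ℝ E]
  {H : Type*} [TopologicalSpace H] {I : ModelWithCorners ℝ E H} [I.Boundaryless]
  {M : Type*} [TopologicalSpace M] [ChartedSpace H M] [IsManifold I 1 M]
  [RiemannianBundle (fun x : M ↦ TangentSpace I x)]
  [IsContinuousRiemannianBundle E (fun x : M ↦ TangentSpace I x)]
  {F : Type*} [NormedAddCommGroup F] [NormedSpace ℝ F]

omit [I.Boundaryless] in
attribute [local instance] normedAddCommGroupTangentSpaceVectorSpace in
attribute [local instance] normedSpaceTangentSpaceVectorSpace in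
theorem exists_norm_mfderiv_extChartAt_le (x : M) :
    ∃ C > 0, ∀ᶠ y in 𝓝 x, ∀ w : TangentSpace I y,
      @norm E _ (mfderiv I 𝓘(ℝ, E) (extChartAt I x) y w) ≤ C * ‖w‖ := by
  obtain ⟨C, hC, h⟩ := eventually_norm_mfderiv_extChartAt_lt I x
  refine ⟨C, hC, h.mono fun y hy w => ?_⟩
  exact ((mfderiv I 𝓘(ℝ, E) (extChartAt I x) y).le_opNorm w).trans
    (mul_le_mul_of_nonneg_right hy.le (norm_nonneg _))

attribute [local instance] normedAddCommGroupTangentSpaceVectorSpace in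
attribute [local instance] normedSpaceTangentSpaceVectorSpace in
theorem exists_norm_mfderiv_extChartAt_symm_le (x : M) :
    ∃ C > 0, ∀ᶠ y in 𝓝 (extChartAt I x x), ∀ w : E,
      ‖mfderiv 𝓘(ℝ, E) I (extChartAt I x).symm y w‖ ≤ C * ‖w‖ := by
  obtain ⟨C, hC, h⟩ := eventually_norm_mfderivWithin_symm_extChartAt_lt I x
  rw [I.range_eq_univ, nhdsWithin_univ] at h
  refine ⟨C, hC, h.mono fun y hy w => ?_⟩
  rw [mfderivWithin_univ] at hy
  exact ((mfderiv 𝓘(ℝ, E) I (extChartAt I x).symm y).le_opNorm w).trans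
    (mul_le_mul_of_nonneg_right hy.le (norm_nonneg _))

theorem ContMDiffAt.exists_norm_mfderiv_le {φ : M → F} {x : M} (hφ : ContMDiffAt I 𝓘(ℝ, F) 1 φ x) :
    ∃ C > 0, ∀ᶠ y in 𝓝 x, ∀ w : TangentSpace I y,
      @norm F _ (mfderiv I 𝓘(ℝ, F) φ y w) ≤ C * ‖w‖ := by
  obtain ⟨C, hC, h⟩ := exists_norm_mfderiv_extChartAt_le (I := I) x
  set ψ := extChartAt I x with hψ
  have hG : ContDiffAt ℝ 1 (φ ∘ ψ.symm) (ψ x) := by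
    have := (contMDiffAt_iff.1 hφ).2
    rw [I.range_eq_univ, contDiffWithinAt_univ] at this
    simpa only [extChartAt_model_space_eq_id, PartialEquiv.refl_coe, Function.id_comp] using this
  have hcont : ContinuousAt (fderiv ℝ (φ ∘ ψ.symm)) (ψ x) :=
    hG.continuousAt_fderiv one_ne_zero
  have hbd : ∀ᶠ z in 𝓝 (ψ x), ‖fderiv ℝ (φ ∘ ψ.symm) z‖ < ‖fderiv ℝ (φ ∘ ψ.symm) (ψ x)‖ + 1 :=
    hcont.norm.eventually (gt_mem_nhds (by simp))
  have hdiff : ∀ᶠ z in 𝓝 (ψ x), DifferentiableAt ℝ (φ ∘ ψ.symm) z :=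
    (hG.eventually (by simp)).mono fun z hz => hz.differentiableAt one_ne_zero
  have hψc : ContinuousAt ψ x := continuousAt_extChartAt x
  refine ⟨(‖fderiv ℝ (φ ∘ ψ.symm) (ψ x)‖ + 1) * C, by positivity, ?_⟩
  filter_upwards [h, hψc.eventually hbd, hψc.eventually hdiff,
    (isOpen_extChartAt_source (I := I) x).mem_nhds (mem_extChartAt_source x)] with y hy hyb hyd hys w
  have hψd : MDifferentiableAt I 𝓘(ℝ, E) ψ y :=
    (contMDiffAt_extChartAt' (n := 1) (by simpa using hys)).mdifferentiableAt one_ne_zero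
  have heq : φ =ᶠ[𝓝 y] (φ ∘ ψ.symm) ∘ ψ := by
    filter_upwards [(isOpen_extChartAt_source (I := I) x).mem_nhds hys] with z hz
    simp only [Function.comp_apply, hψ, (extChartAt I x).left_inv hz]
  have hcomp : HasMFDerivAt I 𝓘(ℝ, F) φ y
      ((fderiv ℝ (φ ∘ ψ.symm) (ψ y)).comp (mfderiv I 𝓘(ℝ, E) ψ y : _ →L[ℝ] E)) :=
    (hyd.hasFDerivAt.hasMFDerivAt.comp y hψd.hasMFDerivAt).congr_of_eventuallyEq heq
  rw [hcomp.mfderiv]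
  calc ‖fderiv ℝ (φ ∘ ψ.symm) (ψ y) (mfderiv I 𝓘(ℝ, E) ψ y w)‖
      ≤ ‖fderiv ℝ (φ ∘ ψ.symm) (ψ y)‖ * @norm E _ (mfderiv I 𝓘(ℝ, E) ψ y w) :=
        ContinuousLinearMap.le_opNorm _ _
    _ ≤ (‖fderiv ℝ (φ ∘ ψ.symm) (ψ x)‖ + 1) * (C * ‖w‖) :=
        mul_le_mul hyb.le (hy w) (norm_nonneg _) (by positivity)
    _ = _ := by ring

end Charts

/-! ### From metric coefficients to the distortion of lengths. -/

section Pullback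

variable {n : ℕ} {M : Type*} [TopologicalSpace M] [ChartedSpace (EuclideanSpace ℝ (Fin n)) M]

theorem mfderiv_symm_apply_mfderiv {φ : OpenPartialHomeomorph M (EuclideanSpace ℝ (Fin n))}
    (hφ : ContMDiffOn (𝓡 n) (𝓡 n) 1 φ φ.source)
    (hφ' : ContMDiffOn (𝓡 n) (𝓡 n) 1 φ.symm φ.target) {y : EuclideanSpace ℝ (Fin n)}
    (hy : y ∈ φ.target) (w : TangentSpace (𝓡 n) (φ.symm y)) :
    mfderiv (𝓡 n) (𝓡 n) φ.symm y
      (mfderiv (𝓡 n) (𝓡 n) φ (φ.symm y) w : EuclideanSpace ℝ (Fin n)) = w := by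
  have hA := ((hφ.contMDiffAt (φ.open_source.mem_nhds (φ.map_target hy))).mdifferentiableAt
    one_ne_zero).hasMFDerivAt
  have hB := ((hφ'.contMDiffAt (φ.open_target.mem_nhds hy)).mdifferentiableAt
    one_ne_zero).hasMFDerivAt
  have hid : HasMFDerivAt (𝓡 n) (𝓡 n) (φ ∘ φ.symm) y
      (ContinuousLinearMap.id ℝ (EuclideanSpace ℝ (Fin n))) := by
    refine (hasMFDerivAt_id y).congr_of_eventuallyEq ?_
    filter_upwards [φ.open_target.mem_nhds hy] with z hz
    exact φ.right_inv hz
  have heq := hasMFDerivAt_unique (hA.comp y hB) hid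
  let A : EuclideanSpace ℝ (Fin n) →L[ℝ] EuclideanSpace ℝ (Fin n) :=
    mfderiv (𝓡 n) (𝓡 n) φ (φ.symm y)
  let B : EuclideanSpace ℝ (Fin n) →L[ℝ] EuclideanSpace ℝ (Fin n) :=
    mfderiv (𝓡 n) (𝓡 n) φ.symm y
  have hAB : (A : EuclideanSpace ℝ (Fin n) →ₗ[ℝ] EuclideanSpace ℝ (Fin n)) *
      (B : EuclideanSpace ℝ (Fin n) →ₗ[ℝ] EuclideanSpace ℝ (Fin n)) = 1 := by
    ext1 v
    exact congr_arg (fun L : EuclideanSpace ℝ (Fin n) →L[ℝ] EuclideanSpace ℝ (Fin n) => L v) heq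
  have hBA := mul_eq_one_comm.1 hAB
  exact congr_arg
    (fun L : EuclideanSpace ℝ (Fin n) →ₗ[ℝ] EuclideanSpace ℝ (Fin n) => L w) hBA

variable [RiemannianBundle (fun x : M ↦ TangentSpace (𝓡 n) x)]
  {M' : Type*} [TopologicalSpace M'] [ChartedSpace (EuclideanSpace ℝ (Fin n)) M']
  [RiemannianBundle (fun x : M' ↦ TangentSpace (𝓡 n) x)]

/-- A bound on the coefficients of `f^* g' - g` in a chart bounds the distortion of norms. -/
theorem abs_norm_sq_mfderiv_sub_le {φ : OpenPartialHomeomorph M (EuclideanSpace ℝ (Fin n))}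
    (hφ : ContMDiffOn (𝓡 n) (𝓡 n) 1 φ φ.source)
    (hφ' : ContMDiffOn (𝓡 n) (𝓡 n) 1 φ.symm φ.target) {f : M → M'} {x : M} (hx : x ∈ φ.source)
    (hf : MDifferentiableAt (𝓡 n) (𝓡 n) f x) {δ C : ℝ}
    (hδ : ‖pullbackMetric n (f ∘ φ.symm) (φ x) - pullbackMetric n φ.symm (φ x)‖ ≤ δ)
    (w : TangentSpace (𝓡 n) x)
    (hC : @norm (EuclideanSpace ℝ (Fin n)) _ (mfderiv (𝓡 n) (𝓡 n) φ x w) ≤ C * ‖w‖) :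
    |‖mfderiv (𝓡 n) (𝓡 n) f x w‖ ^ 2 - ‖w‖ ^ 2| ≤ n ^ 2 * (δ * (C * ‖w‖) ^ 2) := by
  obtain ⟨y, hy, rfl⟩ : ∃ y ∈ φ.target, φ.symm y = x := ⟨φ x, φ.map_source hx, φ.left_inv hx⟩
  rw [φ.right_inv hy] at hδ
  have hB := (hφ'.contMDiffAt (φ.open_target.mem_nhds hy)).mdifferentiableAt one_ne_zero
  let u : EuclideanSpace ℝ (Fin n) := mfderiv (𝓡 n) (𝓡 n) φ (φ.symm y) w
  let e : Fin n → EuclideanSpace ℝ (Fin n) := fun i => EuclideanSpace.single i (1 : ℝ)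
  have hu : u = ∑ i, u i • e i := by
    ext j
    simp [e, Finset.sum_apply, Pi.single_apply]
  have hw : mfderiv (𝓡 n) (𝓡 n) φ.symm y u = w := mfderiv_symm_apply_mfderiv hφ hφ' hy w
  let b : Fin n → TangentSpace (𝓡 n) (φ.symm y) := fun i => mfderiv (𝓡 n) (𝓡 n) φ.symm y (e i)
  let b' : Fin n → TangentSpace (𝓡 n) (f (φ.symm y)) :=
    fun i => mfderiv (𝓡 n) (𝓡 n) f (φ.symm y) (b i)
  have hwb : w = ∑ i, u i • b i := by
    rw [← hw]
    conv_lhs => rw [hu]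
    exact (map_sum (mfderiv (𝓡 n) (𝓡 n) φ.symm y) _ _).trans
      (Finset.sum_congr rfl fun i _ => map_smul (mfderiv (𝓡 n) (𝓡 n) φ.symm y) _ _)
  have hwb' : mfderiv (𝓡 n) (𝓡 n) f (φ.symm y) w = ∑ i, u i • b' i := by
    rw [hwb, map_sum]
    exact Finset.sum_congr rfl fun i _ => map_smul _ _ _
  have hmain := abs_norm_sq_sub_norm_sq_le (b := b) (b' := b') (δ := δ) (U := C * ‖w‖) (u := u)
    (fun i j => ?_) fun i => (PiLp.norm_apply_le u i).trans hC
  · rwa [← hwb, ← hwb'] at hmain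
  · let D : Fin n → Fin n → ℝ := pullbackMetric n (f ∘ φ.symm) y - pullbackMetric n φ.symm y
    have h₁ := (norm_le_pi_norm (D i) j).trans ((norm_le_pi_norm D i).trans hδ)
    rw [Real.norm_eq_abs] at h₁
    convert! h₁ using 2
    simp only [D, Pi.sub_apply, pullbackMetric]
    rw [mfderiv_comp y hf hB]
    rfl

theorem enorm_le_coe_mul {V W : Type*} [SeminormedAddCommGroup V] [SeminormedAddCommGroup W]
    {C : ℝ≥0} {v : V} {w : W} (h : ‖v‖ ≤ C * ‖w‖) : ‖v‖ₑ ≤ C * ‖w‖ₑ := by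
  simp only [enorm_eq_nnnorm]
  exact_mod_cast h

theorem PullbackMetricsTendsto.eventually_enorm_le [IsManifold (𝓡 n) 1 M]
    [IsContinuousRiemannianBundle (EuclideanSpace ℝ (Fin n)) (fun x : M ↦ TangentSpace (𝓡 n) x)]
    {N : ℕ → Type*} [∀ k, TopologicalSpace (N k)]
    [∀ k, ChartedSpace (EuclideanSpace ℝ (Fin n)) (N k)]
    [∀ k, RiemannianBundle (fun x : N k ↦ TangentSpace (𝓡 n) x)] {α : ℝ≥0} {Ω : Set M}
    {f : ∀ k, M → N k} (h : PullbackMetricsTendsto n α N Ω f) (hΩ : IsOpen Ω)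
    (hf : ∀ k, ContMDiffOn (𝓡 n) (𝓡 n) 1 (f k) Ω) {T : Set M} (hT : IsCompact T) (hTΩ : T ⊆ Ω) :
    ∀ᶠ k in atTop, ∀ x ∈ T, ∀ w : TangentSpace (𝓡 n) x,
      ‖mfderiv (𝓡 n) (𝓡 n) (f k) x w‖ₑ ≤ 2 * ‖w‖ₑ ∧
      ‖w‖ₑ ≤ 2 * ‖mfderiv (𝓡 n) (𝓡 n) (f k) x w‖ₑ := by
  obtain ⟨S, hS, hconv⟩ := h
  have hloc : ∀ x ∈ T, ∃ V ∈ 𝓝 x, ∀ᶠ k in atTop, ∀ y ∈ V, ∀ w : TangentSpace (𝓡 n) y,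
      ‖mfderiv (𝓡 n) (𝓡 n) (f k) y w‖ₑ ≤ 2 * ‖w‖ₑ ∧
      ‖w‖ₑ ≤ 2 * ‖mfderiv (𝓡 n) (𝓡 n) (f k) y w‖ₑ := by
    intro x hx
    obtain ⟨φ, hφS, hxφ⟩ := mem_iUnion₂.1 (hS.symm ▸ hTΩ hx)
    obtain ⟨⟨⟨hφ, -⟩, ⟨hφ', -⟩⟩, hlim⟩ := hconv φ hφS
    obtain ⟨C, hC, hCb⟩ :=
      (hφ.contMDiffAt (φ.open_source.mem_nhds hxφ)).exists_norm_mfderiv_le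
    -- With this `δ` squared norms change by at most a half, so norms change by a factor well within
    -- `2` in both directions.
    obtain ⟨δ, hδ, hδC⟩ : ∃ δ > 0, (n : ℝ) ^ 2 * (δ * C ^ 2) ≤ 1 / 2 := by
      refine ⟨1 / (2 * ((n : ℝ) ^ 2 * C ^ 2 + 1)), by positivity, ?_⟩
      rw [show (n : ℝ) ^ 2 * (1 / (2 * ((n : ℝ) ^ 2 * C ^ 2 + 1)) * C ^ 2)
        = (n : ℝ) ^ 2 * C ^ 2 / (2 * ((n : ℝ) ^ 2 * C ^ 2 + 1)) by ring, div_le_iff₀ (by positivity)]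
      nlinarith [sq_nonneg ((n : ℝ) * C)]
    refine ⟨_, inter_mem (φ.open_source.mem_nhds hxφ) hCb, ?_⟩
    filter_upwards [hlim.eventually (gt_mem_nhds (ENNReal.ofReal_pos.2 hδ))] with k hk y hy w
    have hnorm : ‖pullbackMetric n (f k ∘ φ.symm) (φ y) - pullbackMetric n φ.symm (φ y)‖ ≤ δ := by
      rw [← ENNReal.ofReal_le_ofReal_iff hδ.le, ofReal_norm]
      refine le_trans ?_ hk.le
      -- Only the supremum part of the Hölder norm matters.
      exact le_add_right (le_iSup₂_of_le (φ y) (φ.map_source hy.1) le_rfl)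
    have hyΩ : y ∈ Ω := hS ▸ mem_iUnion₂.2 ⟨φ, hφS, hy.1⟩
    have hbd := abs_norm_sq_mfderiv_sub_le hφ hφ' hy.1
      (((hf k).contMDiffAt (hΩ.mem_nhds hyΩ)).mdifferentiableAt one_ne_zero) hnorm w (hy.2 w)
    have hbd' : |‖mfderiv (𝓡 n) (𝓡 n) (f k) y w‖ ^ 2 - ‖w‖ ^ 2| ≤ 1 / 2 * ‖w‖ ^ 2 := by
      refine hbd.trans ?_
      calc (n : ℝ) ^ 2 * (δ * (C * ‖w‖) ^ 2) = (n : ℝ) ^ 2 * (δ * C ^ 2) * ‖w‖ ^ 2 := by ring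
        _ ≤ 1 / 2 * ‖w‖ ^ 2 := mul_le_mul_of_nonneg_right hδC (sq_nonneg _)
    obtain ⟨h₁, h₂⟩ := abs_le.1 hbd'
    constructor
    · exact enorm_le_coe_mul (C := 2)
        (abs_le_of_sq_le_sq' (by push_cast; nlinarith [sq_nonneg ‖w‖]) (by positivity)).2
    · exact enorm_le_coe_mul (C := 2)
        (abs_le_of_sq_le_sq' (by push_cast; nlinarith [sq_nonneg ‖w‖]) (by positivity)).2
  choose! V hV hVk using hloc
  obtain ⟨t, htT, hcov⟩ := hT.elim_nhds_subcover V hV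
  filter_upwards [(Finset.eventually_all t).2 fun x hx => hVk x (htT x hx)] with k hk y hy
  obtain ⟨x, hx, hyx⟩ := mem_iUnion₂.1 (hcov hy)
  exact hk x hx y hyx

end Pullback

/-! ### Lower bounds for the volumes of small balls -/

section VolCollapse

variable {n : ℕ} {M : Type*} [EMetricSpace M] [MeasurableSpace M] [BorelSpace M]

theorem riemVol_eball_pos_of_volCollapse_pos [NeZero n] {x : M} (h : 0 < volCollapse n x) {r : ℝ}
    (hr : r ∈ Ioo (0 : ℝ) 1) : 0 < riemVol n (Metric.eball x (ENNReal.ofReal r)) := by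
  have := h.trans_le (iInf₂_le r hr)
  exact pos_iff_ne_zero.2 fun h0 => by simp [h0] at this

variable [SecondCountableTopology M] [ChartedSpace (EuclideanSpace ℝ (Fin n)) M]
  [IsManifold (𝓡 n) 1 M] [RiemannianBundle (fun x : M ↦ TangentSpace (𝓡 n) x)]
  [IsContinuousRiemannianBundle (EuclideanSpace ℝ (Fin n)) (fun x : M ↦ TangentSpace (𝓡 n) x)]
  [IsRiemannianManifold (𝓡 n) M]

/-- A chart is bi-Lipschitz near `x₀`, so a metric ball contains the preimage of a Euclidean ball of
proportional radius, with a constant uniform in the center and in the radius. -/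
theorem exists_mul_le_riemVol_eball [NeZero n] (x₀ : M) :
    ∃ C : ℝ≥0, ∀ᶠ x in 𝓝 x₀, ∀ r ∈ Ioo (0 : ℝ) 1,
      volume (Metric.ball (0 : EuclideanSpace ℝ (Fin n)) 1) * ENNReal.ofReal (r ^ n) ≤
        C * riemVol n (Metric.eball x (ENNReal.ofReal r)) := by
  obtain ⟨C, hC, hCψ⟩ := exists_norm_mfderiv_extChartAt_le (I := 𝓡 n) x₀
  obtain ⟨C', hC', hC'ψ⟩ := exists_norm_mfderiv_extChartAt_symm_le (I := 𝓡 n) x₀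
  lift C to ℝ≥0 using hC.le
  lift C' to ℝ≥0 using hC'.le
  set ψ := extChartAt (𝓡 n) x₀ with hψ
  have hsrc : ∀ᶠ y in 𝓝 x₀, y ∈ ψ.source := extChartAt_source_mem_nhds x₀
  obtain ⟨V, hV, hVo, hxV⟩ := eventually_nhds_iff.1 (hCψ.and hsrc)
  have hψV : ContMDiffOn (𝓡 n) (𝓡 n) 1 ψ V :=
    contMDiffOn_extChartAt.mono fun y hy => by rw [← extChartAt_source (𝓡 n)]; exact (hV y hy).2
  have hψs : ContinuousAt ψ.symm (ψ x₀) := continuousAt_extChartAt_symm x₀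
  have hVs : ∀ᶠ z in 𝓝 (ψ x₀), ψ.symm z ∈ V :=
    hψs.eventually_mem (by simpa [hψ] using hVo.mem_nhds hxV)
  obtain ⟨ρ, hρ, hB⟩ := Metric.eventually_nhds_iff_ball.1
    (hC'ψ.and (hVs.and (extChartAt_target_mem_nhds x₀)))
  set B := Metric.ball (ψ x₀) ρ
  have hψB : ContMDiffOn (𝓡 n) (𝓡 n) 1 ψ.symm B :=
    (contMDiffOn_extChartAt_symm x₀).mono fun z hz => (hB z hz).2.2
  have hle : ∀ y ∈ V, ∀ w : TangentSpace (𝓡 n) y, ‖mfderiv (𝓡 n) (𝓡 n) ψ y w‖ₑ ≤ C * ‖w‖ₑ := by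
    intro y hy w
    rw [enorm_tangentSpace_vectorSpace]
    exact enorm_le_coe_mul ((hV y hy).1 w)
  have hle' : ∀ z ∈ B, ∀ w : TangentSpace (𝓡 n) z,
      ‖mfderiv (𝓡 n) (𝓡 n) ψ.symm z w‖ₑ ≤ C' * ‖w‖ₑ := by
    intro z hz w
    rw [enorm_tangentSpace_vectorSpace (v := w)]
    exact enorm_le_coe_mul ((hB z hz).1 w)
  -- This makes `s = r * r₀ / C'` at most `ρ / 2` for all radii `r < 1`, so the chart ball `B`
  -- serves all of them, while `C' * s = r * r₀` is at most `r`.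
  set r₀ : ℝ := min 1 (C' * (ρ / 2)) with hr₀
  have hr₀pos : 0 < r₀ := lt_min one_pos (by positivity)
  have hψc : ContinuousAt ψ x₀ := continuousAt_extChartAt x₀
  refine ⟨(C' / r₀.toNNReal * C) ^ n, ?_⟩
  filter_upwards [hψc.eventually_mem (Metric.ball_mem_nhds _ (half_pos hρ)), hsrc] with x hx hxs r hr
  set s : ℝ := r * r₀ / C' with hs
  have hspos : 0 < s := by have := hr.1; positivity
  have hsρ : s ≤ ρ / 2 := by
    rw [hs, div_le_iff₀ hC']
    calc r * r₀ ≤ 1 * (C' * (ρ / 2)) :=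
          mul_le_mul hr.2.le (min_le_right _ _) hr₀pos.le zero_le_one
      _ = ρ / 2 * C' := by ring
  have hball : Metric.eball (ψ x) (ENNReal.ofReal (ρ / 2)) ⊆ B := by
    rw [Metric.eball_ofReal]
    refine Metric.ball_subset_ball' ?_
    have : dist (ψ x) (ψ x₀) < ρ / 2 := hx
    linarith
  have hSB : Metric.ball (ψ x) s ⊆ B := by
    rw [← Metric.eball_ofReal]
    exact (Metric.eball_subset_eball (ENNReal.ofReal_le_ofReal hsρ)).trans hball
  have himg : ψ.symm '' Metric.ball (ψ x) s ⊆ Metric.eball x (ENNReal.ofReal r) := by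
    rintro _ ⟨z, hz, rfl⟩
    have hz' : edist (ψ x) z < ENNReal.ofReal s := by
      rw [← Metric.mem_eball', Metric.eball_ofReal]
      exact hz
    have h₁ := edist_map_le (I := 𝓡 n) (I' := 𝓡 n) Metric.isOpen_ball hψB hle' hball
      (hz'.trans_le (ENNReal.ofReal_le_ofReal hsρ))
    rw [ψ.left_inv hxs] at h₁
    refine Metric.mem_eball'.2 (h₁.trans_lt ?_)
    calc (C' : ℝ≥0∞) * edist (ψ x) z < C' * ENNReal.ofReal s :=
          ENNReal.mul_lt_mul_right (by simpa using hC'.ne') (by simp) hz'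
      _ = ENNReal.ofReal (r * r₀) := by
          rw [← ENNReal.ofReal_coe_nnreal, ← ENNReal.ofReal_mul hC'.le, hs]
          congr 1
          field_simp
      _ ≤ ENNReal.ofReal r :=
          ENNReal.ofReal_le_ofReal (mul_le_of_le_one_right hr.1.le (min_le_left _ _))
  have hS : ψ '' (ψ.symm '' Metric.ball (ψ x) s) = Metric.ball (ψ x) s := by
    rw [image_image]
    exact (image_congr fun z hz => ψ.right_inv (hB z (hSB hz)).2.2).trans (image_id' _)
  have hvol : volume (Metric.ball (ψ x) s) ≤
      C ^ n * riemVol n (Metric.eball x (ENNReal.ofReal r)) := by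
    rw [← EuclideanSpace.euclideanHausdorffMeasure_eq_volume n, ← hS]
    refine (euclideanHausdorffMeasure_image_le (C := C) n ?_).trans
      (mul_le_mul_right (measure_mono himg) _)
    rintro _ ⟨z, hz, rfl⟩
    exact exists_lipschitzOnWith (I := 𝓡 n) (I' := 𝓡 n) hVo hψV hle (hB z (hSB hz)).2.1
  rw [Measure.addHaar_ball _ _ hspos.le, finrank_euclideanSpace_fin] at hvol
  have hrn : ENNReal.ofReal (r ^ n) = ((C' / r₀.toNNReal) ^ n : ℝ≥0) * ENNReal.ofReal (s ^ n) := by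
    rw [← ENNReal.ofReal_coe_nnreal, ← ENNReal.ofReal_mul (NNReal.coe_nonneg _)]
    push_cast
    rw [Real.coe_toNNReal _ hr₀pos.le, ← mul_pow, hs]
    congr 2
    field_simp
  calc volume (Metric.ball (0 : EuclideanSpace ℝ (Fin n)) 1) * ENNReal.ofReal (r ^ n)
      = ((C' / r₀.toNNReal) ^ n : ℝ≥0) *
        (ENNReal.ofReal (s ^ n) * volume (Metric.ball (0 : EuclideanSpace ℝ (Fin n)) 1)) := by
        rw [hrn]; ring
    _ ≤ ((C' / r₀.toNNReal) ^ n : ℝ≥0) *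
        (C ^ n * riemVol n (Metric.eball x (ENNReal.ofReal r))) := mul_le_mul_right hvol _
    _ = _ := by rw [mul_pow]; push_cast; ring

theorem exists_lt_volCollapse [NeZero n] (x₀ : M) :
    ∃ η : ℝ, 0 < η ∧ ∀ᶠ x in 𝓝 x₀, ENNReal.ofReal η < volCollapse n x := by
  obtain ⟨C, hC⟩ := exists_mul_le_riemVol_eball (n := n) x₀
  refine ⟨((C : ℝ) + 1)⁻¹ / 2, by positivity, hC.mono fun x hx => ?_⟩
  have h₁ : ENNReal.ofReal (((C : ℝ) + 1)⁻¹ / 2) < ENNReal.ofReal (((C : ℝ) + 1)⁻¹) :=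
    (ENNReal.ofReal_lt_ofReal_iff (by positivity)).2 (half_lt_self (by positivity))
  refine h₁.trans_le (le_iInf₂ fun r hr => ?_)
  have hω : volume (Metric.ball (0 : EuclideanSpace ℝ (Fin n)) 1) ≠ ⊤ := measure_ball_lt_top.ne
  have hω0 : volume (Metric.ball (0 : EuclideanSpace ℝ (Fin n)) 1) ≠ 0 :=
    (Metric.measure_ball_pos _ _ one_pos).ne'
  have hr0 : ENNReal.ofReal (r ^ n) ≠ 0 := (ENNReal.ofReal_pos.2 (pow_pos hr.1 n)).ne'
  rw [ENNReal.le_div_iff_mul_le (Or.inl (mul_ne_zero hω0 hr0))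
    (Or.inl (ENNReal.mul_ne_top hω ENNReal.ofReal_ne_top)), ENNReal.ofReal_inv_of_pos (by positivity),
    mul_comm, ← div_eq_mul_inv]
  refine ENNReal.div_le_of_le_mul ?_
  rw [mul_comm (riemVol n _)]
  refine (hx r hr).trans (mul_le_mul_left ?_ _)
  rw [← ENNReal.ofReal_coe_nnreal]
  exact ENNReal.ofReal_le_ofReal (by simp)

/-- It guarantees that the domains of the embeddings in the definition of convergence contain any
given compact set once the parameter is small. -/
theorem exists_subset_volCollapse [NeZero n] {T : Set M} (hT : IsCompact T) :
    ∃ η : ℝ, 0 < η ∧ T ⊆ {x | ENNReal.ofReal η < volCollapse n x} := by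
  choose η hη h using exists_lt_volCollapse (n := n) (M := M)
  obtain ⟨t, -, hcov⟩ := hT.elim_nhds_subcover _ fun x _ => h x
  rcases t.eq_empty_or_nonempty with rfl | hne
  · exact ⟨1, one_pos, hcov.trans (by simp)⟩
  obtain ⟨x₁, hx₁, hmin⟩ := t.exists_min_image η hne
  refine ⟨η x₁, hη x₁, fun x hx => ?_⟩
  obtain ⟨y, hy, hxy⟩ := mem_iUnion₂.1 (hcov hx)
  exact (ENNReal.ofReal_le_ofReal (hmin y hy)).trans_lt hxy

theorem riemVol_eball_pos [NeZero n] (x : M) {r : ℝ} (hr : r ∈ Ioo (0 : ℝ) 1) :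
    0 < riemVol n (Metric.eball x (ENNReal.ofReal r)) := by
  obtain ⟨η, -, h⟩ := exists_lt_volCollapse (n := n) x
  exact riemVol_eball_pos_of_volCollapse_pos (bot_le.trans_lt h.self_of_nhds) hr

end VolCollapse

/-! ### Choice of the constants -/

/-- Constants and compact sets as in `CoreFit`, for all maps `f` for which the unit ball volumes at
`f x` lie between `vl x` and `vu x`. -/
structure VolumeCore {M J : Type*} [TopologicalSpace M] (𝓔 : EndData M J) (vl vu : M → ℝ≥0∞)
    (ε lm l0 lp : ℝ) (s : ℕ) (L Q I I' T : Set M) (R : J → Set M) : Prop where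
  ε_pos : 0 < ε
  lm_pos : 0 < lm
  lm_lt : lm < l0
  lt_one : l0 < 1
  lt_lp : 1 < lp
  isCompact_I : IsCompact I
  core_subset : (𝓔.core s : Set M) ⊆ I
  isOpen_I' : IsOpen I'
  I_subset : I ⊆ I'
  isCompact_Q : IsCompact Q
  Q_subset : Q ⊆ I
  L_subset : L ⊆ Q
  compl_Q_subset : Qᶜ ⊆ ⋃ j, 𝓔.E j 0
  isConnected_Q : ∀ N ∈ componentsOf (univ : Set M), IsConnected (Q ∩ N)
  nonempty_L : ∀ N ∈ componentsOf (univ : Set M), (L ∩ N).Nonempty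
  isConnected_R : ∀ j, IsConnected (R j)
  isCompact_R : ∀ j, IsCompact (R j)
  R_subset : ∀ j, R j ⊆ 𝓔.E j s
  collar : ∀ j, (I' \ I) ∩ 𝓔.E j 0 ⊆ R j
  isCompact_T : IsCompact T
  I'_subset_T : I' ⊆ T
  R_subset_T : ∀ j, R j ⊆ T
  lt_L : ∀ x ∈ L, ENNReal.ofReal (lp * ε) < vl x
  lt_Q : ∀ x ∈ Q, ENNReal.ofReal (l0 * ε) < vl x
  le_compl_Q : ∀ x ∉ Q, vu x ≤ ENNReal.ofReal ε
  lt_I : ∀ x ∈ I, ENNReal.ofReal (lm * ε) < vl x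
  le_E : ∀ j, ∀ x ∈ 𝓔.E j s, vu x ≤ ENNReal.ofReal (l0 * ε)
  exists_R : ∀ j, ∃ x ∈ R j, vu x ≤ ENNReal.ofReal (lm * ε)

theorem VolumeCore.coreFit {M J P : Type*} [TopologicalSpace M] [EMetricSpace P]
    [MeasurableSpace P] [BorelSpace P] {𝓔 : EndData M J} {vl vu : M → ℝ≥0∞} {ε lm l0 lp : ℝ}
    {s : ℕ} {L Q I I' T : Set M} {R : J → Set M}
    (h : VolumeCore 𝓔 vl vu ε lm l0 lp s L Q I I' T R) {n : ℕ} {f : M → P}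
    (hc : ∀ x ∈ T, ContinuousAt f x) (hinj : InjOn f T)
    (hopen : ∀ U ⊆ T, IsOpen U → IsOpen (f '' U)) (hl : ∀ x ∈ T, vl x ≤ unitBallVol n (f x))
    (hu : ∀ x ∈ T, unitBallVol n (f x) ≤ vu x) :
    CoreFit n (fun j => 𝓔.E j 0) f ε lm l0 lp L Q I I' R := by
  have hIT : I ⊆ T := h.I_subset.trans h.I'_subset_T
  have hQT : Q ⊆ T := h.Q_subset.trans hIT
  exact
  { ε_pos := h.ε_pos
    lm_pos := h.lm_pos
    lm_lt := h.lm_lt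
    lt_lp := h.lt_lp
    isOpen_A := fun j => 𝓔.isOpen j 0
    disjoint_A := 𝓔.disjoint
    isCompact_I := h.isCompact_I
    isOpen_I' := h.isOpen_I'
    I_subset := h.I_subset
    isCompact_Q := h.isCompact_Q
    Q_subset := h.Q_subset
    L_subset := h.L_subset
    compl_Q_subset := h.compl_Q_subset
    isConnected_Q := h.isConnected_Q
    nonempty_L := h.nonempty_L
    isConnected_R := h.isConnected_R
    isCompact_R := h.isCompact_R
    R_subset := fun j => (h.R_subset j).trans (𝓔.antitone j (Nat.zero_le s))
    collar := h.collar
    continuousAt := fun x hx => hc x (h.I'_subset_T hx)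
    continuousAt_R := fun j x hx => hc x (h.R_subset_T j hx)
    injOn := hinj.mono h.I'_subset_T
    isOpen_image := fun U hU => hopen U (hU.trans h.I'_subset_T)
    lt_L := fun x hx => (h.lt_L x hx).trans_le (hl x (hQT (h.L_subset hx)))
    lt_Q := fun x hx => (h.lt_Q x hx).trans_le (hl x (hQT hx))
    le_I := fun x hx hxQ => (hu x (hIT hx)).trans (h.le_compl_Q x hxQ)
    lt_I := fun x hx => (h.lt_I x hx).trans_le (hl x (hIT hx))
    le_R := fun j x hx => (hu x (h.R_subset_T j hx)).trans (h.le_E j x (h.R_subset j hx))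
    exists_R := fun j => by
      obtain ⟨x, hx, hxm⟩ := h.exists_R j
      exact ⟨x, hx, (hu x (h.R_subset_T j hx)).trans hxm⟩ }

section Construction

variable {M : Type*} [TopologicalSpace M] [T2Space M] [LocallyCompactSpace M]
  [LocallyConnectedSpace M]

omit [T2Space M] [LocallyCompactSpace M] in
theorem finite_spaceComponent_of_isCompact {K : Set M} (hK : IsCompact K)
    (h : ∀ N ∈ componentsOf (univ : Set M), (K ∩ N).Nonempty) : Finite (SpaceComponent M) := by
  obtain ⟨t, ht⟩ := hK.elim_finite_subcover (fun N : SpaceComponent M => N.1)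
    isOpen_spaceComponent fun x _ => mem_iUnion.2
      ⟨⟨_, connectedComponentIn_mem_componentsOf (mem_univ x)⟩, mem_connectedComponentIn (mem_univ x)⟩
  refine Set.finite_univ_iff.1 (t.finite_toSet.subset fun N _ => ?_)
  obtain ⟨x, hxK, hxN⟩ := h N.1 N.2
  obtain ⟨N', hN', hx⟩ := mem_iUnion₂.1 (ht hxK)
  rwa [show N = N' from Subtype.ext (eq_of_mem_componentsOf N.2 N'.2 hxN hx)]

/-- A compact set is contained in a compact set with connected intersections with all
components. -/
theorem exists_isCompact_superset_isConnected_inter [Finite (SpaceComponent M)] {K : Set M}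
    (hK : IsCompact K) : ∃ L, IsCompact L ∧ K ⊆ L ∧
      ∀ N ∈ componentsOf (univ : Set M), IsConnected (L ∩ N) := by
  have h : ∀ N : SpaceComponent M, ∃ K', IsCompact K' ∧ IsConnected K' ∧ K ∩ N.1 ⊆ K' ∧ K' ⊆ N.1 :=
    fun N => exists_isCompact_isConnected_superset (isOpen_spaceComponent N)
      (isConnected_of_mem_componentsOf N.2) (hK.inter_right (isClosed_spaceComponent N))
      inter_subset_right
  choose K' hK' hK'c hKK' hK'N using h
  refine ⟨⋃ N, K' N, isCompact_iUnion hK', fun x hx => ?_, fun N hN => ?_⟩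
  · exact mem_iUnion.2 ⟨⟨_, connectedComponentIn_mem_componentsOf (mem_univ x)⟩,
      hKK' _ ⟨hx, mem_connectedComponentIn (mem_univ x)⟩⟩
  · convert! hK'c ⟨N, hN⟩ using 1
    refine Subset.antisymm ?_ fun x hx => ⟨mem_iUnion.2 ⟨_, hx⟩, hK'N _ hx⟩
    rintro x ⟨hx, hxN⟩
    obtain ⟨N', hx'⟩ := mem_iUnion.1 hx
    rwa [show (⟨N, hN⟩ : SpaceComponent M) = N' from
      Subtype.ext (eq_of_mem_componentsOf hN N'.2 hxN (hK'N _ hx'))]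

theorem exists_pos_lt_ofReal_mul_lt {m : ℝ≥0∞} (hm : 0 < m) {ε c : ℝ} (hε : 0 < ε) (hc : 0 < c) :
    ∃ l, 0 < l ∧ l < c ∧ ENNReal.ofReal (l * ε) < m := by
  obtain ⟨δ, hδ, hδm⟩ := ENNReal.lt_iff_exists_nnreal_btwn.1 hm
  have hδ' : 0 < (δ : ℝ) := by exact_mod_cast hδ
  refine ⟨min (c / 2) (δ / ε), by positivity, (min_le_left _ _).trans_lt (half_lt_self hc), ?_⟩
  refine lt_of_le_of_lt ?_ hδm
  rw [← ENNReal.ofReal_coe_nnreal]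
  exact ENNReal.ofReal_le_ofReal ((le_div_iff₀ hε).1 (min_le_right _ _))

variable {J : Type*} [Finite J] (𝓔 : EndData M J) {vl vu : M → ℝ≥0∞}

theorem exists_volumeCore (hvl : LowerSemicontinuous vl) (hvl0 : ∀ x, 0 < vl x)
    (hvu : ∀ δ, 0 < δ → ∃ G, IsCompact G ∧ ∀ x ∉ G, vu x ≤ δ) :
    ∃ ε₀ : ℝ, 0 < ε₀ ∧ ∀ ε, 0 < ε → ε < ε₀ → ∃ lm l0 lp s L Q I I' T R,
      VolumeCore 𝓔 vl vu ε lm l0 lp s L Q I I' T R := by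
  choose p hp using fun j => (𝓔.isConnected j 0).nonempty
  -- A component that misses the core contains a whole neighborhood of an end; the points `p j` make
  -- sure that it is met too.
  have hK₀ : IsCompact ((𝓔.core 0 : Set M) ∪ range p) :=
    (𝓔.core 0).isCompact.union (finite_range p).isCompact
  have hK₀N : ∀ N ∈ componentsOf (univ : Set M),
      (((𝓔.core 0 : Set M) ∪ range p) ∩ N).Nonempty := by
    intro N hN
    obtain ⟨x, hx⟩ := (isConnected_of_mem_componentsOf hN).nonempty
    by_cases hxc : x ∈ (𝓔.core 0 : Set M)
    · exact ⟨x, Or.inl hxc, hx⟩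
    · obtain ⟨j, hj⟩ := mem_iUnion.1 ((𝓔.compl_core 0).subset hxc)
      exact ⟨p j, Or.inr (mem_range_self j), (𝓔.isConnected j 0).isPreconnected.subset_of_mem_componentsOf
        (subset_univ _) hN hj hx (hp j)⟩
  have := finite_spaceComponent_of_isCompact hK₀ hK₀N
  obtain ⟨L, hL, hK₀L, hLN⟩ := exists_isCompact_superset_isConnected_inter hK₀
  obtain ⟨m₀, hm₀, hLm⟩ := hvl.exists_lt_forall_le hL ENNReal.zero_lt_top fun x _ => hvl0 x
  obtain ⟨ε₀, hε₀, hε₀m⟩ := ENNReal.lt_iff_exists_nnreal_btwn.1 hm₀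
  refine ⟨ε₀, by exact_mod_cast hε₀, fun ε hε hεε₀ => ?_⟩
  -- From here on bounds alternate: smallness of `vu` at infinity yields a compact set, and the
  -- minimum of `vl` on it yields the next constant.
  obtain ⟨G, hG, hGε⟩ := hvu _ (ENNReal.ofReal_pos.2 hε)
  obtain ⟨Q, hQ, hLQ, hQN⟩ := exists_isCompact_superset_isConnected_inter (hL.union hG)
  obtain ⟨m₁, hm₁, hQm⟩ := hvl.exists_lt_forall_le hQ ENNReal.zero_lt_top fun x _ => hvl0 x
  obtain ⟨l0, hl0, hl01, hl0m⟩ := exists_pos_lt_ofReal_mul_lt hm₁ hε one_pos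
  obtain ⟨G₁, hG₁, hG₁ε⟩ := hvu _ (ENNReal.ofReal_pos.2 (mul_pos hl0 hε))
  obtain ⟨s, hs⟩ := 𝓔.exists_disjoint _ (hG₁.union hQ)
  -- The two further levels leave room for the collar: `s'` bounds `I`, `s''` bounds its
  -- neighborhood `I'`, and both lie beyond `s`.
  obtain ⟨s', hss', hs'⟩ := 𝓔.exists_closure_subset s
  obtain ⟨s'', -, hs''⟩ := 𝓔.exists_closure_subset s'
  obtain ⟨m₂, hm₂, hIm⟩ := hvl.exists_lt_forall_le (𝓔.core s').isCompact ENNReal.zero_lt_top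
    fun x _ => hvl0 x
  obtain ⟨lm, hlm, hlm0, hlmm⟩ := exists_pos_lt_ofReal_mul_lt hm₂ hε hl0
  obtain ⟨G₂, hG₂, hG₂ε⟩ := hvu _ (ENNReal.ofReal_pos.2 (mul_pos hlm hε))
  obtain ⟨t, ht⟩ := 𝓔.exists_disjoint _ hG₂
  -- The point `q j` may lie far beyond `s''`; the collar is extended to it inside `E j s` so as to
  -- acquire a point of volume at most `λ₋ε`.
  choose q hq using fun j => 𝓔.nonempty_inter j s t
  have hR : ∀ j, ∃ R, IsCompact R ∧ IsConnected R ∧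
      (closure (𝓔.E j s') ∩ 𝓔.core s'') ∪ {q j} ⊆ R ∧ R ⊆ 𝓔.E j s := fun j =>
    exists_isCompact_isConnected_superset (𝓔.isOpen j s) (𝓔.isConnected j s)
      (((𝓔.core s'').isCompact.inter_left isClosed_closure).union isCompact_singleton)
      (union_subset (inter_subset_left.trans (hs' j)) (singleton_subset_iff.2 (hq j).1))
  choose R hRc hRconn hRsup hRE using hR
  have hcore : ∀ {x : M} {r : ℕ}, x ∈ (𝓔.core r : Set M) ↔ ∀ j, x ∉ 𝓔.E j r := fun {x r} => by
    rw [← not_iff_not, ← mem_compl_iff, 𝓔.compl_core]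
    simp
  have hQE : ∀ j, ∀ x ∈ 𝓔.E j s, x ∉ Q := fun j x hx hxQ =>
    (hs j).notMem_of_mem_left hx (Or.inr hxQ)
  have hmono : (𝓔.core s : Set M) ⊆ 𝓔.core s' := fun x hx =>
    hcore.2 fun j hj => hcore.1 hx j (𝓔.antitone j hss'.le hj)
  -- The choice `λ₊ = ε₀ / ε` turns the threshold `λ₊ε` into the fixed number `ε₀`.
  refine ⟨lm, l0, ε₀ / ε, s, L, Q, 𝓔.core s', (⋃ j, closure (𝓔.E j s''))ᶜ,
    (𝓔.core s'' : Set M) ∪ ⋃ j, R j, R, ?_⟩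
  exact
  { ε_pos := hε
    lm_pos := hlm
    lm_lt := hlm0
    lt_one := hl01
    lt_lp := (one_lt_div hε).2 hεε₀
    isCompact_I := (𝓔.core s').isCompact
    core_subset := hmono
    isOpen_I' := (isClosed_iUnion_of_finite fun j => isClosed_closure).isOpen_compl
    I_subset := fun x hx hx' => by
      obtain ⟨j, hj⟩ := mem_iUnion.1 hx'
      exact hcore.1 hx j (hs'' j hj)
    isCompact_Q := hQ
    Q_subset := fun x hx => hmono (hcore.2 fun j hj => hQE j x hj hx)
    L_subset := subset_union_left.trans hLQ
    compl_Q_subset := fun x hx => (𝓔.compl_core 0).subset fun hxc =>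
      hx (hLQ (Or.inl (hK₀L (Or.inl hxc))))
    isConnected_Q := hQN
    nonempty_L := fun N hN => (hLN N hN).nonempty
    isConnected_R := hRconn
    isCompact_R := hRc
    R_subset := hRE
    collar := by
      rintro j x ⟨⟨hx', hxI⟩, hxj⟩
      obtain ⟨i, hi⟩ := mem_iUnion.1 ((𝓔.compl_core s').subset hxI)
      obtain rfl := 𝓔.eq_of_mem hi hxj
      exact hRsup i (Or.inl ⟨subset_closure hi, hcore.2 fun k hk =>
        hx' (mem_iUnion.2 ⟨k, subset_closure hk⟩)⟩)
    isCompact_T := (𝓔.core s'').isCompact.union (isCompact_iUnion hRc)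
    I'_subset_T := fun x hx => Or.inl (hcore.2 fun k hk =>
        hx (mem_iUnion.2 ⟨k, subset_closure hk⟩))
    R_subset_T := fun j => (subset_iUnion R j).trans subset_union_right
    lt_L := fun x hx => by
      rw [div_mul_cancel₀ _ hε.ne', ENNReal.ofReal_coe_nnreal]
      exact hε₀m.trans_le (hLm x hx)
    lt_Q := fun x hx => hl0m.trans_le (hQm x hx)
    le_compl_Q := fun x hx => hGε x fun hxG => hx (hLQ (Or.inr hxG))
    lt_I := fun x hx => hlmm.trans_le (hIm x hx)
    le_E := fun j x hx => hG₁ε x fun hxG => (hs j).notMem_of_mem_left hx (Or.inl hxG)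
    exists_R := fun j => ⟨q j, hRsup j (Or.inr rfl), hG₂ε _ fun hqG =>
      (ht j).notMem_of_mem_left (hq j).2 hqG⟩ }

end Construction

/-! ### Volume bounds for nearly isometric maps -/

/-- A lower bound for the volume of the unit ball at the image of `x` under a map that distorts
lengths by a factor of at most `2`. -/
def lowerVol (n : ℕ) {M : Type*} [EMetricSpace M] [MeasurableSpace M] [BorelSpace M] (x : M) :
    ℝ≥0∞ :=
  (2 ^ n)⁻¹ * riemVol n (Metric.eball x 2⁻¹)

/-- An upper bound for the volume of the unit ball at the image of `x` under a map that distorts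
lengths by a factor of at most `2`. -/
def upperVol (n : ℕ) {M : Type*} [EMetricSpace M] [MeasurableSpace M] [BorelSpace M] (x : M) :
    ℝ≥0∞ :=
  2 ^ n * riemVol n (Metric.eball x 2)

section Bounds

variable {n : ℕ} {M : Type*} [EMetricSpace M] [MeasurableSpace M] [BorelSpace M]

theorem lowerSemicontinuous_lowerVol : LowerSemicontinuous (lowerVol n : M → ℝ≥0∞) :=
  (ENNReal.continuous_const_mul (by simp)).comp_lowerSemicontinuous
    (lowerSemicontinuous_measure_eball _ _) fun _ _ h => mul_le_mul_right h _

theorem exists_isCompact_upperVol_le [CompleteSpace M] [SecondCountableTopology M]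
    [LocallyCompactSpace M] [IsPathMetric M] (hvol : riemVol n (univ : Set M) < ⊤) {δ : ℝ≥0∞}
    (hδ : 0 < δ) : ∃ G : Set M, IsCompact G ∧ ∀ x ∉ G, upperVol n x ≤ δ := by
  obtain ⟨G, hG, hGδ⟩ := exists_isCompact_measure_eball_le (riemVol n : Measure M) hvol 2
    (ENNReal.div_pos hδ.ne' (ENNReal.pow_ne_top ENNReal.ofNat_ne_top : (2 : ℝ≥0∞) ^ n ≠ ⊤))
  refine ⟨G, hG, fun x hx => ?_⟩
  have := hGδ x hx
  rw [ENNReal.ofReal_ofNat] at this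
  rw [upperVol, mul_comm]
  exact ENNReal.mul_le_of_le_div this

theorem VolumeCore.unitBallVol_le {J : Type*} {𝓔 : EndData M J} {ε lm l0 lp : ℝ} {s : ℕ}
    {L Q I I' T : Set M} {R : J → Set M}
    (h : VolumeCore 𝓔 (lowerVol n) (upperVol n) ε lm l0 lp s L Q I I' T R) (j : J) :
    ∀ x ∈ 𝓔.E j s, unitBallVol n x ≤ ENNReal.ofReal (l0 * ε) := fun x hx =>
  le_trans ((measure_mono (Metric.eball_subset_eball one_le_two)).trans
    (le_mul_of_one_le_left' (one_le_pow₀ one_le_two))) (h.le_E j x hx)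

variable [SecondCountableTopology M] [ChartedSpace (EuclideanSpace ℝ (Fin n)) M]
  [IsManifold (𝓡 n) 1 M] [RiemannianBundle (fun x : M ↦ TangentSpace (𝓡 n) x)]
  [IsRiemannianManifold (𝓡 n) M]

theorem lowerVol_pos [NeZero n] [IsContinuousRiemannianBundle (EuclideanSpace ℝ (Fin n))
    (fun x : M ↦ TangentSpace (𝓡 n) x)] (x : M) : 0 < lowerVol n x := by
  have := riemVol_eball_pos (n := n) x (r := 2⁻¹) ⟨by norm_num, by norm_num⟩
  rw [ENNReal.ofReal_inv_of_pos two_pos, ENNReal.ofReal_ofNat] at this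
  exact ENNReal.mul_pos (by simp) this.ne'

variable [CompleteSpace M] {P : Type*} [EMetricSpace P] [SecondCountableTopology P]
  [MeasurableSpace P] [BorelSpace P] [ChartedSpace (EuclideanSpace ℝ (Fin n)) P]
  [RiemannianBundle (fun x : P ↦ TangentSpace (𝓡 n) x)]
  [IsRiemannianManifold (𝓡 n) P]
  {J : Type*} {𝓔 : EndData M J} {ε lm l0 lp : ℝ} {s : ℕ} {L Q I I' T : Set M} {R : J → Set M}

theorem VolumeCore.coreFit_of_enorm_le
    (h : VolumeCore 𝓔 (lowerVol n) (upperVol n) ε lm l0 lp s L Q I I' T R) {f : M → P} {O : Set M}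
    (hO : IsOpen O) (hTO : ∀ x ∈ T, Metric.eball x 2 ⊆ O) (hf : ContMDiffOn (𝓡 n) (𝓡 n) 1 f O)
    (hinj : InjOn f O)
    (hle : ∀ x ∈ O, ∀ w : TangentSpace (𝓡 n) x, ‖mfderiv (𝓡 n) (𝓡 n) f x w‖ₑ ≤ 2 * ‖w‖ₑ)
    (hge : ∀ x ∈ O, ∀ w : TangentSpace (𝓡 n) x, ‖w‖ₑ ≤ 2 * ‖mfderiv (𝓡 n) (𝓡 n) f x w‖ₑ) :
    CoreFit n (fun j => 𝓔.E j 0) f ε lm l0 lp L Q I I' R := by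
  have hTO' : T ⊆ O := fun x hx => hTO x hx (Metric.mem_eball_self two_pos)
  refine h.coreFit (fun x hx => hf.continuousOn.continuousAt (hO.mem_nhds (hTO' hx)))
    (hinj.mono hTO') (fun U hU hUo => isOpen_image_of_enorm_le (C := 2) hUo
      (hf.mono (hU.trans hTO')) fun x hx => hge x (hTO' (hU hx))) (fun x hx => ?_) fun x hx => ?_
  · rw [lowerVol, mul_comm, ← div_eq_mul_inv]
    refine ENNReal.div_le_of_le_mul' ?_
    exact riemVol_eball_half_le_unitBallVol n hO hf hinj hle hge
      ((Metric.eball_subset_eball one_le_two).trans (hTO x hx))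
  · exact unitBallVol_le_riemVol_eball_two n hO hf hinj hle hge (hTO x hx)

theorem VolumeCore.coreFit_id
    (h : VolumeCore 𝓔 (lowerVol n) (upperVol n) ε lm l0 lp s L Q I I' T R) :
    CoreFit n (fun j => 𝓔.E j 0) (id : M → M) ε lm l0 lp L Q I I' R := by
  have hw : ∀ (x : M) (w : TangentSpace (𝓡 n) x), ‖w‖ₑ ≤ 2 * ‖w‖ₑ := fun x w => by
    rw [two_mul]
    exact le_add_self
  refine h.coreFit_of_enorm_le isOpen_univ (fun _ _ => subset_univ _) contMDiff_id.contMDiffOn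
    (injOn_id _) (fun x _ w => ?_) fun x _ w => ?_ <;>
  · rw [mfderiv_id]
    exact hw x w

/-- The convergence provides nearly isometric embeddings of every compact set. -/
theorem VolumeCore.eventually_coreFit [NeZero n]
    [IsContinuousRiemannianBundle (EuclideanSpace ℝ (Fin n)) (fun x : M ↦ TangentSpace (𝓡 n) x)]
    (h : VolumeCore 𝓔 (lowerVol n) (upperVol n) ε lm l0 lp s L Q I I' T R) {α : ℝ≥0}
    {N : ℕ → Type*} [∀ k, EMetricSpace (N k)] [∀ k, SecondCountableTopology (N k)]
    [∀ k, MeasurableSpace (N k)] [∀ k, BorelSpace (N k)]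
    [∀ k, ChartedSpace (EuclideanSpace ℝ (Fin n)) (N k)]
    [∀ k, RiemannianBundle (fun x : N k ↦ TangentSpace (𝓡 n) x)]
    [∀ k, IsRiemannianManifold (𝓡 n) (N k)] (hN : VolumeExhaustedTendsto n α N M) :
    ∀ᶠ k in atTop, ∃ f : M → N k,
      CoreFit n (fun j => 𝓔.E j 0) f ε lm l0 lp L Q I I' R := by
  have := isPathMetric_of_isRiemannianManifold (𝓡 n) M
  have : LocallyCompactSpace M := Manifold.locallyCompact_of_finiteDimensional (𝓡 n)
  -- Balls of radius `2` around `T` have to lie in an open set on which the distortion bound holds;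
  -- radius `3` leaves room for it inside a compact set.
  have hT₃ := h.isCompact_T.cthickening_of_isPathMetric 3
  obtain ⟨η, hη, hTη⟩ := exists_subset_volCollapse (n := n) hT₃
  obtain ⟨Ω, hΩ, hηΩ, k₀, f, hf, hconv⟩ := hN η hη
  obtain ⟨j₀, hj₀⟩ := eventually_atTop.1 (hconv.eventually_enorm_le hΩ
    (fun j => (hf j).1.1.1) hT₃ (hTη.trans hηΩ))
  refine eventually_atTop.2 ⟨k₀ + j₀, fun k hk => ?_⟩
  obtain ⟨j, rfl⟩ : ∃ j, k = k₀ + j := ⟨k - k₀, by omega⟩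
  have hbd := hj₀ j (by omega)
  have hsub := Metric.thickening_subset_cthickening 3 T
  have hOΩ : Metric.thickening 3 T ⊆ Ω := hsub.trans (hTη.trans hηΩ)
  refine ⟨f j, h.coreFit_of_enorm_le Metric.isOpen_thickening (fun x hx y hy => ?_)
    ((hf j).1.1.1.mono hOΩ) ?_ (fun x hx w => (hbd x (hsub hx) w).1)
    fun x hx w => (hbd x (hsub hx) w).2⟩
  · refine (Metric.mem_thickening_iff_exists_edist_lt _ _).2 ⟨x, hx, lt_of_lt_of_le hy ?_⟩
    rw [ENNReal.ofReal_ofNat]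
    norm_num
  · exact (injOn_iff_injective.2 (hf j).1.2.2.injective).mono hOΩ

end Bounds

end

/-! ### The theorem. -/

theorem mainTheorem5 {n : ℕ} [NeZero n]
    {M : Type*} [EMetricSpace M] [SecondCountableTopology M] [MeasurableSpace M] [BorelSpace M]
    [ChartedSpace (EuclideanSpace ℝ (Fin n)) M] [IsManifold (𝓡 n) ∞ M]
    [RiemannianBundle (fun x : M ↦ TangentSpace (𝓡 n) x)]
    [IsContinuousRiemannianBundle (EuclideanSpace ℝ (Fin n))
      (fun x : M ↦ TangentSpace (𝓡 n) x)]
    [IsRiemannianManifold (𝓡 n) M] [CompleteSpace M]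
    (hends : IsManifoldWithFinitelyManyEnds n M)
    (hvol : riemVol n (univ : Set M) < ⊤) :
    ∃ ε₀ : ℝ, 0 < ε₀ ∧ ∀ ε : ℝ, 0 < ε → ε < ε₀ →
      ∃ lamMinus lamZero lamPlus : ℝ,
        0 < lamMinus ∧ lamMinus < lamZero ∧ lamZero < 1 ∧ 1 < lamPlus ∧
        -- the graph of the limit is finite, and is the star graph of components and ends
        Finite (collapsingVertices n M ε lamMinus lamZero lamPlus) ∧
        (∃ Φ : collapsingGraph n M ε lamMinus lamZero lamPlus ≃g endStarGraph M,
          -- the center that belongs to a component of the manifold is contained in it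
          (∀ Z N, Φ Z = Sum.inl N → Z.1 ⊆ N.1) ∧
          -- a leaf that belongs to an end is a neighborhood of this end in its component
          (∀ Z e, Φ Z = Sum.inr e → Z.1 ⊆ e.component.1 ∧ ∃ K, e.1 K ⊆ Z.1) ∧
          -- the centers are the vertices with positive minimal volume, the leaves the others
          (∀ Z, (∃ N, Φ Z = Sum.inl N) ↔ 0 < vMin n Z.1) ∧
          (∀ Z, (∃ e, Φ Z = Sum.inr e) ↔ vMin n Z.1 = 0)) ∧
        -- the graph morphisms for large indices
        ∀ (α : ℝ≥0) (_ : 0 < α) (_ : α < 1)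
          (N : ℕ → Type*) [∀ k, EMetricSpace (N k)] [∀ k, SecondCountableTopology (N k)]
          [∀ k, MeasurableSpace (N k)] [∀ k, BorelSpace (N k)]
          [∀ k, ChartedSpace (EuclideanSpace ℝ (Fin n)) (N k)] [∀ k, IsManifold (𝓡 n) ∞ (N k)]
          [∀ k, RiemannianBundle (fun x : N k ↦ TangentSpace (𝓡 n) x)]
          [∀ k, IsContinuousRiemannianBundle (EuclideanSpace ℝ (Fin n))
            (fun x : N k ↦ TangentSpace (𝓡 n) x)]
          [∀ k, IsRiemannianManifold (𝓡 n) (N k)] [∀ k, CompleteSpace (N k)],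
          (∀ k, riemVol n (univ : Set (N k)) < ⊤) →
          VolumeExhaustedTendsto n α N M →
          ∀ᶠ k in atTop, ∃ φ : collapsingGraph n M ε lamMinus lamZero lamPlus →g
              collapsingGraph n (N k) ε lamMinus lamZero lamPlus,
            InjOn φ {Z | 0 < vMin n Z.1} := by
  have := isPathMetric_of_isRiemannianManifold (𝓡 n) M
  have : LocallyCompactSpace M := Manifold.locallyCompact_of_finiteDimensional (𝓡 n)
  have : LocallyPathConnectedSpace M :=
    ChartedSpace.locallyPathConnectedSpace (EuclideanSpace ℝ (Fin n)) M
  have : IsManifold (𝓡 n) 1 M := IsManifold.of_le (n := ∞) (by simp)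
  obtain ⟨J, _, ⟨𝓔⟩⟩ := hends.exists_endData
  obtain ⟨ε₀, hε₀, hcore⟩ := exists_volumeCore 𝓔 (lowerSemicontinuous_lowerVol (n := n))
    lowerVol_pos fun _ hδ => exists_isCompact_upperVol_le hvol hδ
  refine ⟨ε₀, hε₀, fun ε hε hεε₀ => ?_⟩
  obtain ⟨lm, l0, lp, s, L, Q, I, I', T, R, h⟩ := hcore ε hε hεε₀
  have hfit := h.coreFit_id
  obtain ⟨Φ, hΦ⟩ := hfit.exists_iso hvol h.lt_one h.core_subset h.R_subset h.unitBallVol_le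
  have hcenter : ∀ Z N, Φ.symm Z = Sum.inl N → Z.1 = hfit.center N := by
    rintro Z N hZ
    rw [← Φ.apply_symm_apply Z, hZ, hΦ]
    rfl
  have hleaf : ∀ Z e, Φ.symm Z = Sum.inr e → Z.1 = hfit.leaf (𝓔.equivSpaceEnd.symm e) := by
    rintro Z e hZ
    rw [← Φ.apply_symm_apply Z, hZ, hΦ]
    rfl
  have hpos : ∀ Z N, Φ.symm Z = Sum.inl N → 0 < vMin n Z.1 := fun Z N hZ => by
    rw [hcenter Z N hZ]
    exact hfit.vMin_center_pos N
  have hzero : ∀ Z e, Φ.symm Z = Sum.inr e → vMin n Z.1 = 0 := fun Z e hZ => by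
    rw [hleaf Z e hZ]
    exact hfit.vMin_leaf hvol h.R_subset h.unitBallVol_le _
  have hinl : ∀ Z, 0 < vMin n Z.1 → ∃ N, Φ.symm Z = Sum.inl N := by
    intro Z hZ
    rcases hZ' : Φ.symm Z with N | e
    · exact ⟨N, rfl⟩
    · exact absurd (hzero Z e hZ') hZ.ne'
  refine ⟨lm, l0, lp, h.lm_pos, h.lm_lt, h.lt_one, h.lt_lp, ?_,
    ⟨Φ.symm, fun Z N hZ => ?_, fun Z e hZ => ⟨?_, 𝓔.core s, ?_⟩,
      fun Z => ⟨fun ⟨N, hN⟩ => hpos Z N hN, hinl Z⟩, fun Z => ⟨fun ⟨e, he⟩ => hzero Z e he, ?_⟩⟩, ?_⟩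
  · have := finite_spaceComponent_of_isCompact h.isCompact_Q fun N hN => (h.isConnected_Q N hN).nonempty
    have := Finite.of_equiv J 𝓔.equivSpaceEnd
    exact Finite.of_equiv _ Φ.toEquiv
  · rw [hcenter Z N hZ]
    exact hfit.center_subset_component N
  · rw [hleaf Z e hZ]
    exact hfit.leaf_subset_component e
  · obtain ⟨j, rfl⟩ := 𝓔.equivSpaceEnd.surjective e
    rw [hleaf Z _ hZ, Equiv.symm_apply_apply]
    -- At the compact set `core s` the end takes exactly the value `E j s`, which lies in the leaf.
    refine Eq.trans_subset (𝓔.toSpaceEnd_core j s) ?_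
    exact hfit.E_subset_leaf h.R_subset h.unitBallVol_le j
  · intro hZ
    rcases hZ' : Φ.symm Z with N | e
    · exact absurd hZ (hpos Z N hZ').ne'
    · exact ⟨e, rfl⟩
  · intro α _ _ N _ _ _ _ _ _ _ _ _ _ hvolN hN
    filter_upwards [h.eventually_coreFit hN] with k ⟨f, hf⟩
    have := isPathMetric_of_isRiemannianManifold (𝓡 n) (N k)
    have : LocallyCompactSpace (N k) := Manifold.locallyCompact_of_finiteDimensional (𝓡 n)
    -- Vertices of positive minimal volume are centers, and distinct centers have distinct images.
    refine ⟨(hf.starHom (hvolN k)).comp Φ.symm.toHom, fun Z hZ Z' hZ' heq => ?_⟩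
    obtain ⟨N₁, hN₁⟩ := hinl Z hZ
    obtain ⟨N₂, hN₂⟩ := hinl Z' hZ'
    refine Φ.symm.injective ?_
    have heq' : hf.vertexMap (Φ.symm Z) = hf.vertexMap (Φ.symm Z') := heq
    rw [hN₁, hN₂] at heq' ⊢
    exact congrArg _ (hf.center_injective (congrArg Subtype.val heq'))
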